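/- \textbf{Theorem.} For a sequence $(a_n)_{n\ge 0}$ of positive integers let $[0;a_0,a_1,\dots]$ denote the corresponding infinite continued fraction. For $\theta=(a_n)_{n\in\mathbb Z}\in(\mathbb N^*)^{\mathbb Z}$ put $f(\theta)=[a_0;a_1,a_2,\dots]+[0;a_{-1},a_{-2},\dots]$ and $m(\theta)=\sup_{n\in\mathbb Z} f(\sigma^n\theta)\in(0,\infty]$, where $\sigma$ is the left shift, and for real $t$ let $\Sigma_t=\{\theta: m(\theta)\le t\}$ and $K_t^+=\{[0;a_0,a_1,\dots]:(a_n)_{n\in\mathbb Z}\in\Sigma_t\}$. Let $$\Delta^+(t)=\limsup_{r\to 0^+}\frac{\log N_{K_t^+}(r)}{\log(1/r)}$$ be the (upper) box-counting dimension of $K_t^+$, where $N_X(r)$ is the least number of intervals of length at most $r$ needed to cover $X$. Let $HD$ denote Hausdorff dimension and let $d(t)=HD(L\cap(-\infty,t))$, where $L=\{\ell(\alpha):\alpha\in\mathbb R\setminus\mathbb Q,\ \ell(\alpha)<\infty\}$, $\ell(\alpha)=\limsup_{q\to\infty,\,p\in\mathbb Z}\frac{1}{|q(q\alpha-p)|}$,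 is the Lagrange spectrum. For a finite set $B$ of at least two nonempty finite words of positive integers, none of which begins by another one, let $\Sigma(B)\subset(\mathbb N^*)^{\mathbb Z}$ be the set of all bi-infinite concatenations $\dots\gamma_{-1}\gamma_0\gamma_1\dots$ with $\gamma_i\in B$ for all $i$ ($\gamma_0$ starting at position $0$), and let $K(B)=\{[0;\gamma_0,\gamma_1,\gamma_2,\dots]:\gamma_i\in B\ \forall i\}$ be the associated Gauss--Cantor set. Let $\eta>0$ and $3\le t<5$ with $d(t)>0$. Then there are $\delta>0$ and such a set of words $B$ with $\Sigma(B)\subset\{1,2,3,4\}^{\mathbb Z}$, $$\Sigma(B)\subset\Sigma_{t-\delta}\quad\text{and}\quad HD(K(B))\ge(1-\eta)\,\Delta^+(t).$$ -/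

import Mathlib

open Filter Topology

namespace GaussCantor

noncomputable section

/-- The finite continued fraction `[0; a 0, a 1, …, a (n-1)]`. -/
def cfConv : ℕ → (ℕ → ℕ+) → ℝ
  | 0, _ => 0
  | n + 1, a => 1 / (((a 0 : ℕ) : ℝ) + cfConv n (fun k => a (k + 1)))

/-- The infinite continued fraction `[0; a 0, a 1, a 2, …]`, the limit of its convergents
(the limit always exists, see `tendsto_cfConv`). -/
def cfVal (a : ℕ → ℕ+) : ℝ :=
  limUnder atTop (fun n => cfConv n a)

theorem cfConv_mem (n : ℕ) (a : ℕ → ℕ+) : 0 ≤ cfConv n a ∧ cfConv n a ≤ 1 := by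
  induction n generalizing a with
  | zero => simp [cfConv]
  | succ n ih =>
    have h := (ih (fun k => a (k + 1))).1
    have h1 : (1 : ℝ) ≤ ((a 0 : ℕ) : ℝ) := by exact_mod_cast (a 0).pos
    constructor
    · simp only [cfConv]; positivity
    · simp only [cfConv]
      rw [div_le_one (by linarith)]
      linarith

theorem abs_cfConv_sub_le (n k : ℕ) (a : ℕ → ℕ+) :
    |cfConv (n + k) a - cfConv n a| ≤ 1 / ((n : ℝ) + 1) := by
  induction n generalizing a with
  | zero =>
    have h := cfConv_mem k a
    simp only [zero_add, cfConv, sub_zero, abs_of_nonneg h.1]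
    simpa using h.2
  | succ n ih =>
    have h := ih (fun j => a (j + 1))
    have hx := cfConv_mem (n + k) (fun j => a (j + 1))
    have hy := cfConv_mem n (fun j => a (j + 1))
    have h1 : (1 : ℝ) ≤ ((a 0 : ℕ) : ℝ) := by exact_mod_cast (a 0).pos
    rw [show n + 1 + k = (n + k) + 1 by ring]
    simp only [cfConv]
    generalize cfConv (n + k) (fun j => a (j + 1)) = x at *
    generalize cfConv n (fun j => a (j + 1)) = y at *
    generalize ((a 0 : ℕ) : ℝ) = c at *
    have hn : (0 : ℝ) ≤ n := Nat.cast_nonneg n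
    have hcx : 0 < c + x := by linarith
    have hcy : 0 < c + y := by linarith
    have e : 1 / (c + x) - 1 / (c + y) = (y - x) / ((c + x) * (c + y)) := by
      field_simp
      ring
    rw [e, abs_div, abs_of_pos (mul_pos hcx hcy), abs_sub_comm y x]
    rw [le_div_iff₀ (by positivity)] at h
    push_cast
    rw [div_le_div_iff₀ (mul_pos hcx hcy) (by positivity)]
    have hle : |x - y| ≤ x + y := by
      rw [abs_le]; constructor <;> linarith
    have hprod : 1 + x + y ≤ (c + x) * (c + y) := by
      nlinarith [mul_nonneg hx.1 hy.1]
    nlinarith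

theorem tendsto_cfConv (a : ℕ → ℕ+) :
    Tendsto (fun n => cfConv n a) atTop (𝓝 (cfVal a)) := by
  refine CauchySeq.tendsto_limUnder (cauchySeq_of_le_tendsto_0'
    (fun n : ℕ => 1 / ((n : ℝ) + 1)) ?_ tendsto_one_div_add_atTop_nhds_zero_nat)
  intro n m hnm
  obtain ⟨k, rfl⟩ := Nat.exists_eq_add_of_le hnm
  rw [dist_comm, Real.dist_eq]
  exact abs_cfConv_sub_le n k a

/-- The best constant of Diophantine approximation of `α`: the upper limit of
`1 / |q (q α - p)|` over integers `p` and denominators `q → ∞`. -/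
def bestConst (α : ℝ) : EReal :=
  limsup (fun x : ℤ × ℕ => ((1 / |(x.2 : ℝ) * ((x.2 : ℝ) * α - (x.1 : ℝ))| : ℝ) : EReal))
    (comap Prod.snd atTop)

/-- The Lagrange spectrum: the finite best constants of irrational numbers. -/
def lagrangeSpectrum : Set ℝ :=
  {x | ∃ α : ℝ, Irrational α ∧ bestConst α = (x : EReal)}

/-- `d(t)`, the Hausdorff dimension of the part of the Lagrange spectrum below `t`. -/
def dimLagrange (t : ℝ) : ENNReal :=
  dimH (lagrangeSpectrum ∩ Set.Iio t)

/-- The height `[a₀; a₁, a₂, …] + [0; a₋₁, a₋₂, …]` of a bi-infinite sequence. -/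
def height (θ : ℤ → ℕ+) : ℝ :=
  (((θ 0 : ℕ) : ℝ) + cfVal (fun n : ℕ => θ ((n : ℤ) + 1))) +
    cfVal (fun n : ℕ => θ (-((n : ℤ) + 1)))

/-- The Markov value `m(θ)`: the supremum of the height along the orbit of `θ` under the shift. -/
def markovValue (θ : ℤ → ℕ+) : EReal :=
  ⨆ n : ℤ, (height (fun k => θ (k + n)) : EReal)

/-- `Σ_t`, the sequences of Markov value at most `t`. -/
def sigmaLe (t : ℝ) : Set (ℤ → ℕ+) :=
  {θ | markovValue θ ≤ (t : EReal)}

/-- The set of all `[0; θ₀, θ₁, θ₂, …]` with `θ` in `S`: the projection of `S` to the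
nonnegative coordinates, read as continued fractions. -/
def cfProj (S : Set (ℤ → ℕ+)) : Set ℝ :=
  (fun θ : ℤ → ℕ+ => cfVal (fun n : ℕ => θ (n : ℤ))) '' S

/-- `N_X(r)`: the least number of intervals of length at most `r` needed to cover `X`
(they may be enlarged to have length exactly `r`); it is `⊤` if finitely many do not suffice. -/
def boxCount (X : Set ℝ) (r : ℝ) : ℕ∞ :=
  ⨅ (s : Finset ℝ) (_ : X ⊆ ⋃ a ∈ s, Set.Icc a (a + r)), (s.card : ℕ∞)

/-- The (upper) box-counting dimension of a set of reals. -/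
def boxDim (X : Set ℝ) : EReal :=
  limsup (fun r : ℝ => ENNReal.log (boxCount X r : ENNReal) / ((Real.log (1 / r) : ℝ) : EReal))
    (𝓝[>] 0)

/-- `Δ⁺(t)`, the box-counting dimension of the projection of `Σ_t`. -/
def deltaPlus (t : ℝ) : EReal :=
  boxDim (cfProj (sigmaLe t))

/-- The alphabets of Gauss–Cantor sets: at least two nonempty finite words of positive
integers, none of which begins by another one. -/
structure IsAlphabet (B : Finset (List ℕ+)) : Prop where
  two_le_card : 2 ≤ B.card
  ne_nil : ∀ β ∈ B, β ≠ []
  prefix_free : ∀ β ∈ B, ∀ γ ∈ B, β ≠ γ → ¬ γ <+: β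

/-- `Σ(B)`: the bi-infinite concatenations `… γ₋₁ γ₀ γ₁ …` of words of `B`, the word `γ i`
occupying the positions `c i, …, c (i + 1) - 1` and `γ 0` starting at position `0`. -/
def completeShift (B : Finset (List ℕ+)) : Set (ℤ → ℕ+) :=
  {θ | ∃ (γ : ℤ → List ℕ+) (c : ℤ → ℤ), (∀ i, γ i ∈ B) ∧ c 0 = 0 ∧
    (∀ i, c (i + 1) = c i + ((γ i).length : ℤ)) ∧
    ∀ (i : ℤ) (k : ℕ) (hk : k < (γ i).length), θ (c i + (k : ℤ)) = (γ i)[k]}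

/-- `K(B)`: the numbers `[0; γ₀, γ₁, γ₂, …]` with all `γ i` in `B`. -/
def gaussCantorSet (B : Finset (List ℕ+)) : Set ℝ :=
  cfProj (completeShift B)

end

end GaussCantor

/-!
Cover `K_t⁺` at scale `R⁻²` by the words of the language of `Σ_t` whose continuants have just
reached `R`, the blocks. Long admissible words are concatenations of `k` blocks, and there are about
`R ^ (2 k Δ⁺(t))` of them. In most of them most blocks are flanked: if what precedes (or follows)
the block is kept, then it can be replaced both by a block that increases the value of the
continued fraction and by one that decreases it. By the pigeonhole principle there are a pair `a b`
of flanked blocks and a length such that nearly the expected number of words `m` of this length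
occur as `a b m a b`.

The words `b m a` can then be concatenated freely. In `… a b m a b …` the height at a letter of `a`
or `b` is compared with the height in a sequence of `Σ_t` that agrees with the concatenation around
this letter, except that a flanked block has been replaced, on the side where the agreement is
shorter, by one that increases the value. The gain on that side outweighs the possible loss on the
other one, so that the height in the concatenation is smaller than `t` by a definite amount. The
dimension of the Gauss–Cantor set is bounded below by a Hölder map onto `[0, 1]` that reads off the
digits `b m a`.

Finally `Δ⁺(t) > 0`: up to an integer, a point of the Lagrange spectrum below `t` is a sum of two
points of `K_t⁺`, and the sumset of a set of box-counting dimension `0` has dimension `0`.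
-/

namespace GaussCantor

noncomputable section

/-! ### Continuants -/

/-- The product of the matrices `!![a, 1; 1, 0]` along a word. Its columns are the last two pairs
(denominator, numerator) of convergents of `[0; w]`. -/
def continuantMatrix : List ℕ+ → Matrix (Fin 2) (Fin 2) ℕ
  | [] => 1
  | a :: w => !![(a : ℕ), 1; 1, 0] * continuantMatrix w

/-- The continuant of a word: the denominator of `[0; w]`. -/
def continuant (w : List ℕ+) : ℕ := continuantMatrix w 0 0

theorem continuantMatrix_append (u v : List ℕ+) :
    continuantMatrix (u ++ v) = continuantMatrix u * continuantMatrix v := by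
  induction u with
  | nil => simp [continuantMatrix]
  | cons a u ih => simp [continuantMatrix, ih]

theorem continuantMatrix_reverse (u : List ℕ+) :
    continuantMatrix u.reverse = (continuantMatrix u).transpose := by
  induction u with
  | nil => simp [continuantMatrix]
  | cons a u ih =>
    rw [List.reverse_cons, continuantMatrix_append, ih]
    simp only [continuantMatrix, Matrix.transpose_mul, mul_one]
    congr 1
    ext i j
    fin_cases i <;> fin_cases j <;> rfl

@[simp]
theorem continuantMatrix_cons_zero (a : ℕ+) (w : List ℕ+) (j : Fin 2) :
    continuantMatrix (a :: w) 0 j = a * continuantMatrix w 0 j + continuantMatrix w 1 j := by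
  simp [continuantMatrix, Matrix.mul_apply, Fin.sum_univ_two]

@[simp]
theorem continuantMatrix_cons_one (a : ℕ+) (w : List ℕ+) (j : Fin 2) :
    continuantMatrix (a :: w) 1 j = continuantMatrix w 0 j := by
  simp [continuantMatrix, Matrix.mul_apply, Fin.sum_univ_two]

@[simp]
theorem continuant_nil : continuant [] = 1 := by simp [continuant, continuantMatrix]

theorem continuant_reverse (u : List ℕ+) : continuant u.reverse = continuant u := by
  simp [continuant, continuantMatrix_reverse]

theorem continuant_pos (w : List ℕ+) : 0 < continuant w := by
  induction w with
  | nil => simp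
  | cons a w ih =>
    rw [continuant, continuantMatrix_cons_zero]
    exact Nat.add_pos_left (Nat.mul_pos a.pos ih) _

theorem continuantMatrix_one_zero_le (w : List ℕ+) : continuantMatrix w 1 0 ≤ continuant w := by
  cases w with
  | nil => simp [continuantMatrix]
  | cons a w =>
    rw [continuant, continuantMatrix_cons_zero, continuantMatrix_cons_one]
    exact le_add_right (Nat.le_mul_of_pos_left _ a.pos)

theorem continuantMatrix_zero_one_le (w : List ℕ+) : continuantMatrix w 0 1 ≤ continuant w := by
  simpa [continuantMatrix_reverse, continuant_reverse] using
    continuantMatrix_one_zero_le w.reverse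

theorem continuant_append (u v : List ℕ+) :
    continuant (u ++ v) =
      continuant u * continuant v + continuantMatrix u 0 1 * continuantMatrix v 1 0 := by
  simp [continuant, continuantMatrix_append, Matrix.mul_apply, Fin.sum_univ_two]

theorem continuant_mul_le (u v : List ℕ+) : continuant u * continuant v ≤ continuant (u ++ v) :=
  continuant_append u v ▸ Nat.le_add_right _ _

theorem continuant_append_le (u v : List ℕ+) :
    continuant (u ++ v) ≤ 2 * (continuant u * continuant v) := by
  rw [continuant_append, two_mul]
  gcongr
  exacts [continuantMatrix_zero_one_le u, continuantMatrix_one_zero_le v]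

theorem continuant_le_of_infix {u v : List ℕ+} (h : u <:+: v) : continuant u ≤ continuant v := by
  obtain ⟨x, y, rfl⟩ := h
  calc continuant u ≤ continuant x * continuant u := Nat.le_mul_of_pos_left _ (continuant_pos x)
    _ ≤ continuant (x ++ u) := continuant_mul_le x u
    _ ≤ continuant (x ++ u) * continuant y := Nat.le_mul_of_pos_right _ (continuant_pos y)
    _ ≤ continuant (x ++ u ++ y) := continuant_mul_le _ y

theorem continuant_append_singleton_le (u : List ℕ+) (a : ℕ+) :
    continuant (u ++ [a]) ≤ (a + 1) * continuant u := by
  have hcol := continuantMatrix_zero_one_le u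
  have h00 : continuant [a] = a := by simp [continuant, continuantMatrix]
  have h10 : continuantMatrix [a] 1 0 = 1 := by simp [continuantMatrix]
  rw [continuant_append, h00, h10]
  linarith

theorem two_mul_continuant_le (a b : ℕ+) (w : List ℕ+) :
    2 * continuant w ≤ continuant (a :: b :: w) := by
  simp only [continuant, continuantMatrix_cons_zero, continuantMatrix_cons_one]
  have hab := Nat.mul_le_mul a.pos (Nat.mul_le_mul b.pos (le_refl (continuantMatrix w 0 0)))
  nlinarith [Nat.zero_le (a * continuantMatrix w 1 0)]

theorem two_pow_length_le (w : List ℕ+) : 2 ^ w.length ≤ 2 * continuant w ^ 2 := by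
  match w with
  | [] => simp
  | [a] =>
    have := continuant_pos [a]
    simp only [List.length_singleton]
    nlinarith
  | a :: b :: w =>
    calc 2 ^ (a :: b :: w).length = 4 * 2 ^ w.length := by simp [pow_succ]; ring
      _ ≤ 4 * (2 * continuant w ^ 2) := by gcongr; exact two_pow_length_le w
      _ = 2 * (2 * continuant w) ^ 2 := by ring
      _ ≤ 2 * continuant (a :: b :: w) ^ 2 := by gcongr; exact two_mul_continuant_le a b w

theorem coprime_continuant (w : List ℕ+) :
    Nat.Coprime (continuant w) (continuantMatrix w 1 0) := by
  induction w with
  | nil => simp [continuantMatrix]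
  | cons a w ih =>
    rw [continuant, continuantMatrix_cons_zero, continuantMatrix_cons_one,
      Nat.coprime_mul_right_add_left]
    exact ih.symm

/-! ### Continued fractions with a given initial word -/

theorem one_le_cast (a : ℕ+) : (1 : ℝ) ≤ ((a : ℕ) : ℝ) := Nat.one_le_cast.2 a.pos

/-- The number `[0; w₀, …, wₙ₋₁ + x]`, that is, `x` with the word `w` put in front of its continued
fraction expansion. -/
def cfPrepend : List ℕ+ → ℝ → ℝ
  | [], x => x
  | a :: w, x => 1 / (((a : ℕ) : ℝ) + cfPrepend w x)

/-- The denominator `qₙ + qₙ₋₁ x` of `[0; w₀, …, wₙ₋₁ + x]` as a Möbius transformation of `x`. -/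
def cfDenom (w : List ℕ+) (x : ℝ) : ℝ := continuant w + continuantMatrix w 0 1 * x

theorem cfPrepend_append (u v : List ℕ+) (x : ℝ) :
    cfPrepend (u ++ v) x = cfPrepend u (cfPrepend v x) := by
  induction u with
  | nil => rfl
  | cons a u ih => simp [cfPrepend, ih]

theorem one_div_add_mem_Icc {a x : ℝ} (ha : 1 ≤ a) (hx : 0 ≤ x) :
    1 / (a + x) ∈ Set.Icc (0 : ℝ) 1 :=
  ⟨by positivity, by rw [div_le_one (by linarith)]; linarith⟩

theorem cfPrepend_nonneg (w : List ℕ+) {x : ℝ} (hx : 0 ≤ x) : 0 ≤ cfPrepend w x := by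
  induction w with
  | nil => exact hx
  | cons a w ih => exact (one_div_add_mem_Icc (one_le_cast a) ih).1

theorem cfPrepend_mem_Icc (w : List ℕ+) {x : ℝ} (hx : x ∈ Set.Icc (0 : ℝ) 1) :
    cfPrepend w x ∈ Set.Icc (0 : ℝ) 1 := by
  cases w with
  | nil => exact hx
  | cons a w => exact one_div_add_mem_Icc (one_le_cast a) (cfPrepend_nonneg w hx.1)

theorem continuant_le_cfDenom (w : List ℕ+) {x : ℝ} (hx : 0 ≤ x) : continuant w ≤ cfDenom w x :=
  le_add_of_nonneg_right (by positivity)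

theorem cfDenom_pos (w : List ℕ+) {x : ℝ} (hx : 0 ≤ x) : 0 < cfDenom w x :=
  (Nat.cast_pos.2 (continuant_pos w)).trans_le (continuant_le_cfDenom w hx)

theorem cfDenom_le (w : List ℕ+) {x : ℝ} (hx : x ∈ Set.Icc (0 : ℝ) 1) :
    cfDenom w x ≤ 2 * continuant w := by
  have hcol : (continuantMatrix w 0 1 : ℝ) ≤ continuant w :=
    Nat.cast_le.2 (continuantMatrix_zero_one_le w)
  have := mul_le_mul hcol hx.2 hx.1 (Nat.cast_nonneg _)
  unfold cfDenom
  linarith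

theorem cfPrepend_mul_cfDenom (w : List ℕ+) {x : ℝ} (hx : 0 ≤ x) :
    cfPrepend w x * cfDenom w x = continuantMatrix w 1 0 + continuantMatrix w 1 1 * x := by
  induction w with
  | nil => simp [cfPrepend, cfDenom, continuantMatrix]
  | cons a w ih =>
    have hne : ((a : ℕ) : ℝ) + cfPrepend w x ≠ 0 := by
      linarith [one_le_cast a, cfPrepend_nonneg w hx]
    simp only [cfPrepend, cfDenom, continuant, continuantMatrix_cons_zero,
      continuantMatrix_cons_one] at ih ⊢
    push_cast
    field_simp
    linear_combination -ih

theorem cfDenom_cons (a : ℕ+) (w : List ℕ+) {x : ℝ} (hx : 0 ≤ x) :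
    cfDenom (a :: w) x = (((a : ℕ) : ℝ) + cfPrepend w x) * cfDenom w x := by
  rw [add_mul, cfPrepend_mul_cfDenom w hx]
  simp only [cfDenom, continuant, continuantMatrix_cons_zero]
  push_cast
  ring

theorem cfPrepend_sub_mul (w : List ℕ+) {x y : ℝ} (hx : 0 ≤ x) (hy : 0 ≤ y) :
    (cfPrepend w x - cfPrepend w y) * (cfDenom w x * cfDenom w y) =
      (-1) ^ w.length * (x - y) := by
  induction w with
  | nil => simp [cfPrepend, cfDenom, continuantMatrix]
  | cons a w ih =>
    have hX : ((a : ℕ) : ℝ) + cfPrepend w x ≠ 0 := by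
      linarith [one_le_cast a, cfPrepend_nonneg w hx]
    have hY : ((a : ℕ) : ℝ) + cfPrepend w y ≠ 0 := by
      linarith [one_le_cast a, cfPrepend_nonneg w hy]
    rw [cfDenom_cons a w hx, cfDenom_cons a w hy]
    simp only [cfPrepend, List.length_cons, pow_succ]
    field_simp
    linear_combination -ih

theorem abs_cfPrepend_sub_mul (w : List ℕ+) {x y : ℝ} (hx : 0 ≤ x) (hy : 0 ≤ y) :
    |cfPrepend w x - cfPrepend w y| * (cfDenom w x * cfDenom w y) = |x - y| := by
  have h := congrArg abs (cfPrepend_sub_mul w hx hy)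
  rwa [abs_mul, abs_mul ((-1) ^ _), abs_neg_one_pow, one_mul,
    abs_of_pos (mul_pos (cfDenom_pos w hx) (cfDenom_pos w hy))] at h

theorem abs_cfPrepend_sub_le (w : List ℕ+) {x y : ℝ} (hx : 0 ≤ x) (hy : 0 ≤ y) :
    |cfPrepend w x - cfPrepend w y| ≤ |x - y| / (continuant w : ℝ) ^ 2 := by
  have hq : (0 : ℝ) < continuant w := Nat.cast_pos.2 (continuant_pos w)
  rw [le_div_iff₀ (by positivity), ← abs_cfPrepend_sub_mul w hx hy, sq]
  gcongr
  exacts [(cfDenom_pos w hx).le, continuant_le_cfDenom w hx, continuant_le_cfDenom w hy]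

/-! ### Initial words of sequences -/

/-- The word of the first `n` terms of a sequence. -/
def initialWord (a : ℕ → ℕ+) (n : ℕ) : List ℕ+ := (List.range n).map a

@[simp]
theorem length_initialWord (a : ℕ → ℕ+) (n : ℕ) : (initialWord a n).length = n := by
  simp [initialWord]

@[simp]
theorem getElem_initialWord (a : ℕ → ℕ+) (n i : ℕ) (h : i < (initialWord a n).length) :
    (initialWord a n)[i] = a i := by
  simp [initialWord]

@[simp]
theorem initialWord_zero (a : ℕ → ℕ+) : initialWord a 0 = [] := rfl

theorem initialWord_succ (a : ℕ → ℕ+) (n : ℕ) :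
    initialWord a (n + 1) = initialWord a n ++ [a n] := by
  simp [initialWord, List.range_succ]

theorem initialWord_succ' (a : ℕ → ℕ+) (n : ℕ) :
    initialWord a (n + 1) = a 0 :: initialWord (fun k => a (k + 1)) n := by
  simp [initialWord, List.range_succ_eq_map, Function.comp_def]

theorem initialWord_add (a : ℕ → ℕ+) (m n : ℕ) :
    initialWord a (m + n) = initialWord a m ++ initialWord (fun k => a (k + m)) n := by
  simp [initialWord, List.range_add, Function.comp_def, add_comm]

theorem initialWord_eq_initialWord_iff {a b : ℕ → ℕ+} {n : ℕ} :
    initialWord a n = initialWord b n ↔ ∀ i < n, a i = b i := by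
  simp [initialWord]

theorem cfVal_mem_Icc (a : ℕ → ℕ+) : cfVal a ∈ Set.Icc (0 : ℝ) 1 :=
  isClosed_Icc.mem_of_tendsto (tendsto_cfConv a) (Eventually.of_forall fun n => cfConv_mem n a)

theorem cfVal_eq_one_div (a : ℕ → ℕ+) :
    cfVal a = 1 / (((a 0 : ℕ) : ℝ) + cfVal (fun k => a (k + 1))) := by
  have hne : ((a 0 : ℕ) : ℝ) + cfVal (fun k => a (k + 1)) ≠ 0 := by
    linarith [one_le_cast (a 0), (cfVal_mem_Icc fun k => a (k + 1)).1]
  exact tendsto_nhds_unique ((tendsto_cfConv a).comp (tendsto_add_atTop_nat 1))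
    (tendsto_const_nhds.div (tendsto_const_nhds.add (tendsto_cfConv _)) hne)

theorem cfVal_eq_cfPrepend (a : ℕ → ℕ+) (n : ℕ) :
    cfVal a = cfPrepend (initialWord a n) (cfVal (fun k => a (k + n))) := by
  induction n generalizing a with
  | zero => simp [cfPrepend]
  | succ n ih =>
    rw [initialWord_succ', cfPrepend, cfVal_eq_one_div a, ih (fun k => a (k + 1))]
    simp only [add_assoc, add_comm n 1]

theorem one_div_le_cfVal {A : ℕ} {a : ℕ → ℕ+} (h : (a 0 : ℕ) < A) : 1 / (A : ℝ) ≤ cfVal a := by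
  rw [cfVal_eq_one_div]
  have hA : ((a 0 : ℕ) : ℝ) + 1 ≤ A := by exact_mod_cast h
  have htail := cfVal_mem_Icc (fun k => a (k + 1))
  exact one_div_le_one_div_of_le (by linarith [one_le_cast (a 0), htail.1]) (by linarith [htail.2])

theorem abs_cfVal_sub_le {a b : ℕ → ℕ+} {n : ℕ} (h : initialWord a n = initialWord b n) :
    |cfVal a - cfVal b| ≤ 1 / (continuant (initialWord a n) : ℝ) ^ 2 := by
  have ha := cfVal_mem_Icc (fun k => a (k + n))
  have hb := cfVal_mem_Icc (fun k => b (k + n))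
  rw [cfVal_eq_cfPrepend a n, cfVal_eq_cfPrepend b n, ← h]
  refine (abs_cfPrepend_sub_le _ ha.1 hb.1).trans ?_
  gcongr
  exact abs_sub_le_of_nonneg_of_le ha.1 ha.2 hb.1 hb.2

theorem one_div_pow_three_le_cfVal_sub {A : ℕ} {a b : ℕ → ℕ+} (ha : (a 0 : ℕ) < A)
    (hb : ∀ i, (b i : ℕ) < A) (h : a 0 < b 0) : 1 / (A : ℝ) ^ 3 ≤ cfVal a - cfVal b := by
  rw [cfVal_eq_one_div a, cfVal_eq_one_div b]
  have hx := cfVal_mem_Icc (fun k => a (k + 1))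
  have hy := cfVal_mem_Icc (fun k => b (k + 1))
  have hy' : 1 / (A : ℝ) ≤ cfVal (fun k => b (k + 1)) := one_div_le_cfVal (hb 1)
  have haA : ((a 0 : ℕ) : ℝ) + 1 ≤ A := by exact_mod_cast ha
  have hbA : ((b 0 : ℕ) : ℝ) + 1 ≤ A := by exact_mod_cast hb 0
  have hab : ((a 0 : ℕ) : ℝ) + 1 ≤ (b 0 : ℕ) := by exact_mod_cast h
  have ha1 := one_le_cast (a 0)
  generalize cfVal (fun k => a (k + 1)) = x at *
  generalize cfVal (fun k => b (k + 1)) = y at *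
  generalize ((a 0 : ℕ) : ℝ) = c at *
  generalize ((b 0 : ℕ) : ℝ) = d at *
  have hc : 0 < c + x := by linarith [hx.1]
  have hd : 0 < d + y := by linarith [hy.1]
  have hA : 0 < (A : ℝ) := by linarith
  calc 1 / (A : ℝ) ^ 3 = 1 / A / (A * A) := by field_simp
    _ ≤ (d + y - (c + x)) / ((c + x) * (d + y)) := by
        gcongr <;> linarith [hx.2, hy.1, hy.2]
    _ = 1 / (c + x) - 1 / (d + y) := by field_simp

/-! ### The order of continued fractions -/

/-- A sequence begins with the word `u`. -/
def BeginsWith (a : ℕ → ℕ+) (u : List ℕ+) : Prop := initialWord a u.length = u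

theorem beginsWith_initialWord (a : ℕ → ℕ+) (n : ℕ) : BeginsWith a (initialWord a n) := by
  simp [BeginsWith]

theorem BeginsWith.prefix_or_prefix {a : ℕ → ℕ+} {u v : List ℕ+} (hu : BeginsWith a u)
    (hv : BeginsWith a v) : u <+: v ∨ v <+: u := by
  have hprefix (m n : ℕ) (h : m ≤ n) : initialWord a m <+: initialWord a n := by
    obtain ⟨d, rfl⟩ := Nat.exists_eq_add_of_le h
    exact ⟨_, (initialWord_add a m d).symm⟩
  rw [← hu, ← hv]
  exact (Nat.le_total _ _).imp (hprefix _ _) (hprefix _ _)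

theorem beginsWith_append {a : ℕ → ℕ+} {u v : List ℕ+} :
    BeginsWith a (u ++ v) ↔ BeginsWith a u ∧ BeginsWith (fun k => a (k + u.length)) v := by
  rw [BeginsWith, List.length_append, initialWord_add]
  exact ⟨fun h => List.append_inj h (by simp), fun h => congrArg₂ _ h.1 h.2⟩

theorem beginsWith_cons {a : ℕ → ℕ+} {c : ℕ+} {u : List ℕ+} :
    BeginsWith a (c :: u) ↔ a 0 = c ∧ BeginsWith (fun k => a (k + 1)) u := by
  rw [BeginsWith, List.length_cons, initialWord_succ', List.cons.injEq, BeginsWith]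

/-- `CfLT u v`: the words differ at some place, and every number `[0; u, …]` is smaller than
every number `[0; v, …]`. The first difference is at the index `p.length`, and a larger partial
quotient makes a continued fraction smaller at even indices and larger at odd ones. -/
def CfLT (u v : List ℕ+) : Prop :=
  ∃ (p u' v' : List ℕ+) (x y : ℕ+), u = p ++ x :: u' ∧ v = p ++ y :: v' ∧ x ≠ y ∧
    (x < y ↔ Odd p.length)

theorem CfLT.cons {u v : List ℕ+} (h : CfLT u v) (a : ℕ+) : CfLT (a :: v) (a :: u) := by
  obtain ⟨p, u', v', x, y, rfl, rfl, hne, hxy⟩ := h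
  refine ⟨a :: p, v', u', y, x, rfl, rfl, hne.symm, ?_⟩
  rw [List.length_cons, Nat.odd_add_one, ← hxy, not_lt]
  exact ⟨le_of_lt, fun h => lt_of_le_of_ne h hne.symm⟩

theorem CfLT.append {u v : List ℕ+} (h : CfLT u v) (z : List ℕ+) :
    (Even z.length → CfLT (z ++ u) (z ++ v)) ∧ (Odd z.length → CfLT (z ++ v) (z ++ u)) := by
  induction z with
  | nil => simpa using h
  | cons a z ih =>
    simp only [List.length_cons, Nat.even_add_one, Nat.odd_add_one, Nat.not_even_iff_odd,
      Nat.not_odd_iff_even, List.cons_append]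
    exact ⟨fun hz => (ih.2 hz).cons a, fun hz => (ih.1 hz).cons a⟩

theorem cfLT_or_cfLT {u v : List ℕ+} (hlen : u.length = v.length) (hne : u ≠ v) :
    CfLT u v ∨ CfLT v u := by
  induction u generalizing v with
  | nil => exact absurd (List.length_eq_zero_iff.1 hlen.symm).symm hne
  | cons a u ih =>
    cases v with
    | nil => simp at hlen
    | cons b v =>
      rcases lt_trichotomy a b with hlt | rfl | hlt
      · exact Or.inr ⟨[], v, u, b, a, rfl, rfl, hlt.ne', by simp [hlt.le]⟩
      · exact (ih (by simpa using hlen) (by simpa using hne)).symm.imp (·.cons a) (·.cons a)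
      · exact Or.inl ⟨[], u, v, a, b, rfl, rfl, hlt.ne', by simp [hlt.le]⟩

section BoundedLetters

variable {A : ℕ} {a b : ℕ → ℕ+} (ha : ∀ i, (a i : ℕ) < A) (hb : ∀ i, (b i : ℕ) < A)
include ha hb

theorem cfVal_add_le_of_beginsWith {p : List ℕ+} {x y : ℕ+} (hne : x ≠ y)
    (hxy : x < y ↔ Odd p.length) (hp : BeginsWith a p) (hp' : BeginsWith b p)
    (hx : a (0 + p.length) = x) (hy : b (0 + p.length) = y) :
    cfVal a + 1 / (4 * A ^ 3 * (continuant p : ℝ) ^ 2) ≤ cfVal b := by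
  set α := cfVal fun k => a (k + p.length)
  set β := cfVal fun k => b (k + p.length)
  have hα : α ∈ Set.Icc (0 : ℝ) 1 := cfVal_mem_Icc _
  have hβ : β ∈ Set.Icc (0 : ℝ) 1 := cfVal_mem_Icc _
  have htail : 1 / (A : ℝ) ^ 3 ≤ (-1) ^ p.length * (β - α) := by
    rcases Nat.even_or_odd p.length with heven | hodd
    · have hyx : y < x :=
        hne.symm.lt_of_le (not_lt.1 fun hlt => Nat.not_odd_iff_even.2 heven (hxy.1 hlt))
      rw [heven.neg_one_pow, one_mul]
      exact one_div_pow_three_le_cfVal_sub (hb _) (fun i => ha _) (by rwa [hx, hy])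
    · rw [hodd.neg_one_pow, neg_one_mul, neg_sub]
      exact one_div_pow_three_le_cfVal_sub (ha _) (fun i => hb _) (by rw [hx, hy]; exact hxy.2 hodd)
  have hdiff : (cfVal b - cfVal a) * (cfDenom p β * cfDenom p α) = (-1) ^ p.length * (β - α) := by
    rw [cfVal_eq_cfPrepend a p.length, cfVal_eq_cfPrepend b p.length,
      show initialWord a _ = p from hp, show initialWord b _ = p from hp']
    exact cfPrepend_sub_mul p hβ.1 hα.1
  have hpos := mul_pos (cfDenom_pos p hβ.1) (cfDenom_pos p hα.1)
  have hD : cfDenom p β * cfDenom p α ≤ (2 * continuant p) * (2 * continuant p) := by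
    gcongr
    exacts [(cfDenom_pos p hα.1).le, cfDenom_le p hβ, cfDenom_le p hα]
  rw [← le_sub_iff_add_le']
  calc 1 / (4 * A ^ 3 * (continuant p : ℝ) ^ 2)
      = 1 / (A : ℝ) ^ 3 / ((2 * continuant p) * (2 * continuant p)) := by rw [div_div]; ring
    _ ≤ (-1) ^ p.length * (β - α) / (cfDenom p β * cfDenom p α) := by
        gcongr
        exact le_trans (by positivity) htail
    _ = cfVal b - cfVal a := by rw [← hdiff, mul_div_cancel_right₀ _ hpos.ne']

theorem CfLT.cfVal_add_le {u v w : List ℕ+} (h : CfLT u v) (hu : BeginsWith a u)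
    (hv : BeginsWith b v) (hw : w = u ∨ w = v) :
    cfVal a + 1 / (4 * A ^ 3 * (continuant w : ℝ) ^ 2) ≤ cfVal b := by
  obtain ⟨p, u', v', x, y, rfl, rfl, hne, hxy⟩ := h
  obtain ⟨hap, hau⟩ := beginsWith_append.1 hu
  obtain ⟨hbp, hbv⟩ := beginsWith_append.1 hv
  have hpw : continuant p ≤ continuant w := by
    rcases hw with rfl | rfl <;> exact continuant_le_of_infix (List.prefix_append _ _).isInfix
  have hp := continuant_pos p
  have hA : 0 < A := (Nat.zero_le _).trans_lt (ha 0)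
  refine le_trans ?_ (cfVal_add_le_of_beginsWith ha hb hne hxy hap hbp
    (beginsWith_cons.1 hau).1 (beginsWith_cons.1 hbv).1)
  gcongr

theorem le_abs_cfVal_sub {n : ℕ} (h : initialWord a n ≠ initialWord b n) :
    1 / (4 * A ^ 3 * (continuant (initialWord a n) : ℝ) ^ 2) ≤ |cfVal a - cfVal b| := by
  rcases cfLT_or_cfLT (by simp) h with hlt | hlt
  · rw [abs_sub_comm]
    exact le_trans (le_sub_iff_add_le'.2 <| hlt.cfVal_add_le ha hb (beginsWith_initialWord a n)
      (beginsWith_initialWord b n) (.inl rfl)) (le_abs_self _)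
  · exact le_trans (le_sub_iff_add_le'.2 <| hlt.cfVal_add_le hb ha (beginsWith_initialWord b n)
      (beginsWith_initialWord a n) (.inr rfl)) (le_abs_self _)

end BoundedLetters

/-- `x` lies strictly between two elements of `S` for the relation `lt`. -/
def Flanked {α : Type*} (lt : α → α → Prop) (S : Set α) (x : α) : Prop :=
  (∃ y ∈ S, lt y x) ∧ ∃ y ∈ S, lt x y

theorem Flanked.mono {α : Type*} {lt : α → α → Prop} {S T : Set α} {x : α}
    (h : Flanked lt S x) (hST : S ⊆ T) : Flanked lt T x :=
  ⟨h.1.imp fun _ hy => ⟨hST hy.1, hy.2⟩, h.2.imp fun _ hy => ⟨hST hy.1, hy.2⟩⟩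

-- The parity of the length of `z` decides on which side a replacement increases the value.
theorem Flanked.exists_cfVal_add_le {A : ℕ} {z u : List ℕ+} {S : Set (List ℕ+)}
    (h : Flanked CfLT S u) :
    ∃ v ∈ S, ∀ a b : ℕ → ℕ+, (∀ i, (a i : ℕ) < A) → (∀ i, (b i : ℕ) < A) →
      BeginsWith a (z ++ u) → BeginsWith b (z ++ v) →
      cfVal a + 1 / (4 * A ^ 3 * (continuant (z ++ u) : ℝ) ^ 2) ≤ cfVal b := by
  obtain ⟨⟨v, hv, hvu⟩, v', hv', huv⟩ := h
  rcases Nat.even_or_odd z.length with hz | hz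
  · exact ⟨v', hv', fun a b ha hb hu hbv =>
      ((huv.append z).1 hz).cfVal_add_le ha hb hu hbv (.inl rfl)⟩
  · exact ⟨v, hv, fun a b ha hb hu hbv =>
      ((hvu.append z).2 hz).cfVal_add_le ha hb hu hbv (.inl rfl)⟩

/-! ### Words with many replaceable letters -/

section Words

open scoped Finset

variable {α : Type*}

/-- The words of length `k` with letters in the finite set `B`. -/
def words (B : Finset α) (k : ℕ) : Finset (List α) :=
  (Fintype.piFinset fun _ : Fin k => B).map ⟨List.ofFn, List.ofFn_injective⟩

theorem mem_words {B : Finset α} {k : ℕ} {w : List α} :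
    w ∈ words B k ↔ w.length = k ∧ ∀ x ∈ w, x ∈ B := by
  simp only [words, Finset.mem_map, Fintype.mem_piFinset, Function.Embedding.coeFn_mk]
  constructor
  · rintro ⟨f, hf, rfl⟩
    simpa [List.forall_mem_ofFn_iff] using hf
  · rintro ⟨rfl, hw⟩
    exact ⟨w.get, fun i => hw _ (w.get_mem i), List.ofFn_get w⟩

theorem card_words (B : Finset α) (k : ℕ) : #(words B k) = #B ^ k := by
  rw [words, Finset.card_map, Fintype.card_piFinset_const]

theorem mem_words_of_sublist {B : Finset α} {k : ℕ} {w v : List α} (hw : w ∈ words B k)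
    (h : v.Sublist w) : v ∈ words B v.length :=
  mem_words.2 ⟨rfl, fun _ hx => (mem_words.1 hw).2 _ (h.subset hx)⟩

/-- The letters that may stand at position `j` of a word of `X` beginning like `w` before `j`. -/
def rightLetters (X : Finset (List α)) (w : List α) (j : ℕ) : Set α :=
  {x | ∃ u ∈ X, u.take j = w.take j ∧ u[j]? = some x}

/-- The letters that may stand at position `j` of a word of `X` ending like `w` after `j`. -/
def leftLetters (X : Finset (List α)) (w : List α) (j : ℕ) : Set α :=
  {x | ∃ u ∈ X, u.drop (j + 1) = w.drop (j + 1) ∧ u[j]? = some x}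

/-- Position `j` of the word `w` is right-good in `X` if, keeping what precedes it, its letter may
be replaced by a smaller one and by a greater one. -/
def RightGood (X : Finset (List α)) (lt : α → α → Prop) (w : List α) (j : ℕ) : Prop :=
  ∃ x, w[j]? = some x ∧ Flanked lt (rightLetters X w j) x

/-- Position `j` of the word `w` is left-good in `X` if, keeping what follows it, its letter may
be replaced by a smaller one and by a greater one. -/
def LeftGood (X : Finset (List α)) (lt : α → α → Prop) (w : List α) (j : ℕ) : Prop :=
  ∃ x, w[j]? = some x ∧ Flanked lt (leftLetters X w j) x

/-- What may follow the first letter `x` in the words of `X`. -/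
def tailsAfter (X : Finset (List α)) (x : α) : Finset (List α) :=
  X.preimage (List.cons x) List.cons_injective.injOn

theorem mem_tailsAfter {X : Finset (List α)} {x : α} {w : List α} :
    w ∈ tailsAfter X x ↔ x :: w ∈ X :=
  Finset.mem_preimage

theorem tailsAfter_subset_words {B : Finset α} {k : ℕ} {X : Finset (List α)}
    (hX : X ⊆ words B (k + 1)) (x : α) : tailsAfter X x ⊆ words B k := by
  intro w hw
  obtain ⟨hlen, hB⟩ := mem_words.1 (hX (mem_tailsAfter.1 hw))
  exact mem_words.2 ⟨by simpa using hlen, fun y hy => hB y (List.mem_cons_of_mem x hy)⟩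

open scoped Classical in
/-- The first letters of the words of `X`, as a subset of the alphabet `B`. -/
def firstLetters (B : Finset α) (X : Finset (List α)) : Finset α :=
  {x ∈ B | (tailsAfter X x).Nonempty}

theorem mem_firstLetters_iff {B : Finset α} {k : ℕ} {X : Finset (List α)} (hX : X ⊆ words B k)
    {x : α} : x ∈ firstLetters B X ↔ ∃ w, x :: w ∈ X := by
  rw [firstLetters, Finset.mem_filter, Finset.Nonempty]
  simp only [mem_tailsAfter]
  exact ⟨And.right, fun ⟨w, hw⟩ => ⟨(mem_words.1 (hX hw)).2 x List.mem_cons_self, w, hw⟩⟩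

theorem firstLetters_subset (B : Finset α) (X : Finset (List α)) : firstLetters B X ⊆ B :=
  Finset.filter_subset _ _

theorem sum_eq_sum_tailsAfter {M : Type*} [AddCommMonoid M] {B : Finset α} {k : ℕ}
    {X : Finset (List α)} (hX : X ⊆ words B (k + 1)) (f : List α → M) :
    ∑ w ∈ X, f w = ∑ x ∈ firstLetters B X, ∑ w ∈ tailsAfter X x, f (x :: w) := by
  rw [Finset.sum_sigma']
  symm
  refine Finset.sum_bij (fun s _ => s.1 :: s.2) ?_ ?_ ?_ fun _ _ => rfl
  · intro s hs
    exact mem_tailsAfter.1 (Finset.mem_sigma.1 hs).2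
  · rintro ⟨x, v⟩ - ⟨y, u⟩ - h
    obtain ⟨rfl, rfl⟩ := List.cons.inj h
    rfl
  · intro w hw
    obtain ⟨x, v, rfl⟩ := List.exists_cons_of_length_eq_add_one (mem_words.1 (hX hw)).1
    exact ⟨⟨x, v⟩, Finset.mem_sigma.2
      ⟨(mem_firstLetters_iff hX).2 ⟨v, hw⟩, mem_tailsAfter.2 hw⟩, rfl⟩

theorem rightLetters_cons_succ (X : Finset (List α)) (x : α) (w : List α) (j : ℕ) :
    rightLetters X (x :: w) (j + 1) = rightLetters (tailsAfter X x) w j := by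
  ext y
  constructor
  · rintro ⟨_ | ⟨z, u⟩, hu, htakes, hy⟩
    · simp at hy
    · obtain ⟨rfl, htake⟩ : z = x ∧ u.take j = w.take j := by simpa using htakes
      exact ⟨u, mem_tailsAfter.2 hu, htake, hy⟩
  · rintro ⟨u, hu, htake, hy⟩
    exact ⟨x :: u, mem_tailsAfter.1 hu, congrArg (List.cons x) htake, hy⟩

theorem rightGood_cons_succ (X : Finset (List α)) (lt : α → α → Prop) (x : α) (w : List α)
    (j : ℕ) : RightGood X lt (x :: w) (j + 1) ↔ RightGood (tailsAfter X x) lt w j := by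
  rw [RightGood, rightLetters_cons_succ, List.getElem?_cons_succ, RightGood]

theorem rightGood_cons_zero {B : Finset α} {k : ℕ} {X : Finset (List α)} (hX : X ⊆ words B k)
    (lt : α → α → Prop) (x : α) (w : List α) :
    RightGood X lt (x :: w) 0 ↔ Flanked lt (firstLetters B X : Set α) x := by
  have hset : rightLetters X (x :: w) 0 = (firstLetters B X : Set α) := by
    ext y
    rw [Finset.mem_coe, mem_firstLetters_iff hX]
    constructor
    · rintro ⟨_ | ⟨z, u⟩, hu, -, hy⟩
      · simp at hy
      · obtain rfl : z = y := by simpa using hy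
        exact ⟨u, hu⟩
    · rintro ⟨u, hu⟩
      exact ⟨y :: u, hu, rfl, rfl⟩
  simp only [RightGood, hset, List.getElem?_cons_zero, Option.some.injEq, exists_eq_left']

open scoped Classical in
theorem card_not_rightGood_cons {B : Finset α} {n : ℕ} {X : Finset (List α)} (hX : X ⊆ words B n)
    (lt : α → α → Prop) (x : α) (w : List α) (k : ℕ) :
    #{j ∈ Finset.range (k + 1) | ¬ RightGood X lt (x :: w) j} =
      #{j ∈ Finset.range k | ¬ RightGood (tailsAfter X x) lt w j} +
        if Flanked lt (firstLetters B X : Set α) x then 0 else 1 := by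
  rw [Finset.card_filter, Finset.card_filter, Finset.sum_range_succ']
  simp only [rightGood_cons_succ, rightGood_cons_zero hX, ite_not]

open scoped Classical in
theorem card_not_flanked_le {lt : α → α → Prop} {len : α → ℕ} {L : ℕ} (H : Finset α)
    (hlen : ∀ x ∈ H, len x < L)
    (htri : ∀ x ∈ H, ∀ y ∈ H, len x = len y → x ≠ y → lt x y ∨ lt y x) :
    #{x ∈ H | ¬ Flanked lt (H : Set α) x} ≤ 2 * L := by
  have hinj : Set.InjOn (fun x => (decide (∃ y ∈ H, lt y x), len x))
      ({x ∈ H | ¬ Flanked lt (H : Set α) x} : Finset α) := by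
    intro x hx y hy hxy
    obtain ⟨hlt, hl⟩ : ((∃ z ∈ H, lt z x) ↔ ∃ z ∈ H, lt z y) ∧ len x = len y := by
      simpa using hxy
    obtain ⟨hxH, hx⟩ := Finset.mem_filter.1 hx
    obtain ⟨hyH, hy⟩ := Finset.mem_filter.1 hy
    by_contra hne
    rcases htri x hxH y hyH hl hne with h | h
    · exact hx ⟨hlt.2 ⟨x, hxH, h⟩, y, hyH, h⟩
    · exact hy ⟨hlt.1 ⟨y, hyH, h⟩, x, hxH, h⟩
  have hmaps : Set.MapsTo (fun x => (decide (∃ y ∈ H, lt y x), len x))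
      ({x ∈ H | ¬ Flanked lt (H : Set α) x} : Finset α)
      ((Finset.univ : Finset Bool) ×ˢ Finset.range L : Finset (Bool × ℕ)) := fun x hx =>
    Finset.mem_coe.2 (Finset.mem_product.2
      ⟨Finset.mem_univ _, Finset.mem_range.2 (hlen x (Finset.mem_filter.1 hx).1)⟩)
  simpa using Finset.card_le_card_of_injOn _ hmaps hinj

theorem sum_pow_ite_le (H : Finset α) (P : α → Prop) [DecidablePred P] (N : ℕ) :
    ∑ x ∈ H, N ^ (if P x then 0 else 1) ≤ #H + #{x ∈ H | ¬ P x} * N := by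
  have hterm : ∀ x, N ^ (if P x then 0 else 1) ≤ 1 + (if P x then 0 else 1) * N := fun x => by
    split_ifs <;> simp
  refine (Finset.sum_le_sum fun x _ => hterm x).trans_eq ?_
  simp only [Finset.sum_add_distrib, Finset.sum_const, smul_eq_mul, mul_one, ← Finset.sum_mul,
    Finset.card_filter, ite_not]

section Counting

variable {B : Finset α} {lt : α → α → Prop} {len : α → ℕ} {L : ℕ}
  (hlen : ∀ x ∈ B, len x < L)
  (htri : ∀ x ∈ B, ∀ y ∈ B, len x = len y → x ≠ y → lt x y ∨ lt y x)
include hlen htri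

-- Among the first letters of given length at most two, the least and the greatest, are not flanked.
open scoped Classical in
theorem sum_pow_card_not_rightGood_le {k : ℕ} {X : Finset (List α)} (hX : X ⊆ words B k) :
    ∑ w ∈ X, #B ^ #{j ∈ Finset.range k | ¬ RightGood X lt w j} ≤ ((2 * L + 1) * #B) ^ k := by
  induction k generalizing X with
  | zero => simpa [card_words] using Finset.card_le_card hX
  | succ k ih =>
    set H := firstLetters B X
    have hHB : H ⊆ B := firstLetters_subset B X
    have hnot : #{x ∈ H | ¬ Flanked lt (H : Set α) x} ≤ 2 * L :=
      card_not_flanked_le H (fun x hx => hlen x (hHB hx))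
        fun x hx y hy => htri x (hHB hx) y (hHB hy)
    rw [sum_eq_sum_tailsAfter hX]
    simp only [card_not_rightGood_cons hX, pow_add, ← Finset.sum_mul]
    calc ∑ x ∈ H, (∑ w ∈ tailsAfter X x,
            #B ^ #{j ∈ Finset.range k | ¬ RightGood (tailsAfter X x) lt w j}) *
          #B ^ (if Flanked lt (H : Set α) x then 0 else 1)
        ≤ ∑ x ∈ H, ((2 * L + 1) * #B) ^ k * #B ^ (if Flanked lt (H : Set α) x then 0 else 1) :=
          Finset.sum_le_sum fun x _ =>
            Nat.mul_le_mul_right _ (ih (tailsAfter_subset_words hX x))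
      _ ≤ ((2 * L + 1) * #B) ^ k * (#B + 2 * L * #B) := by
          rw [← Finset.mul_sum]
          gcongr
          refine (sum_pow_ite_le H _ #B).trans ?_
          gcongr
      _ = _ := by ring

open scoped Classical in
theorem card_filter_not_rightGood_mul_le {k : ℕ} {X : Finset (List α)} (hX : X ⊆ words B k)
    (m : ℕ) :
    #{w ∈ X | m ≤ #{j ∈ Finset.range k | ¬ RightGood X lt w j}} * #B ^ m ≤
      ((2 * L + 1) * #B) ^ k := by
  refine le_trans ?_ (sum_pow_card_not_rightGood_le hlen htri hX)
  rw [← smul_eq_mul, ← Finset.sum_const]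
  refine (Finset.sum_le_sum fun w hw => ?_).trans
    (Finset.sum_le_sum_of_subset (Finset.filter_subset _ _))
  obtain ⟨hwX, hm⟩ := Finset.mem_filter.1 hw
  rcases Nat.eq_zero_or_pos #B with hB | hB
  · obtain ⟨hwlen, hwB⟩ := mem_words.1 (hX hwX)
    obtain rfl : w = [] :=
      List.eq_nil_iff_forall_not_mem.2 fun x hx => by
        simpa [Finset.card_eq_zero.1 hB] using hwB x hx
    obtain rfl : k = 0 := by simpa using hwlen.symm
    obtain rfl : m = 0 := by simpa using hm
    simp
  · exact Nat.pow_le_pow_right hB hm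

end Counting

open scoped Classical in
theorem rightLetters_image_reverse {k j : ℕ} {X : Finset (List α)} (hX : ∀ w ∈ X, w.length = k)
    {w : List α} (hw : w.length = k) (hj : j < k) :
    rightLetters (X.image List.reverse) w.reverse (k - 1 - j) = leftLetters X w j := by
  have hindex : ∀ u : List α, u.length = k → u.reverse[k - 1 - j]? = u[j]? := fun u hu => by
    rw [List.getElem?_reverse (by omega), hu, show k - 1 - (k - 1 - j) = j by omega]
  have htake : ∀ u : List α, u.length = k →
      u.reverse.take (k - 1 - j) = (u.drop (j + 1)).reverse := fun u hu => by
    rw [List.take_reverse, hu, show k - (k - 1 - j) = j + 1 by omega]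
  ext x
  simp only [rightLetters, leftLetters, Set.mem_ofPred_eq, Finset.exists_mem_image]
  refine exists_congr fun u => and_congr_right fun hu => ?_
  rw [htake u (hX u hu), htake w hw, hindex u (hX u hu), List.reverse_inj]

open scoped Classical in
theorem card_not_rightGood_reverse {lt : α → α → Prop} {k : ℕ} {X : Finset (List α)}
    (hX : ∀ w ∈ X, w.length = k) {w : List α} (hw : w.length = k) :
    #{j ∈ Finset.range k | ¬ RightGood (X.image List.reverse) lt w.reverse j} =
      #{j ∈ Finset.range k | ¬ LeftGood X lt w j} := by
  rw [Finset.card_filter, Finset.card_filter, ← Finset.sum_range_reflect]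
  refine Finset.sum_congr rfl fun j hj => ?_
  have hj := Finset.mem_range.1 hj
  rw [RightGood, rightLetters_image_reverse hX hw hj, List.getElem?_reverse (by omega), hw,
    show k - 1 - (k - 1 - j) = j by omega, LeftGood]

open scoped Classical in
theorem card_filter_not_leftGood_mul_le {B : Finset α} {lt : α → α → Prop} {len : α → ℕ} {L : ℕ}
    (hlen : ∀ x ∈ B, len x < L)
    (htri : ∀ x ∈ B, ∀ y ∈ B, len x = len y → x ≠ y → lt x y ∨ lt y x) {k : ℕ}
    {X : Finset (List α)} (hX : X ⊆ words B k) (m : ℕ) :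
    #{w ∈ X | m ≤ #{j ∈ Finset.range k | ¬ LeftGood X lt w j}} * #B ^ m ≤
      ((2 * L + 1) * #B) ^ k := by
  have hX' : X.image List.reverse ⊆ words B k := by
    intro v hv
    obtain ⟨w, hw, rfl⟩ := Finset.mem_image.1 hv
    simpa [mem_words] using mem_words.1 (hX hw)
  have hlength : ∀ w ∈ X, w.length = k := fun w hw => (mem_words.1 (hX hw)).1
  refine le_trans (Nat.mul_le_mul_right _ ?_)
    (card_filter_not_rightGood_mul_le hlen htri hX' m)
  refine Finset.card_le_card_of_injOn List.reverse (fun w hw => ?_) List.reverse_injective.injOn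
  obtain ⟨hw, hm⟩ := Finset.mem_filter.1 hw
  exact Finset.mem_coe.2 (Finset.mem_filter.2 ⟨Finset.mem_image_of_mem _ hw,
    hm.trans_eq (card_not_rightGood_reverse hlength (hlength w hw)).symm⟩)

end Words

/-! ### Finding many words between two occurrences of the same pair of letters -/

section Loops

open scoped Finset

variable {α τ : Type*}

/-- The letters of `w` at the positions `p + 1, …, q`. -/
def loopWord (p q : ℕ) (w : List α) : List α := (w.drop (p + 1)).take (q - p)

theorem loopWord_infix (p q : ℕ) (w : List α) : loopWord p q w <:+: w :=
  (List.take_prefix _ _).isInfix.trans (List.drop_suffix _ _).isInfix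

theorem length_loopWord {p q : ℕ} {w : List α} (hq : q < w.length) :
    (loopWord p q w).length = q - p := by
  rw [loopWord, List.length_take, List.length_drop]
  lia

theorem drop_eq_append_loopWord {a p q : ℕ} (hap : a ≤ p) (hpq : p ≤ q) (w : List α) :
    w.drop a = (w.drop a).take (p + 1 - a) ++ (loopWord p q w ++ w.drop (q + 1)) := by
  have htail : (w.drop (p + 1)).drop (q - p) = w.drop (q + 1) := by
    rw [List.drop_drop, show p + 1 + (q - p) = q + 1 by omega]
  have hdrop : (w.drop a).drop (p + 1 - a) = w.drop (p + 1) := by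
    rw [List.drop_drop, show a + (p + 1 - a) = p + 1 by omega]
  rw [loopWord, ← htail, List.take_append_drop, ← hdrop, List.take_append_drop]

theorem card_image_take_drop_le [DecidableEq α] {B : Finset α} {k : ℕ} {Z : Finset (List α)}
    (hZ : Z ⊆ words B k) {i n : ℕ} (hin : i + n ≤ k) :
    #(Z.image fun w => (w.drop i).take n) ≤ #B ^ n := by
  rw [← card_words]
  refine Finset.card_le_card fun v hv => ?_
  obtain ⟨w, hw, rfl⟩ := Finset.mem_image.1 hv
  have hlen : ((w.drop i).take n).length = n := by
    rw [List.length_take, List.length_drop, (mem_words.1 (hZ hw)).1]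
    omega
  simpa only [hlen] using
    mem_words_of_sublist (hZ hw) ((List.take_sublist n _).trans (List.drop_sublist i w))

theorem card_image_drop_le_pow [DecidableEq α] {B : Finset α} {k a : ℕ} {Z : Finset (List α)}
    (hZ : Z ⊆ words B k) (hak : a ≤ k) : #(Z.image (List.drop a)) ≤ #B ^ (k - a) := by
  refine le_of_eq_of_le (congrArg Finset.card (Finset.image_congr fun w hw => ?_))
    (card_image_take_drop_le hZ (Nat.add_sub_of_le hak).le)
  exact (List.take_of_length_le (by rw [List.length_drop, (mem_words.1 (hZ hw)).1])).symm

theorem card_image_drop_le_mul [DecidableEq α] {B : Finset α} {k a p q : ℕ} {Z : Finset (List α)}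
    (hZ : Z ⊆ words B k) (hap : a ≤ p) (hpq : p ≤ q) (hqk : q < k) :
    #(Z.image (List.drop a)) ≤
      #B ^ (p + 1 - a) * (#(Z.image (loopWord p q)) * #(Z.image (List.drop (q + 1)))) := by
  refine le_trans ?_ (Nat.mul_le_mul_right _
    (card_image_take_drop_le hZ (i := a) (n := p + 1 - a) (by omega)))
  rw [← Finset.card_product, ← Finset.card_product]
  refine (Finset.card_le_card fun v hv => ?_).trans
    (Finset.card_image_le (f := fun s : List α × List α × List α => s.1 ++ (s.2.1 ++ s.2.2)))
  obtain ⟨w, hw, rfl⟩ := Finset.mem_image.1 hv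
  exact Finset.mem_image.2 ⟨((w.drop a).take (p + 1 - a), loopWord p q w, w.drop (q + 1)),
    Finset.mem_product.2 ⟨Finset.mem_image_of_mem _ hw, Finset.mem_product.2
      ⟨Finset.mem_image_of_mem _ hw, Finset.mem_image_of_mem _ hw⟩⟩,
    (drop_eq_append_loopWord hap hpq w).symm⟩

/-- When positions carry marks according to the relation `R`, the first marked position of
`[a, k)` is `p`, one of its marks is `c`, and `q` is the last position of `[a, k)` marked `c`. -/
structure FirstAndLastMark (R : ℕ → τ → Prop) (a k p q : ℕ) (c : τ) : Prop where
  le_first : a ≤ p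
  first_le_last : p ≤ q
  last_lt : q < k
  not_mark_of_lt_first : ∀ i, a ≤ i → i < p → ∀ d, ¬ R i d
  mark_first : R p c
  mark_last : R q c
  not_mark_of_last_lt : ∀ i, q < i → i < k → ¬ R i c

theorem exists_firstAndLastMark {R : ℕ → τ → Prop} {a k : ℕ}
    (h : ∃ p, a ≤ p ∧ p < k ∧ ∃ c, R p c) : ∃ p q c, FirstAndLastMark R a k p q c := by
  classical
  obtain ⟨hap, hpk, c, hc⟩ := Nat.find_spec h
  set p := Nat.find h
  have hmem : p ∈ {q ∈ Finset.range k | p ≤ q ∧ R q c} :=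
    Finset.mem_filter.2 ⟨Finset.mem_range.2 hpk, le_rfl, hc⟩
  obtain ⟨q, hq, hmax⟩ := Finset.exists_max_image _ id ⟨p, hmem⟩
  obtain ⟨hqk, hpq, hqc⟩ := Finset.mem_filter.1 hq
  refine ⟨p, q, c, hap, hpq, Finset.mem_range.1 hqk, fun i hai hip d hd => ?_, hc, hqc,
    fun i hqi hik hi => ?_⟩
  · exact Nat.find_min h hip ⟨hai, hip.trans hpk, d, hd⟩
  · exact hqi.not_ge (hmax i
      (Finset.mem_filter.2 ⟨Finset.mem_range.2 hik, hpq.trans hqi.le, hi⟩))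

open scoped Classical in
theorem FirstAndLastMark.add_card_unmarked_le {R : ℕ → τ → Prop} {a k p q : ℕ} {c : τ}
    (h : FirstAndLastMark R a k p q c) :
    p - a + #{i ∈ Finset.Ico (q + 1) k | ∀ d, ¬ R i d} ≤
      #{i ∈ Finset.Ico a k | ∀ d, ¬ R i d} := by
  have hle := h.le_first
  have hpq := h.first_le_last
  have hqk := h.last_lt
  rw [← Nat.card_Ico, ← Finset.card_union_of_disjoint]
  · refine Finset.card_le_card fun i hi => ?_
    simp only [Finset.mem_union, Finset.mem_filter, Finset.mem_Ico] at hi ⊢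
    rcases hi with ⟨hai, hip⟩ | ⟨hi, hmark⟩
    · exact ⟨by omega, h.not_mark_of_lt_first i hai hip⟩
    · exact ⟨by omega, hmark⟩
  · refine Finset.disjoint_left.2 fun i hi hi' => ?_
    simp only [Finset.mem_filter, Finset.mem_Ico] at hi hi'
    omega

open scoped Classical in
theorem card_image_drop_le_add_sum [DecidableEq α] {R : List α → ℕ → τ → Prop} {a k : ℕ}
    {T : Finset τ} {Y : Finset (List α)}
    (hT : ∀ w ∈ Y, ∀ i, a ≤ i → i < k → ∀ d, R w i d → d ∈ T) :
    #(Y.image (List.drop a)) ≤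
      #({w ∈ Y | ∀ i, a ≤ i → i < k → ∀ d, ¬ R w i d}.image (List.drop a)) +
        ∑ s ∈ Finset.range k ×ˢ Finset.range k ×ˢ T,
          #({w ∈ Y | FirstAndLastMark (R w) a k s.1 s.2.1 s.2.2}.image (List.drop a)) := by
  have hcover : Y ⊆ {w ∈ Y | ∀ i, a ≤ i → i < k → ∀ d, ¬ R w i d} ∪
      (Finset.range k ×ˢ Finset.range k ×ˢ T).biUnion
        fun s => {w ∈ Y | FirstAndLastMark (R w) a k s.1 s.2.1 s.2.2} := by
    intro w hw
    by_cases h : ∃ p, a ≤ p ∧ p < k ∧ ∃ c, R w p c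
    · obtain ⟨p, q, c, hpq⟩ := exists_firstAndLastMark h
      have hqk := hpq.last_lt
      have hpk := hpq.first_le_last.trans_lt hqk
      refine Finset.mem_union_right _ (Finset.mem_biUnion.2
        ⟨(p, q, c), ?_, Finset.mem_filter.2 ⟨hw, hpq⟩⟩)
      simp only [Finset.mem_product, Finset.mem_range]
      exact ⟨hpk, hqk, hT w hw p hpq.le_first hpk c hpq.mark_first⟩
    · push Not at h
      exact Finset.mem_union_left _ (Finset.mem_filter.2 ⟨hw, h⟩)
  refine (Finset.card_le_card (Finset.image_subset_image hcover)).trans ?_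
  rw [Finset.image_union, Finset.biUnion_image]
  exact (Finset.card_union_le _ _).trans (Nat.add_le_add_left Finset.card_biUnion_le _)

open scoped Classical in
theorem card_image_drop_le_mul_of_forall [DecidableEq α] {R : List α → ℕ → τ → Prop} {a k M : ℕ}
    {T : Finset τ} (hTM : #T ≤ M) {Y : Finset (List α)}
    (hT : ∀ w ∈ Y, ∀ i, a ≤ i → i < k → ∀ d, R w i d → d ∈ T) {E : ℝ} (hE : 0 ≤ E)
    (hunmarked : #({w ∈ Y | ∀ i, a ≤ i → i < k → ∀ d, ¬ R w i d}.image (List.drop a)) ≤ E)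
    (hmarked : ∀ p, ∀ q < k, ∀ c ∈ T,
      #({w ∈ Y | FirstAndLastMark (R w) a k p q c}.image (List.drop a)) ≤ E) :
    (#(Y.image (List.drop a)) : ℝ) ≤ ((k : ℝ) ^ 2 * M + 1) * E := by
  set I := Finset.range k ×ˢ Finset.range k ×ˢ T
  have hI : #I ≤ k ^ 2 * M := by
    simp only [I, Finset.card_product, Finset.card_range, sq, mul_assoc]
    gcongr
  calc (#(Y.image (List.drop a)) : ℝ)
      ≤ #({w ∈ Y | ∀ i, a ≤ i → i < k → ∀ d, ¬ R w i d}.image (List.drop a)) + ∑ s ∈ I,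
          (#({w ∈ Y | FirstAndLastMark (R w) a k s.1 s.2.1 s.2.2}.image (List.drop a)) : ℝ) := by
        exact_mod_cast card_image_drop_le_add_sum hT
    _ ≤ E + #I * E := by
        rw [← nsmul_eq_mul, ← Finset.sum_const]
        refine add_le_add hunmarked (Finset.sum_le_sum fun s hs => ?_)
        simp only [I, Finset.mem_product, Finset.mem_range] at hs
        exact hmarked _ _ hs.2.1 _ hs.2.2
    _ ≤ E + (k ^ 2 * M : ℕ) * E := by gcongr
    _ = _ := by
        push_cast
        ring

section MarkedWords

variable [DecidableEq α]

variable {B : Finset α} {k : ℕ} {X : Finset (List α)} (hX : X ⊆ words B k) (hB : 1 ≤ #B)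
  {R : List α → ℕ → τ → Prop}

include hX hB

open scoped Classical in
theorem card_image_drop_le_of_unmarked {a e : ℕ} (hak : a ≤ k)
    (he : ∀ w ∈ X, #{i ∈ Finset.Ico a k | ∀ d, ¬ R w i d} ≤ e)
    (hno : ∀ w ∈ X, ∀ i, a ≤ i → i < k → ∀ d, ¬ R w i d) :
    #(X.image (List.drop a)) ≤ #B ^ e := by
  rcases X.eq_empty_or_nonempty with rfl | ⟨w, hw⟩
  · simp
  · have hke : k - a ≤ e := by
      have hcard := he w hw
      rwa [Finset.filter_true_of_mem, Nat.card_Ico] at hcard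
      intro i hi
      exact hno w hw i (Finset.mem_Ico.1 hi).1 (Finset.mem_Ico.1 hi).2
    exact (card_image_drop_le_pow hX hak).trans (Nat.pow_le_pow_right hB hke)

variable {V : ℝ} (hV : 1 ≤ V) {ℓ : ℕ}
  (hloop : ∀ p q c, p + ℓ ≤ q → q < k → ∀ Z ⊆ X, (∀ w ∈ Z, R w p c ∧ R w q c) →
    (#(Z.image (loopWord p q)) : ℝ) ≤ V ^ (q - p))

include hV hloop

theorem card_image_loopWord_le {p q : ℕ} {c : τ} (hpq : p ≤ q) (hqk : q < k) {Z : Finset (List α)}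
    (hZX : Z ⊆ X) (hZ : ∀ w ∈ Z, R w p c ∧ R w q c) :
    (#(Z.image (loopWord p q)) : ℝ) ≤ (#B : ℝ) ^ ℓ * V ^ (q - p) := by
  have hB' : (1 : ℝ) ≤ #B := by exact_mod_cast hB
  rcases le_or_gt (p + ℓ) q with hq | hq
  · exact (hloop p q c hq hqk Z hZX hZ).trans
      (le_mul_of_one_le_left (by positivity) (one_le_pow₀ hB'))
  · calc (#(Z.image (loopWord p q)) : ℝ) ≤ (#B : ℝ) ^ (q - p) := by
          exact_mod_cast card_image_take_drop_le (hZX.trans hX) (by omega)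
      _ ≤ (#B : ℝ) ^ ℓ := pow_le_pow_right₀ hB' (by omega)
      _ ≤ _ := le_mul_of_one_le_right (by positivity) (one_le_pow₀ hV)

open scoped Classical in
theorem card_image_drop_le_of_firstAndLastMark {a p q e n : ℕ} {c : τ} {Z : Finset (List α)}
    (hZX : Z ⊆ X) (hZ : ∀ w ∈ Z, FirstAndLastMark (R w) a k p q c)
    (he : ∀ w ∈ Z, #{i ∈ Finset.Ico a k | ∀ d, ¬ R w i d} ≤ e) {W : ℝ} (hW : 0 ≤ W)
    (hrec : (#(Z.image (List.drop (q + 1))) : ℝ) ≤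
      W * (#B : ℝ) ^ (e - (p - a) + n * (ℓ + 1)) * V ^ (k - (q + 1))) :
    (#(Z.image (List.drop a)) : ℝ) ≤
      W * (#B : ℝ) ^ (e + (n + 1) * (ℓ + 1)) * V ^ (k - a) := by
  rcases Z.eq_empty_or_nonempty with rfl | ⟨w, hw⟩
  · rw [Finset.image_empty, Finset.card_empty, Nat.cast_zero]
    positivity
  obtain ⟨hap, hpq, hqk, -⟩ := hZ w hw
  have hpe : p - a ≤ e := by
    have hsplit := (hZ w hw).add_card_unmarked_le
    have hew := he w hw
    omega
  have hexp : e + (n + 1) * (ℓ + 1) = p + 1 - a + ℓ + (e - (p - a) + n * (ℓ + 1)) := by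
    rw [add_mul]
    omega
  calc (#(Z.image (List.drop a)) : ℝ)
      ≤ (#B : ℝ) ^ (p + 1 - a) *
          (#(Z.image (loopWord p q)) * #(Z.image (List.drop (q + 1)))) := by
        exact_mod_cast card_image_drop_le_mul (hZX.trans hX) hap hpq hqk
    _ ≤ (#B : ℝ) ^ (p + 1 - a) * (((#B : ℝ) ^ ℓ * V ^ (q - p)) *
          (W * (#B : ℝ) ^ (e - (p - a) + n * (ℓ + 1)) * V ^ (k - (q + 1)))) := by
        gcongr
        exact card_image_loopWord_le hX hB hV hloop hpq hqk hZX
          fun w hw => ⟨(hZ w hw).mark_first, (hZ w hw).mark_last⟩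
    _ = W * (#B : ℝ) ^ (e + (n + 1) * (ℓ + 1)) * V ^ (q - p + (k - (q + 1))) := by
        rw [hexp]
        ring
    _ ≤ _ := mul_le_mul_of_nonneg_left (pow_le_pow_right₀ hV (by omega)) (by positivity)

-- A word is cut at the first marked position and at the last position carrying the same mark;
-- that mark no longer occurs in the remaining tail, so that `T` loses an element.
open scoped Classical in
theorem card_image_drop_le {M a e : ℕ} {T : Finset τ} (hTM : #T ≤ M) (hak : a ≤ k)
    {Y : Finset (List α)} (hYX : Y ⊆ X)
    (hT : ∀ w ∈ Y, ∀ i, a ≤ i → i < k → ∀ d, R w i d → d ∈ T)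
    (he : ∀ w ∈ Y, #{i ∈ Finset.Ico a k | ∀ d, ¬ R w i d} ≤ e) :
    (#(Y.image (List.drop a)) : ℝ) ≤
      ((k : ℝ) ^ 2 * M + 1) ^ #T * (#B : ℝ) ^ (e + #T * (ℓ + 1)) * V ^ (k - a) := by
  have hB' : (1 : ℝ) ≤ #B := by exact_mod_cast hB
  induction hn : #T generalizing T a Y e with
  | zero =>
    obtain rfl : T = ∅ := Finset.card_eq_zero.1 hn
    have hunmarked := card_image_drop_le_of_unmarked (hYX.trans hX) hB hak he
      fun w hw i hai hik d hd => Finset.notMem_empty d (hT w hw i hai hik d hd)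
    rw [pow_zero, one_mul, zero_mul, add_zero]
    exact (by exact_mod_cast hunmarked : _ ≤ (#B : ℝ) ^ e).trans
      (le_mul_of_one_le_right (by positivity) (one_le_pow₀ hV))
  | succ n ih =>
    set W : ℝ := ((k : ℝ) ^ 2 * M + 1) ^ n with hWdef
    have hW : 1 ≤ W := one_le_pow₀ (by simpa using by positivity)
    rw [pow_succ', ← hWdef, mul_assoc, mul_assoc, ← mul_assoc W]
    refine card_image_drop_le_mul_of_forall hTM hT (by positivity) ?_ fun p q hqk c hcT => ?_
    · set Y₀ := {w ∈ Y | ∀ i, a ≤ i → i < k → ∀ d, ¬ R w i d}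
      have hcard := card_image_drop_le_of_unmarked (((Finset.filter_subset _ Y).trans hYX).trans hX)
        hB hak (fun w hw => he w (Finset.mem_filter.1 hw).1) fun w hw => (Finset.mem_filter.1 hw).2
      calc (#(Y₀.image (List.drop a)) : ℝ) ≤ (#B : ℝ) ^ e := by exact_mod_cast hcard
        _ ≤ (#B : ℝ) ^ (e + (n + 1) * (ℓ + 1)) := pow_le_pow_right₀ hB' (by omega)
        _ ≤ W * (#B : ℝ) ^ (e + (n + 1) * (ℓ + 1)) := le_mul_of_one_le_left (by positivity) hW
        _ ≤ _ := le_mul_of_one_le_right (by positivity) (one_le_pow₀ hV)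
    · set Z := {w ∈ Y | FirstAndLastMark (R w) a k p q c}
      have hcard : #(T.erase c) = n := by rw [Finset.card_erase_of_mem hcT, hn, Nat.add_sub_cancel]
      have hZ : ∀ w ∈ Z, w ∈ Y ∧ FirstAndLastMark (R w) a k p q c :=
        fun w hw => Finset.mem_filter.1 hw
      have hZX : Z ⊆ X := (Finset.filter_subset _ Y).trans hYX
      refine card_image_drop_le_of_firstAndLastMark hX hB hV hloop hZX (fun w hw => (hZ w hw).2)
        (fun w hw => he w (hZ w hw).1) (by positivity)
        (ih (a := q + 1) ((Finset.card_le_card (T.erase_subset c)).trans hTM) hqk hZX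
          (fun w hw i hqi hik d hd => ?_) (fun w hw => ?_) hcard)
      · obtain ⟨hwY, hw⟩ := hZ w hw
        have hai : a ≤ i := hw.le_first.trans (hw.first_le_last.trans (by omega))
        refine Finset.mem_erase.2 ⟨?_, hT w hwY i hai hik d hd⟩
        rintro rfl
        exact hw.not_mark_of_last_lt i hqi hik hd
      · have hsplit := (hZ w hw).2.add_card_unmarked_le
        have hew := he w (hZ w hw).1
        omega

end MarkedWords

/-- The letters of `w` at the positions `p` and `p + 1` are the pair `s`, and both positions are
right-good for `ltr` and left-good for `ltl`. -/
structure GoodPair (X : Finset (List α)) (ltr ltl : α → α → Prop) (w : List α) (p : ℕ)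
    (s : α × α) : Prop where
  getElem_fst : w[p]? = some s.1
  getElem_snd : w[p + 1]? = some s.2
  right_fst : RightGood X ltr w p
  right_snd : RightGood X ltr w (p + 1)
  left_fst : LeftGood X ltl w p
  left_snd : LeftGood X ltl w (p + 1)

theorem RightGood.exists_getElem_eq {X : Finset (List α)} {lt : α → α → Prop} {w : List α} {j : ℕ}
    (h : RightGood X lt w j) : ∃ x, w[j]? = some x :=
  h.imp fun _ => And.left

theorem GoodPair.mem_product {X : Finset (List α)} {ltr ltl : α → α → Prop} {w : List α} {p : ℕ}
    {s : α × α} (h : GoodPair X ltr ltl w p s) {B : Finset α} {k : ℕ} (hw : w ∈ words B k) :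
    s ∈ B ×ˢ B :=
  Finset.mem_product.2 ⟨(mem_words.1 hw).2 _ (List.mem_of_getElem? h.getElem_fst),
    (mem_words.1 hw).2 _ (List.mem_of_getElem? h.getElem_snd)⟩

theorem card_filter_succ_le (k : ℕ) (P : ℕ → Prop) [DecidablePred P] :
    #{p ∈ Finset.range k | P (p + 1)} ≤ #{p ∈ Finset.range k | P p} + 1 := by
  have hsucc : #{p ∈ Finset.range k | P (p + 1)} ≤ #{p ∈ Finset.range (k + 1) | P p} := by
    rw [Finset.card_filter, Finset.card_filter, Finset.sum_range_succ']
    exact Nat.le_add_right _ _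
  refine hsucc.trans ?_
  rw [Finset.range_add_one, Finset.filter_insert]
  split_ifs
  · exact Finset.card_insert_le _ _
  · exact Nat.le_succ _

open scoped Classical in
theorem card_not_goodPair_le (X : Finset (List α)) (ltr ltl : α → α → Prop) (w : List α) (k : ℕ) :
    #{p ∈ Finset.range k | ∀ s, ¬ GoodPair X ltr ltl w p s} ≤
      2 * (#{p ∈ Finset.range k | ¬ RightGood X ltr w p} +
        #{p ∈ Finset.range k | ¬ LeftGood X ltl w p} + 1) := by
  have hright := card_filter_succ_le k fun j => ¬ RightGood X ltr w j
  have hleft := card_filter_succ_le k fun j => ¬ LeftGood X ltl w j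
  have hsub : {p ∈ Finset.range k | ∀ s, ¬ GoodPair X ltr ltl w p s} ⊆
      ({p ∈ Finset.range k | ¬ RightGood X ltr w p} ∪
        {p ∈ Finset.range k | ¬ RightGood X ltr w (p + 1)}) ∪
      ({p ∈ Finset.range k | ¬ LeftGood X ltl w p} ∪
        {p ∈ Finset.range k | ¬ LeftGood X ltl w (p + 1)}) := by
    intro p hp
    obtain ⟨hpk, hp⟩ := Finset.mem_filter.1 hp
    simp only [Finset.mem_union, Finset.mem_filter, hpk, true_and]
    by_contra! h
    obtain ⟨⟨hr, hr'⟩, hl, hl'⟩ := h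
    obtain ⟨x, hx⟩ := hr.exists_getElem_eq
    obtain ⟨y, hy⟩ := hr'.exists_getElem_eq
    exact hp (x, y) ⟨hx, hy, hr, hr', hl, hl'⟩
  have hcard := (Finset.card_le_card hsub).trans ((Finset.card_union_le _ _).trans
    (Nat.add_le_add (Finset.card_union_le _ _) (Finset.card_union_le _ _)))
  omega

section ExistsLoop

variable {B : Finset α} {ltr ltl : α → α → Prop} {len : α → ℕ} {L : ℕ}
  (hB : 1 ≤ #B) (hlen : ∀ x ∈ B, len x < L)
  (htri_right : ∀ x ∈ B, ∀ y ∈ B, len x = len y → x ≠ y → ltr x y ∨ ltr y x)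
  (htri_left : ∀ x ∈ B, ∀ y ∈ B, len x = len y → x ≠ y → ltl x y ∨ ltl y x)
  {k m : ℕ} {X : Finset (List α)} (hX : X ⊆ words B k)
  (hm : 4 * ((2 * L + 1) * #B) ^ k ≤ #B ^ m * #X)

include hB hlen htri_right htri_left hX hm

open scoped Classical in
theorem card_le_two_mul_card_filter_good :
    #X ≤ 2 * #{w ∈ X | #{j ∈ Finset.range k | ¬ RightGood X ltr w j} < m ∧
      #{j ∈ Finset.range k | ¬ LeftGood X ltl w j} < m} := by
  have hright := card_filter_not_rightGood_mul_le hlen htri_right hX m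
  have hleft := card_filter_not_leftGood_mul_le hlen htri_left hX m
  set Yr := {w ∈ X | m ≤ #{j ∈ Finset.range k | ¬ RightGood X ltr w j}}
  set Yl := {w ∈ X | m ≤ #{j ∈ Finset.range k | ¬ LeftGood X ltl w j}}
  set Y := {w ∈ X | #{j ∈ Finset.range k | ¬ RightGood X ltr w j} < m ∧
    #{j ∈ Finset.range k | ¬ LeftGood X ltl w j} < m}
  have hsplit : X ⊆ Y ∪ (Yr ∪ Yl) := by
    intro w hw
    simp only [Y, Yr, Yl, Finset.mem_union, Finset.mem_filter, hw, true_and]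
    omega
  have hcard := (Finset.card_le_card hsplit).trans ((Finset.card_union_le _ _).trans
    (Nat.add_le_add_left (Finset.card_union_le _ _) _))
  have hbad : 2 * (#Yr + #Yl) ≤ #X := by
    refine le_of_mul_le_mul_left (a := 2 * #B ^ m) ?_ (by positivity)
    nlinarith
  omega

theorem exists_loop {ℓ : ℕ} {V : ℝ} (hV : 1 ≤ V)
    (hlarge : 2 * (((k : ℝ) ^ 2 * (#B ^ 2 : ℕ) + 1) ^ (#B ^ 2) *
      (#B : ℝ) ^ (4 * m + 2 + #B ^ 2 * (ℓ + 1)) * V ^ k) < #X) :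
    ∃ (p q : ℕ) (s : α × α) (Z : Finset (List α)), p + ℓ ≤ q ∧
      (∀ z ∈ Z, ∃ w ∈ X, GoodPair X ltr ltl w p s ∧ GoodPair X ltr ltl w q s ∧
        loopWord p q w = z) ∧ V ^ (q - p) < #Z := by
  classical
  by_contra! hcon
  have hhalf := card_le_two_mul_card_filter_good hB hlen htri_right htri_left hX hm
  set Y := {w ∈ X | #{j ∈ Finset.range k | ¬ RightGood X ltr w j} < m ∧
    #{j ∈ Finset.range k | ¬ LeftGood X ltl w j} < m}
  have hYX : Y ⊆ X := Finset.filter_subset _ X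
  have hcard : #(B ×ˢ B) = #B ^ 2 := by rw [Finset.card_product, sq]
  have hfew : (#(Y.image (List.drop 0)) : ℝ) ≤ ((k : ℝ) ^ 2 * (#B ^ 2 : ℕ) + 1) ^ #(B ×ˢ B) *
      (#B : ℝ) ^ (4 * m + 2 + #(B ×ˢ B) * (ℓ + 1)) * V ^ (k - 0) := by
    refine card_image_drop_le hX hB hV (R := GoodPair X ltr ltl) ?_ hcard.le
      (Nat.zero_le k) hYX (fun w hw i _ _ s hs => hs.mem_product (hX (hYX hw))) fun w hw => ?_
    · intro p q s hpq _ Z hZX hZ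
      refine hcon p q s (Z.image (loopWord p q)) hpq fun z hz => ?_
      obtain ⟨w, hw, rfl⟩ := Finset.mem_image.1 hz
      exact ⟨w, hZX hw, (hZ w hw).1, (hZ w hw).2, rfl⟩
    · have hnot := card_not_goodPair_le X ltr ltl w k
      obtain ⟨-, hr, hl⟩ := Finset.mem_filter.1 hw
      rw [← Finset.range_eq_Ico]
      omega
  rw [show List.drop 0 = (id : List α → List α) from rfl, Finset.image_id, hcard,
    Nat.sub_zero] at hfew
  have hhalf' : (#X : ℝ) ≤ 2 * #Y := by exact_mod_cast hhalf
  linarith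

end ExistsLoop

end Loops

/-! ### Gauss–Cantor sets -/

section Concatenation

variable {α : Type*}

/-- The concatenation of the first `n` words of a sequence. -/
def concatPrefix (g : ℕ → List α) (n : ℕ) : List α := ((List.range n).map g).flatten

/-- The infinite concatenation of a sequence of words; the default letter is never used when the
words are nonempty. -/
def concat [Inhabited α] (g : ℕ → List α) (n : ℕ) : α := (concatPrefix g (n + 1)).getD n default

/-- The bi-infinite sequence with `g` at the positions `0, 1, …` and `h` at `-1, -2, …`. -/
def glue (h g : ℕ → α) : ℤ → α
  | .ofNat n => g n
  | .negSucc n => h n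

theorem concatPrefix_succ (g : ℕ → List α) (n : ℕ) :
    concatPrefix g (n + 1) = concatPrefix g n ++ g n := by
  simp [concatPrefix, List.range_succ]

theorem length_concatPrefix_succ (g : ℕ → List α) (n : ℕ) :
    (concatPrefix g (n + 1)).length = (concatPrefix g n).length + (g n).length := by
  rw [concatPrefix_succ, List.length_append]

theorem concatPrefix_add (g : ℕ → List α) (m n : ℕ) :
    concatPrefix g (m + n) = concatPrefix g m ++ concatPrefix (fun k => g (m + k)) n := by
  simp [concatPrefix, List.range_add, Function.comp_def]

theorem le_length_concatPrefix {g : ℕ → List α} (hg : ∀ i, g i ≠ []) (n : ℕ) :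
    n ≤ (concatPrefix g n).length := by
  induction n with
  | zero => exact Nat.zero_le _
  | succ n ih =>
    have := List.length_pos_iff.2 (hg n)
    rw [length_concatPrefix_succ]
    lia

variable [Inhabited α]

theorem getElem_concatPrefix {g : ℕ → List α} (hg : ∀ i, g i ≠ []) {n i : ℕ}
    (hi : i < (concatPrefix g n).length) : (concatPrefix g n)[i] = concat g i := by
  rw [concat, List.getD_eq_getElem _ _ (le_length_concatPrefix hg (i + 1))]
  rcases Nat.le_total n (i + 1) with h | h
  · obtain ⟨m, hm⟩ := Nat.exists_eq_add_of_le h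
    simp only [hm, concatPrefix_add]
    rw [List.getElem_append_left]
  · obtain ⟨m, rfl⟩ := Nat.exists_eq_add_of_le h
    simp only [concatPrefix_add g (i + 1) m]
    rw [List.getElem_append_left]

theorem concat_length_add {g : ℕ → List α} (hg : ∀ i, g i ≠ []) {n k : ℕ}
    (hk : k < (g n).length) : concat g ((concatPrefix g n).length + k) = (g n)[k] := by
  have h : (concatPrefix g n).length + k < (concatPrefix g (n + 1)).length := by
    rw [length_concatPrefix_succ]
    lia
  rw [← getElem_concatPrefix hg h]
  simp only [concatPrefix_succ]
  rw [List.getElem_append_right (Nat.le_add_right _ _)]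
  simp only [Nat.add_sub_cancel_left]

theorem exists_concat_mem {g : ℕ → List α} (hg : ∀ i, g i ≠ []) (n : ℕ) :
    ∃ i, concat g n ∈ g i := by
  have hmem := List.getElem_mem (le_length_concatPrefix hg (n + 1))
  rw [getElem_concatPrefix hg] at hmem
  simp only [concatPrefix, List.mem_flatten, List.mem_map] at hmem
  obtain ⟨_, ⟨i, -, rfl⟩, hi⟩ := hmem
  exact ⟨i, hi⟩

end Concatenation

theorem initialWord_concat {g : ℕ → List ℕ+} (hg : ∀ i, g i ≠ []) (n : ℕ) :
    initialWord (concat g) (concatPrefix g n).length = concatPrefix g n := by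
  refine List.ext_getElem (length_initialWord _ _) fun i _ _ => ?_
  rw [getElem_initialWord, getElem_concatPrefix hg]

theorem continuant_concatPrefix_le {g : ℕ → List ℕ+} {P : ℕ} (hg : ∀ i, continuant (g i) ≤ P)
    (n : ℕ) : continuant (concatPrefix g n) ≤ (2 * P) ^ n := by
  induction n with
  | zero => simp [concatPrefix]
  | succ n ih =>
    rw [concatPrefix_succ, pow_succ]
    refine (continuant_append_le _ _).trans ?_
    have := Nat.mul_le_mul ih (hg n)
    linarith

section GaussCantorSet

variable {B : Finset (List ℕ+)}

theorem glue_concat_mem_completeShift (hB : IsAlphabet B) {g h : ℕ → List ℕ+}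
    (hg : ∀ i, g i ∈ B) (hh : ∀ i, h i ∈ B) :
    glue (concat fun i => (h i).reverse) (concat g) ∈ completeShift B := by
  set h' : ℕ → List ℕ+ := fun i => (h i).reverse
  have hg0 : ∀ i, g i ≠ [] := fun i => hB.ne_nil _ (hg i)
  have hh0 : ∀ i, h' i ≠ [] := fun i => by simpa [h'] using hB.ne_nil _ (hh i)
  have hlen (n : ℕ) : (h' n).length = (h n).length := List.length_reverse
  refine ⟨glue h g, glue (fun n => -((concatPrefix h' (n + 1)).length : ℤ))
    fun n => (concatPrefix g n).length, ?_, rfl, ?_, ?_⟩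
  · rintro (n | n)
    exacts [hg n, hh n]
  · rintro (n | _ | n)
    · change ((concatPrefix g (n + 1)).length : ℤ) = (concatPrefix g n).length + (g n).length
      exact_mod_cast length_concatPrefix_succ g n
    · change ((concatPrefix g 0).length : ℤ) = -((concatPrefix h' 1).length : ℤ) + (h 0).length
      simp [concatPrefix, h']
    · change -((concatPrefix h' (n + 1)).length : ℤ) =
        -((concatPrefix h' (n + 2)).length : ℤ) + (h (n + 1)).length
      rw [length_concatPrefix_succ h' (n + 1), hlen]
      lia
  · rintro (n | n) k hk
    · exact concat_length_add hg0 hk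
    · change k < (h n).length at hk
      have hpos : -((concatPrefix h' (n + 1)).length : ℤ) + k =
          Int.negSucc ((concatPrefix h' n).length + ((h n).length - 1 - k)) := by
        rw [length_concatPrefix_succ, hlen, Int.negSucc_eq]
        lia
      change glue _ _ (-((concatPrefix h' (n + 1)).length : ℤ) + k) = (h n)[k]
      rw [hpos]
      change concat h' _ = _
      rw [concat_length_add hh0 (by rw [hlen]; lia)]
      simp only [h', List.getElem_reverse]
      congr 1
      lia

theorem cfVal_concat_mem_gaussCantorSet (hB : IsAlphabet B) {g : ℕ → List ℕ+}
    (hg : ∀ i, g i ∈ B) : cfVal (concat g) ∈ gaussCantorSet B :=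
  ⟨_, glue_concat_mem_completeShift hB hg hg, rfl⟩

theorem initialWord_concat_ne (hB : IsAlphabet B) {g h : ℕ → List ℕ+}
    (hg : ∀ i, g i ∈ B) (hh : ∀ i, h i ∈ B) {n : ℕ} (heq : ∀ i < n, g i = h i)
    (hne : g n ≠ h n) :
    initialWord (concat g) (concatPrefix g (n + 1)).length ≠
      initialWord (concat h) (concatPrefix g (n + 1)).length := by
  have hg0 : ∀ i, g i ≠ [] := fun i => hB.ne_nil _ (hg i)
  have hh0 : ∀ i, h i ≠ [] := fun i => hB.ne_nil _ (hh i)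
  intro hword
  have hprefix : concatPrefix g n = concatPrefix h n := by
    rw [concatPrefix, List.map_congr_left fun i hi => heq i (List.mem_range.1 hi), concatPrefix]
  have hletters (k : ℕ) (hgk : k < (g n).length) (hhk : k < (h n).length) :
      (g n)[k] = (h n)[k] := by
    rw [← concat_length_add hg0, ← concat_length_add hh0, ← hprefix]
    refine initialWord_eq_initialWord_iff.1 hword _ ?_
    rw [length_concatPrefix_succ]
    lia
  have hg_or_hh : g n <+: h n ∨ h n <+: g n := by
    simp only [List.prefix_iff_getElem]
    rcases Nat.le_total (g n).length (h n).length with hl | hl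
    · exact .inl ⟨hl, fun k hk => hletters k hk _⟩
    · exact .inr ⟨hl, fun k hk => (hletters k _ hk).symm⟩
  rcases hg_or_hh with hgh | hhg
  · exact hB.prefix_free _ (hh n) _ (hg n) hne.symm hgh
  · exact hB.prefix_free _ (hg n) _ (hh n) hne hhg

theorem le_abs_cfVal_concat_sub (hB : IsAlphabet B) {A P : ℕ}
    (hA : ∀ β ∈ B, ∀ a ∈ β, (a : ℕ) < A) (hP : ∀ β ∈ B, continuant β ≤ P) {g h : ℕ → List ℕ+}
    (hg : ∀ i, g i ∈ B) (hh : ∀ i, h i ∈ B) {n : ℕ} (heq : ∀ i < n, g i = h i)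
    (hne : g n ≠ h n) :
    1 / (4 * (A : ℝ) ^ 3 * ((2 * P : ℝ) ^ 2) ^ (n + 1)) ≤
      |cfVal (concat g) - cfVal (concat h)| := by
  have hg0 : ∀ i, g i ≠ [] := fun i => hB.ne_nil _ (hg i)
  have hletters {g : ℕ → List ℕ+} (hg : ∀ i, g i ∈ B) (i : ℕ) : ((concat g i : ℕ+) : ℕ) < A := by
    obtain ⟨j, hj⟩ := exists_concat_mem (fun i => hB.ne_nil _ (hg i)) i
    exact hA _ (hg j) _ hj
  have hsep := le_abs_cfVal_sub (hletters hg) (hletters hh)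
    (initialWord_concat_ne hB hg hh heq hne)
  rw [initialWord_concat hg0] at hsep
  have hcont : (continuant (concatPrefix g (n + 1)) : ℝ) ≤ (2 * P : ℝ) ^ (n + 1) := by
    exact_mod_cast continuant_concatPrefix_le (fun i => hP _ (hg i)) (n + 1)
  have hpos : (0 : ℝ) < continuant (concatPrefix g (n + 1)) := by
    exact_mod_cast continuant_pos _
  have hA0 : (0 : ℝ) < A := by exact_mod_cast (hletters hg 0).pos
  refine le_trans ?_ hsep
  rw [pow_right_comm]
  gcongr

theorem ofReal_le_dimH_range {ι X : Type*} [MetricSpace X] {F : ι → X} {D : ι → ℝ}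
    (hD : Set.Icc 0 1 ⊆ Set.range D) {C s : ℝ} (hC : 0 ≤ C) (hs : 0 < s)
    (h : ∀ i j, |D i - D j| ≤ C * dist (F i) (F j) ^ s) :
    ENNReal.ofReal s ≤ dimH (Set.range F) := by
  have hfactors : D.FactorsThrough F := fun i j hij => by
    have := h i j
    rw [hij, dist_self, Real.zero_rpow hs.ne', mul_zero] at this
    exact sub_eq_zero.1 (abs_nonpos_iff.1 this)
  set f : X → ℝ := Function.extend F D 0
  have hf (i : ι) : f (F i) = D i := hfactors.extend_apply 0 i
  have hholder : HolderOnWith C.toNNReal s.toNNReal f (Set.range F) := by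
    rintro _ ⟨i, rfl⟩ _ ⟨j, rfl⟩
    have := ENNReal.ofReal_le_ofReal (h i j)
    rw [ENNReal.ofReal_mul hC, ← ENNReal.ofReal_rpow_of_nonneg dist_nonneg hs.le] at this
    rwa [hf, hf, edist_dist, edist_dist, Real.dist_eq, Real.coe_toNNReal _ hs.le]
  have himage : f '' Set.range F = Set.range D := by
    rw [← Set.range_comp]
    exact congrArg Set.range (funext hf)
  have hone : (1 : ENNReal) ≤ dimH (f '' Set.range F) := by
    have hint : (interior (Set.Icc (0 : ℝ) 1)).Nonempty := by simp
    rw [himage, ← Nat.cast_one, ← Module.finrank_self ℝ, ← Real.dimH_of_nonempty_interior hint]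
    exact dimH_mono hD
  have hle := hone.trans (hholder.dimH_image_le (Real.toNNReal_pos.2 hs))
  rwa [ENNReal.le_div_iff_mul_le (Or.inl (by simpa using hs)) (Or.inl ENNReal.coe_ne_top),
    one_mul] at hle

theorem abs_ofDigits_sub_ofDigits_le_of_concat (hB : IsAlphabet B) {A P M : ℕ}
    (hA : ∀ β ∈ B, ∀ a ∈ β, (a : ℕ) < A) (hP : ∀ β ∈ B, continuant β ≤ P)
    {e : Fin M → List ℕ+} (he : e.Injective) (heB : ∀ i, e i ∈ B) {s : ℝ} (hs : 0 ≤ s)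
    (hPM : ((2 * P : ℝ) ^ 2) ^ s = M) (d d' : ℕ → Fin M) :
    |Real.ofDigits d - Real.ofDigits d'| ≤ M * (4 * (A : ℝ) ^ 3) ^ s *
      |cfVal (concat fun i => e (d i)) - cfVal (concat fun i => e (d' i))| ^ s := by
  by_cases hdd : d = d'
  · subst hdd
    rw [sub_self, abs_zero]
    positivity
  obtain ⟨n, hn, heq⟩ : ∃ n, d n ≠ d' n ∧ ∀ i < n, d i = d' i := by
    classical
    have hex := Function.ne_iff.1 hdd
    exact ⟨Nat.find hex, Nat.find_spec hex, fun i hi => not_not.1 (Nat.find_min hex hi)⟩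
  have hM : (0 : ℝ) < M := by exact_mod_cast (d n).pos
  have hA0 : (0 : ℝ) < A := by
    obtain ⟨a, ha⟩ := List.exists_mem_of_ne_nil _ (hB.ne_nil _ (heB (d n)))
    exact_mod_cast (hA _ (heB _) a ha).pos
  have hsep := le_abs_cfVal_concat_sub hB hA hP (fun i => heB (d i)) (fun i => heB (d' i))
    (fun i hi => congrArg e (heq i hi)) (he.ne hn)
  have hpow : (1 / (4 * (A : ℝ) ^ 3 * ((2 * P : ℝ) ^ 2) ^ (n + 1))) ^ s =
      1 / ((4 * (A : ℝ) ^ 3) ^ s * (M : ℝ) ^ (n + 1)) := by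
    rw [Real.div_rpow zero_le_one (by positivity), Real.one_rpow,
      Real.mul_rpow (by positivity) (by positivity), ← Real.rpow_pow_comm (by positivity), hPM]
  calc |Real.ofDigits d - Real.ofDigits d'| ≤ ((M : ℝ) ^ n)⁻¹ :=
        Real.abs_ofDigits_sub_ofDigits_le heq
    _ = M * (4 * (A : ℝ) ^ 3) ^ s *
        (1 / (4 * (A : ℝ) ^ 3 * ((2 * P : ℝ) ^ 2) ^ (n + 1))) ^ s := by
      rw [hpow, pow_succ (M : ℝ)]
      have : (0 : ℝ) < (4 * (A : ℝ) ^ 3) ^ s := by positivity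
      field_simp
    _ ≤ _ := by gcongr

theorem ofReal_le_dimH_gaussCantorSet (hB : IsAlphabet B) {A P : ℕ}
    (hA : ∀ β ∈ B, ∀ a ∈ β, (a : ℕ) < A) (hP1 : 1 ≤ P) (hP : ∀ β ∈ B, continuant β ≤ P) :
    ENNReal.ofReal (Real.log B.card / (2 * Real.log (2 * P))) ≤ dimH (gaussCantorSet B) := by
  have hM : (1 : ℝ) < B.card := by exact_mod_cast hB.two_le_card
  have hP2 : (1 : ℝ) < 2 * P := by exact_mod_cast (show 1 < 2 * P by lia)
  have hlogM := Real.log_pos hM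
  have hlogP := Real.log_pos hP2
  set s := Real.log B.card / (2 * Real.log (2 * P)) with hs
  have hs0 : 0 < s := by positivity
  have hPM : ((2 * P : ℝ) ^ 2) ^ s = B.card := by
    rw [Real.rpow_def_of_pos (by positivity), Real.log_pow, Nat.cast_two, hs,
      mul_div_cancel₀ _ (by positivity), Real.exp_log (by positivity)]
  set e : Fin B.card → List ℕ+ := fun i => B.equivFin.symm i
  have he : e.Injective := Subtype.val_injective.comp B.equivFin.symm.injective
  have heB : ∀ i, e i ∈ B := fun i => (B.equivFin.symm i).2
  have hrange : Set.range (fun d : ℕ → Fin B.card => cfVal (concat fun i => e (d i))) ⊆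
      gaussCantorSet B := by
    rintro _ ⟨d, rfl⟩
    exact cfVal_concat_mem_gaussCantorSet hB fun i => heB (d i)
  refine le_trans (ofReal_le_dimH_range ?_ (by positivity) hs0
    (abs_ofDigits_sub_ofDigits_le_of_concat hB hA hP he heB hs0.le hPM)) (dimH_mono hrange)
  intro z hz
  obtain ⟨d, -, hd⟩ := Real.ofDigits_SurjOn hB.two_le_card hz
  exact ⟨d, hd⟩

end GaussCantorSet

/-! ### Heights along an orbit -/

/-- The height of the shifted sequence `σⁿ θ`, written without a shift. -/
def heightAt (θ : ℤ → ℕ+) (n : ℤ) : ℝ :=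
  ((θ n : ℕ) : ℝ) + cfVal (fun m : ℕ => θ (n + 1 + m)) + cfVal (fun m : ℕ => θ (n - 1 - m))

theorem height_shift (θ : ℤ → ℕ+) (n : ℤ) : height (fun k => θ (k + n)) = heightAt θ n := by
  have hright (m : ℕ) : (m : ℤ) + 1 + n = n + 1 + m := by ring
  have hleft (m : ℕ) : -((m : ℤ) + 1) + n = n - 1 - m := by ring
  simp only [height, heightAt, zero_add, hright, hleft]

theorem mem_sigmaLe {t : ℝ} {θ : ℤ → ℕ+} : θ ∈ sigmaLe t ↔ ∀ n, heightAt θ n ≤ t := by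
  simp only [sigmaLe, Set.mem_ofPred_eq, markovValue, iSup_le_iff, EReal.coe_le_coe_iff,
    height_shift]

theorem heightAt_shift (θ : ℤ → ℕ+) (m n : ℤ) :
    heightAt (fun k => θ (k + m)) n = heightAt θ (n + m) := by
  simp only [← height_shift, add_assoc]

theorem heightAt_mirror (θ : ℤ → ℕ+) (n : ℤ) :
    heightAt (fun k => θ (-k)) n = heightAt θ (-n) := by
  have hright (m : ℕ) : -(n + 1 + m) = -n - 1 - m := by ring
  have hleft (m : ℕ) : -(n - 1 - m) = -n + 1 + m := by ring
  simp only [heightAt, hright, hleft]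
  ring

theorem shift_mem_sigmaLe {t : ℝ} {θ : ℤ → ℕ+} (h : θ ∈ sigmaLe t) (m : ℤ) :
    (fun k => θ (k + m)) ∈ sigmaLe t :=
  mem_sigmaLe.2 fun n => (heightAt_shift θ m n).trans_le (mem_sigmaLe.1 h _)

theorem mirror_mem_sigmaLe {t : ℝ} {θ : ℤ → ℕ+} (h : θ ∈ sigmaLe t) :
    (fun k => θ (-k)) ∈ sigmaLe t :=
  mem_sigmaLe.2 fun n => (heightAt_mirror θ n).trans_le (mem_sigmaLe.1 h _)

theorem lt_of_mem_sigmaLe {t : ℝ} {A : ℕ} (htA : t < A) {θ : ℤ → ℕ+} (h : θ ∈ sigmaLe t)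
    (n : ℤ) : (θ n : ℕ) < A := by
  have hheight := mem_sigmaLe.1 h n
  rw [heightAt] at hheight
  have hright := (cfVal_mem_Icc fun m : ℕ => θ (n + 1 + m)).1
  have hleft := (cfVal_mem_Icc fun m : ℕ => θ (n - 1 - m)).1
  exact_mod_cast (by linarith : ((θ n : ℕ) : ℝ) < A)

/-! ### Occurrences of words -/

/-- The word `u` occurs in `θ` at the positions `n, n + 1, …`. -/
def OccursAt (u : List ℕ+) (θ : ℤ → ℕ+) (n : ℤ) : Prop :=
  ∀ (i : ℕ) (h : i < u.length), θ (n + i) = u[i]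

theorem occursAt_append {u v : List ℕ+} {θ : ℤ → ℕ+} {n : ℤ} :
    OccursAt (u ++ v) θ n ↔ OccursAt u θ n ∧ OccursAt v θ (n + u.length) := by
  constructor
  · refine fun h => ⟨fun i hi => ?_, fun i hi => ?_⟩
    · rw [h i (by rw [List.length_append]; lia), List.getElem_append_left hi]
    · have := h (u.length + i) (by rw [List.length_append]; lia)
      rw [List.getElem_append_right (Nat.le_add_right _ _)] at this
      simpa only [Nat.add_sub_cancel_left, Nat.cast_add, ← add_assoc] using this
  · rintro ⟨hu, hv⟩ i hi
    rw [List.length_append] at hi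
    by_cases h : i < u.length
    · rw [List.getElem_append_left h, hu i h]
    · rw [List.getElem_append_right (not_lt.1 h), ← hv (i - u.length) (by lia)]
      congr 1
      lia

theorem occursAt_cons {c : ℕ+} {v : List ℕ+} {θ : ℤ → ℕ+} {n : ℤ} :
    OccursAt (c :: v) θ n ↔ θ n = c ∧ OccursAt v θ (n + 1) := by
  rw [← List.singleton_append, occursAt_append]
  refine and_congr ⟨fun h => by simpa using h 0 Nat.one_pos, ?_⟩ Iff.rfl
  rintro rfl i hi
  obtain rfl : i = 0 := by simpa using hi
  simp

theorem occursAt_append_cons {u v : List ℕ+} {c : ℕ+} {θ : ℤ → ℕ+} {n : ℤ} :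
    OccursAt (u ++ c :: v) θ (n - u.length) ↔
      OccursAt u θ (n - u.length) ∧ θ n = c ∧ OccursAt v θ (n + 1) := by
  rw [occursAt_append, sub_add_cancel, occursAt_cons]

namespace OccursAt

variable {u : List ℕ+} {θ : ℤ → ℕ+} {n : ℤ}

theorem shift (h : OccursAt u θ n) (m : ℤ) : OccursAt u (fun k => θ (k + (n - m))) m := by
  intro i hi
  simpa only [show m + i + (n - m) = n + i by ring] using h i hi

theorem mirror (h : OccursAt u θ n) :
    OccursAt u.reverse (fun k => θ (-k)) (1 - n - u.length) := by
  intro i hi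
  rw [List.length_reverse] at hi
  rw [List.getElem_reverse, ← h (u.length - 1 - i) (by lia)]
  dsimp only
  congr 1
  lia

theorem beginsWith (h : OccursAt u θ n) : BeginsWith (fun m : ℕ => θ (n + m)) u :=
  List.ext_getElem (length_initialWord _ _) fun i _ hi => by rw [getElem_initialWord, h i hi]

theorem beginsWith_left (h : OccursAt u θ (n - u.length)) :
    BeginsWith (fun m : ℕ => θ (n - 1 - m)) u.reverse := by
  have := h.mirror.beginsWith
  convert this using 4
  ring

theorem exists_eq_append_cons (h : OccursAt u θ n) {k : ℤ} (hk : n ≤ k)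
    (hku : k < n + u.length) : ∃ u₁ u₂, u = u₁ ++ θ k :: u₂ ∧ k = n + u₁.length := by
  obtain ⟨i, rfl⟩ := Int.le.dest hk
  have hi : i < u.length := by lia
  refine ⟨u.take i, u.drop (i + 1), ?_, ?_⟩
  · rw [h i hi, List.getElem_cons_drop, List.take_append_drop]
  · rw [List.length_take, min_eq_left hi.le]

end OccursAt

theorem occursAt_initialWord (θ : ℤ → ℕ+) (n : ℤ) (l : ℕ) :
    OccursAt (initialWord (fun m : ℕ => θ (n + m)) l) θ n := by
  intro i _
  rw [getElem_initialWord]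

/-- The words occurring in sequences of Markov value at most `t`. -/
def language (t : ℝ) : Set (List ℕ+) := {u | ∃ θ ∈ sigmaLe t, ∃ n, OccursAt u θ n}

section Language

variable {t : ℝ} {u v : List ℕ+}

theorem exists_occursAt_of_mem_language (h : u ∈ language t) (n : ℤ) :
    ∃ θ ∈ sigmaLe t, OccursAt u θ n := by
  obtain ⟨θ, hθ, m, hm⟩ := h
  exact ⟨_, shift_mem_sigmaLe hθ (m - n), hm.shift n⟩

theorem mem_language_of_infix (h : v ∈ language t) (huv : u <:+: v) : u ∈ language t := by
  obtain ⟨x, y, rfl⟩ := huv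
  obtain ⟨θ, hθ, m, hm⟩ := h
  exact ⟨θ, hθ, _, (occursAt_append.1 (occursAt_append.1 hm).1).2⟩

theorem reverse_mem_language (h : u ∈ language t) : u.reverse ∈ language t := by
  obtain ⟨θ, hθ, m, hm⟩ := h
  exact ⟨_, mirror_mem_sigmaLe hθ, _, hm.mirror⟩

theorem lt_of_mem_language {A : ℕ} (htA : t < A) (h : u ∈ language t) :
    ∀ a ∈ u, (a : ℕ) < A := by
  obtain ⟨θ, hθ, m, hm⟩ := h
  intro a ha
  obtain ⟨i, hi, rfl⟩ := List.mem_iff_getElem.1 ha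
  rw [← hm i hi]
  exact lt_of_mem_sigmaLe htA hθ _

end Language

/-! ### Good loops -/

-- The word `x` may be replaced by a word decreasing the continued fraction on the right of `n` and
-- by one increasing it; comparing with the increasing one gains more on the right than the
-- unknown letters before `y` can lose on the left.
theorem heightAt_le_of_flanked {t : ℝ} {A : ℕ} (htA : t < A) {θ : ℤ → ℕ+}
    (hθA : ∀ n, (θ n : ℕ) < A) {n : ℤ} {y z x : List ℕ+} {c : ℕ+}
    (hθ : OccursAt (y ++ c :: (z ++ x)) θ (n - y.length))
    (hx : Flanked CfLT {v | y ++ c :: (z ++ v) ∈ language t} x)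
    (hlong : 8 * A ^ 3 * continuant (z ++ x) ^ 2 ≤ continuant y ^ 2) {G : ℕ}
    (hG : continuant (z ++ x) ≤ G) :
    heightAt θ n ≤ t - 1 / (8 * A ^ 3 * (G : ℝ) ^ 2) := by
  obtain ⟨v, hv, hlt⟩ := hx.exists_cfVal_add_le (A := A) (z := z)
  obtain ⟨θ', hθ't, hθ'⟩ := exists_occursAt_of_mem_language hv (n - y.length)
  have hθ'A := lt_of_mem_sigmaLe htA hθ't
  obtain ⟨hy, hc, hzx⟩ := occursAt_append_cons.1 hθ
  obtain ⟨hy', hc', hzv⟩ := occursAt_append_cons.1 hθ'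
  have hright := hlt (fun m => θ (n + 1 + m)) (fun m => θ' (n + 1 + m)) (fun _ => hθA _)
    (fun _ => hθ'A _) hzx.beginsWith hzv.beginsWith
  have hleft : |cfVal (fun m : ℕ => θ (n - 1 - m)) - cfVal (fun m : ℕ => θ' (n - 1 - m))| ≤
      1 / (continuant y : ℝ) ^ 2 := by
    have := abs_cfVal_sub_le (hy.beginsWith_left.trans hy'.beginsWith_left.symm)
    rwa [hy.beginsWith_left, continuant_reverse] at this
  have hA : (0 : ℝ) < A := by exact_mod_cast (hθA n).pos
  have hpos : (0 : ℝ) < continuant (z ++ x) := by exact_mod_cast continuant_pos _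
  have hloss : 1 / (continuant y : ℝ) ^ 2 ≤ 1 / (8 * A ^ 3 * (continuant (z ++ x) : ℝ) ^ 2) :=
    one_div_le_one_div_of_le (by positivity) (by exact_mod_cast hlong)
  have hGle : 1 / (8 * A ^ 3 * (G : ℝ) ^ 2) ≤ 1 / (8 * A ^ 3 * (continuant (z ++ x) : ℝ) ^ 2) := by
    gcongr
  have hgain : 1 / (4 * A ^ 3 * (continuant (z ++ x) : ℝ) ^ 2) =
      2 * (1 / (8 * A ^ 3 * (continuant (z ++ x) : ℝ) ^ 2)) := by ring
  have hheight := mem_sigmaLe.1 hθ't n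
  rw [heightAt, hc'] at hheight
  rw [heightAt, hc]
  linarith [(abs_le.1 hleft).2]

/-- In `a b m a b`, the last two pieces have neighbours on both sides in the language. -/
structure RightFlanked (t : ℝ) (a b m : List ℕ+) : Prop where
  fst : Flanked CfLT {v | a ++ (b ++ (m ++ v)) ∈ language t} a
  snd : Flanked CfLT {v | a ++ (b ++ (m ++ (a ++ v))) ∈ language t} b

/-- A word `b m a` such that, in `a b m a b`, the last two pieces and, read backwards, the first
two pieces have neighbours on both sides in the language. Such words can be concatenated freely. -/
structure GoodLoop (t : ℝ) (a b m : List ℕ+) : Prop where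
  right : RightFlanked t a b m
  left : RightFlanked t b.reverse a.reverse m.reverse

theorem append_eq_append_cons_cases {α : Type*} {x y u v : List α} {c : α}
    (h : x ++ y = u ++ c :: v) :
    (∃ r, x = u ++ c :: r ∧ v = r ++ y) ∨ ∃ r, u = x ++ r ∧ y = r ++ c :: v := by
  rcases List.append_eq_append_iff.1 h with ⟨r, hu, hy⟩ | ⟨r, hx, hv⟩
  · exact .inr ⟨r, hu, hy⟩
  · cases r with
    | nil => exact .inr ⟨[], by simpa using hx.symm, hv.symm⟩
    | cons d r =>
      obtain ⟨rfl, rfl⟩ := List.cons_eq_cons.1 hv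
      exact .inl ⟨r, hx, rfl⟩

section GoodLoop

variable {t : ℝ} {A R : ℕ} {θ : ℤ → ℕ+} {a b m : List ℕ+}
  (htA : t < A) (hθA : ∀ n, (θ n : ℕ) < A) (hR : 32 * A ^ 7 ≤ R ^ 2)

include htA hθA hR

theorem RightFlanked.heightAt_le_of_last (h : RightFlanked t a b m)
    (ha : continuant a ∈ Set.Icc R (A * R)) (hb : continuant b ∈ Set.Icc R (A * R))
    (hm : R ≤ continuant m) {n : ℤ} {a₁ a₂ : List ℕ+} {c : ℕ+} (hsplit : a = a₁ ++ c :: a₂)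
    (hθ : OccursAt (a ++ (b ++ (m ++ (a ++ b)))) θ (n - (a ++ (b ++ (m ++ a₁))).length)) :
    heightAt θ n ≤ t - 1 / (8 * A ^ 3 * (continuant (a ++ (b ++ (m ++ (a ++ b)))) : ℝ) ^ 2) := by
  have hword (v : List ℕ+) : a ++ (b ++ (m ++ (a ++ v))) =
      (a ++ (b ++ (m ++ a₁))) ++ c :: (a₂ ++ v) := by
    have ha : a ++ v = a₁ ++ c :: (a₂ ++ v) := by simp [hsplit]
    rw [ha]
    simp only [List.append_assoc]
  have ha₂ : continuant a₂ ≤ continuant a := by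
    refine continuant_le_of_infix ⟨a₁ ++ [c], [], ?_⟩
    rw [hsplit, List.append_nil, List.append_assoc, List.singleton_append]
  have hshort : continuant (a₂ ++ b) ≤ 2 * A ^ 2 * R ^ 2 :=
    calc continuant (a₂ ++ b) ≤ 2 * (continuant a₂ * continuant b) := continuant_append_le _ _
      _ ≤ 2 * ((A * R) * (A * R)) := by
        gcongr
        exacts [ha₂.trans ha.2, hb.2]
      _ = 2 * A ^ 2 * R ^ 2 := by ring
  have hlong : R ^ 3 ≤ continuant (a ++ (b ++ (m ++ a₁))) :=
    calc R ^ 3 = R * (R * R) := by ring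
      _ ≤ continuant a * (continuant b * continuant m) :=
        Nat.mul_le_mul ha.1 (Nat.mul_le_mul hb.1 hm)
      _ ≤ continuant a * continuant (b ++ m) := Nat.mul_le_mul_left _ (continuant_mul_le _ _)
      _ ≤ continuant (a ++ (b ++ m)) := continuant_mul_le _ _
      _ ≤ _ := continuant_le_of_infix ⟨[], a₁, by simp only [List.nil_append, List.append_assoc]⟩
  have hflanked := h.snd
  simp only [hword] at hflanked hθ
  refine heightAt_le_of_flanked htA hθA hθ hflanked ?_ ?_
  · calc 8 * A ^ 3 * continuant (a₂ ++ b) ^ 2 ≤ 8 * A ^ 3 * (2 * A ^ 2 * R ^ 2) ^ 2 := by gcongr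
      _ = 32 * A ^ 7 * R ^ 4 := by ring
      _ ≤ R ^ 2 * R ^ 4 := Nat.mul_le_mul_right _ hR
      _ = (R ^ 3) ^ 2 := by ring
      _ ≤ _ := Nat.pow_le_pow_left hlong 2
  · exact continuant_le_of_infix ⟨(a ++ (b ++ (m ++ a₁))) ++ [c], [], by simp [hword]⟩

theorem RightFlanked.heightAt_le_of_middle (h : RightFlanked t a b m) (ha : R ≤ continuant a)
    {n : ℤ} {m₁ m₂ : List ℕ+} {c : ℕ+} (hsplit : m = m₁ ++ c :: m₂)
    (hle : continuant (m₂ ++ a) ≤ continuant (b ++ m₁))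
    (hθ : OccursAt (a ++ (b ++ (m ++ (a ++ b)))) θ (n - (a ++ (b ++ m₁)).length)) :
    heightAt θ n ≤ t - 1 / (8 * A ^ 3 * (continuant (a ++ (b ++ (m ++ (a ++ b)))) : ℝ) ^ 2) := by
  have hword (v : List ℕ+) : a ++ (b ++ (m ++ v)) = (a ++ (b ++ m₁)) ++ c :: (m₂ ++ v) := by
    simp [hsplit]
  have hend : a ++ (b ++ (m ++ (a ++ b))) = ((a ++ (b ++ m₁)) ++ c :: (m₂ ++ a)) ++ b := by
    simp [hword]
  have hA : 0 < A := (hθA 0).pos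
  have hR' : 8 * A ^ 3 ≤ R ^ 2 :=
    le_trans (Nat.mul_le_mul (by lia) (Nat.pow_le_pow_right hA (by lia))) hR
  have hflanked := h.fst
  simp only [hword] at hflanked
  rw [hend] at hθ ⊢
  refine heightAt_le_of_flanked htA hθA (occursAt_append.1 hθ).1 hflanked ?_ ?_
  · calc 8 * A ^ 3 * continuant (m₂ ++ a) ^ 2 ≤ R ^ 2 * continuant (b ++ m₁) ^ 2 := by gcongr
      _ = (R * continuant (b ++ m₁)) ^ 2 := (mul_pow _ _ _).symm
      _ ≤ (continuant a * continuant (b ++ m₁)) ^ 2 := by gcongr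
      _ ≤ _ := Nat.pow_le_pow_left (continuant_mul_le _ _) 2
  · exact continuant_le_of_infix ⟨(a ++ (b ++ m₁)) ++ [c], b, by simp⟩

theorem GoodLoop.heightAt_le (h : GoodLoop t a b m)
    (ha : continuant a ∈ Set.Icc R (A * R)) (hb : continuant b ∈ Set.Icc R (A * R))
    (hm : R ≤ continuant m) {n : ℤ} {u v : List ℕ+} {c : ℕ+}
    (hsplit : b ++ (m ++ a) = u ++ c :: v)
    (hθ : OccursAt (a ++ (b ++ (m ++ (a ++ b)))) θ (n - (a ++ u).length)) :
    heightAt θ n ≤ t - 1 / (8 * A ^ 3 * (continuant (a ++ (b ++ (m ++ (a ++ b)))) : ℝ) ^ 2) := by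
  set θ' : ℤ → ℕ+ := fun k => θ (-k)
  have hθ'A : ∀ n, (θ' n : ℕ) < A := fun _ => hθA _
  have hheight : heightAt θ n = heightAt θ' (-n) := by rw [heightAt_mirror, neg_neg]
  have hrev : b.reverse ++ (a.reverse ++ (m.reverse ++ (b.reverse ++ a.reverse))) =
      (a ++ (b ++ (m ++ (a ++ b)))).reverse := by simp
  have hcont := continuant_reverse (a ++ (b ++ (m ++ (a ++ b))))
  have hθ' : OccursAt (a ++ (b ++ (m ++ (a ++ b)))).reverse θ' (-n - (v ++ b).length) := by
    convert hθ.mirror using 1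
    have := congrArg List.length hsplit
    simp only [List.length_append, List.length_cons] at this ⊢
    lia
  have ha' := ha
  have hb' := hb
  have hm' := hm
  rw [← continuant_reverse] at ha' hb' hm'
  rcases append_eq_append_cons_cases hsplit with ⟨r, hbr, hv⟩ | ⟨r, hu, hma⟩
  · rw [hheight, ← hcont, ← hrev]
    refine h.left.heightAt_le_of_last htA hθ'A hR hb' ha' hm' (a₁ := r.reverse)
      (a₂ := u.reverse) (c := c) (by simp [hbr]) ?_
    rw [hrev]
    convert hθ' using 2
    simp only [hv, List.length_append, List.length_reverse]
    lia
  rcases append_eq_append_cons_cases hma with ⟨s, hmr, hv⟩ | ⟨s, hr, har⟩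
  · rcases Nat.le_total (continuant (s ++ a)) (continuant (b ++ r)) with hle | hle
    · exact h.right.heightAt_le_of_middle htA hθA hR ha.1 hmr hle (by rwa [← hu])
    · rw [hheight, ← hcont, ← hrev]
      refine h.left.heightAt_le_of_middle htA hθ'A hR hb'.1 (m₁ := s.reverse)
        (m₂ := r.reverse) (c := c) (by simp [hmr]) ?_ ?_
      · rwa [← List.reverse_append, ← List.reverse_append, continuant_reverse, continuant_reverse]
      · rw [hrev]
        convert hθ' using 2
        simp only [hv, List.length_append, List.length_reverse]
        lia
  · exact h.right.heightAt_le_of_last htA hθA hR ha hb hm har (by rwa [← hr, ← hu])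

end GoodLoop

/-! ### From good loops to complete shifts -/

theorem exists_le_and_lt_of_strictMono {c : ℤ → ℤ} (hc : StrictMono c) (n : ℤ) :
    ∃ i, c i ≤ n ∧ n < c (i + 1) := by
  obtain ⟨_, ⟨j, rfl⟩, hj⟩ := not_bddAbove_iff.1 hc.not_bddAbove_range_of_isSuccArchimedean n
  obtain ⟨_, ⟨k, rfl⟩, hk⟩ := not_bddBelow_iff.1 hc.not_bddBelow_range_of_isPredArchimedean n
  obtain ⟨i, hi, hmax⟩ := Int.exists_greatest_of_bdd (P := fun i => c i ≤ n)
    ⟨j, fun i hi => (hc.lt_iff_lt.1 (hi.trans_lt hj)).le⟩ ⟨k, hk.le⟩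
  exact ⟨i, hi, not_le.1 fun h => (lt_add_one i).not_ge (hmax (i + 1) h)⟩

section CompleteShift

variable {B : Finset (List ℕ+)} (hB : ∀ β ∈ B, β ≠ []) {θ : ℤ → ℕ+} (hθ : θ ∈ completeShift B)

include hB hθ

theorem exists_occursAt_of_mem_completeShift (n : ℤ) :
    ∃ β₁ ∈ B, ∃ β ∈ B, ∃ β₂ ∈ B, ∃ u v, β = u ++ θ n :: v ∧
      OccursAt (β₁ ++ (β ++ β₂)) θ (n - (β₁ ++ u).length) := by
  obtain ⟨γ, c, hγ, -, hc, hθ⟩ := hθ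
  have hmono : StrictMono c := strictMono_int_of_lt_succ fun i => by
    have := List.length_pos_iff.2 (hB _ (hγ i))
    rw [hc]
    lia
  obtain ⟨i, hin, hni⟩ := exists_le_and_lt_of_strictMono hmono n
  have hocc (j : ℤ) : OccursAt (γ j) θ (c j) := hθ j
  have hprev := hc (i - 1)
  rw [sub_add_cancel] at hprev
  rw [hc] at hni
  obtain ⟨u, v, hsplit, hn⟩ := (hocc i).exists_eq_append_cons hin hni
  refine ⟨_, hγ (i - 1), _, hγ i, _, hγ (i + 1), u, v, hsplit, ?_⟩
  have hstart : n - (γ (i - 1) ++ u).length = c (i - 1) := by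
    rw [List.length_append]
    lia
  rw [hstart, occursAt_append, occursAt_append, ← hprev, ← hc]
  exact ⟨hocc _, hocc _, hocc _⟩

theorem lt_of_mem_completeShift {A : ℕ} (hA : ∀ β ∈ B, ∀ a ∈ β, (a : ℕ) < A) (n : ℤ) :
    (θ n : ℕ) < A := by
  obtain ⟨-, -, β, hβ, -, -, u, v, hsplit, -⟩ := exists_occursAt_of_mem_completeShift hB hθ n
  exact hA β hβ _ (hsplit ▸ List.mem_append_cons_self)

end CompleteShift

theorem exists_completeShift_subset_sigmaLe {t : ℝ} {A R : ℕ} (hA0 : 0 < A) (htA : t < A)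
    (hR : 32 * A ^ 7 ≤ R ^ 2) {B : Finset (List ℕ+)} {a b : List ℕ+}
    (ha : continuant a ∈ Set.Icc R (A * R)) (hb : continuant b ∈ Set.Icc R (A * R))
    (hloop : ∀ β ∈ B, ∃ m, β = b ++ (m ++ a) ∧ R ≤ continuant m ∧ GoodLoop t a b m)
    (hA : ∀ β ∈ B, ∀ x ∈ β, (x : ℕ) < A) (hne : ∀ β ∈ B, β ≠ []) :
    ∃ δ : ℝ, 0 < δ ∧ completeShift B ⊆ sigmaLe (t - δ) := by
  set G : ℕ := B.sup fun β => continuant (a ++ (β ++ b))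
  refine ⟨1 / (8 * A ^ 3 * ((G + 1 : ℕ) : ℝ) ^ 2), by positivity, fun θ hθ => ?_⟩
  refine mem_sigmaLe.2 fun n => ?_
  obtain ⟨β₁, hβ₁, β, hβ, β₂, hβ₂, u, v, hsplit, hocc⟩ :=
    exists_occursAt_of_mem_completeShift hne hθ n
  obtain ⟨m, rfl, hm, hgood⟩ := hloop β hβ
  obtain ⟨m₁, rfl, -, -⟩ := hloop β₁ hβ₁
  obtain ⟨m₂, rfl, -, -⟩ := hloop β₂ hβ₂
  have hword : OccursAt (a ++ (b ++ (m ++ (a ++ b)))) θ (n - (a ++ u).length) := by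
    have e : (b ++ (m₁ ++ a)) ++ ((b ++ (m ++ a)) ++ (b ++ (m₂ ++ a))) =
        (b ++ m₁) ++ ((a ++ (b ++ (m ++ (a ++ b)))) ++ (m₂ ++ a)) := by
      simp only [List.append_assoc]
    rw [e] at hocc
    convert (occursAt_append.1 (occursAt_append.1 hocc).2).1 using 1
    simp only [List.length_append]
    lia
  have hheight := hgood.heightAt_le htA (lt_of_mem_completeShift hne hθ hA) hR ha hb hm hsplit hword
  have hle : continuant (a ++ (b ++ (m ++ (a ++ b)))) ≤ G + 1 := by
    have := Finset.le_sup (f := fun β => continuant (a ++ (β ++ b))) hβ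
    simp only [List.append_assoc] at this
    exact this.trans (Nat.le_succ _)
  have hpos := continuant_pos (a ++ (b ++ (m ++ (a ++ b))))
  refine hheight.trans (sub_le_sub_left ?_ t)
  gcongr

/-! ### Covering numbers -/

section BoxCount

variable {ι : Type*} {T : Finset ι} {X : Set ℝ} {r : ℝ}

theorem exists_subset_Icc_of_abs_sub_le (h : ∀ x ∈ X, ∀ y ∈ X, |x - y| ≤ r) :
    ∃ a, X ⊆ Set.Icc a (a + r) := by
  rcases X.eq_empty_or_nonempty with rfl | hne
  · exact ⟨0, Set.empty_subset _⟩
  refine ⟨sInf X, fun x hx => ?_⟩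
  have hlower : x - r ∈ lowerBounds X := fun y hy => by
    linarith [(abs_le.1 (h x hx y hy)).2]
  exact ⟨csInf_le ⟨_, hlower⟩ hx, by linarith [le_csInf hne hlower]⟩

theorem boxCount_le_card (F : ι → Set ℝ) (hX : X ⊆ ⋃ i ∈ T, F i)
    (hF : ∀ i ∈ T, ∀ x ∈ F i, ∀ y ∈ F i, |x - y| ≤ r) : boxCount X r ≤ T.card := by
  classical
  have hex (i : ι) : ∃ a, i ∈ T → F i ⊆ Set.Icc a (a + r) := by
    by_cases hi : i ∈ T
    · exact (exists_subset_Icc_of_abs_sub_le (hF i hi)).imp fun _ ha _ => ha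
    · exact ⟨0, fun h => absurd h hi⟩
  choose a ha using hex
  refine (iInf₂_le (T.image a) fun x hx => ?_).trans (Nat.cast_le.2 Finset.card_image_le)
  obtain ⟨i, hi, hxi⟩ := Set.mem_iUnion₂.1 (hX hx)
  exact Set.mem_iUnion₂.2 ⟨a i, Finset.mem_image_of_mem a hi, ha i hi hxi⟩

theorem card_le_boxCount (f : ι → ℝ) (hX : ∀ i ∈ T, f i ∈ X)
    (hsep : ∀ i ∈ T, ∀ j ∈ T, i ≠ j → r < |f i - f j|) : (T.card : ℕ∞) ≤ boxCount X r := by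
  refine le_iInf₂ fun s hs => ?_
  have hex (i : ι) : ∃ a, i ∈ T → a ∈ s ∧ f i ∈ Set.Icc a (a + r) := by
    by_cases hi : i ∈ T
    · obtain ⟨a, ha, hia⟩ := Set.mem_iUnion₂.1 (hs (hX i hi))
      exact ⟨a, fun _ => ⟨ha, hia⟩⟩
    · exact ⟨0, fun h => absurd h hi⟩
  choose a ha using hex
  refine Nat.cast_le.2 (Finset.card_le_card_of_injOn a (fun i hi => (ha i hi).1) ?_)
  intro i hi j hj hij
  by_contra hne
  obtain ⟨hi₁, hi₂⟩ := (ha i hi).2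
  obtain ⟨hj₁, hj₂⟩ := (ha j hj).2
  rw [← hij] at hj₁ hj₂
  exact (hsep i hi j hj hne).not_ge (abs_le.2 ⟨by linarith, by linarith⟩)

end BoxCount

/-! ### Blocks -/

/-- A block of size `R`: a word of the language of `Σ_t` whose continuant reaches `R` exactly at
its last letter. The cylinders of all blocks cut `K_t⁺` into pieces of size about `R⁻²`. -/
structure IsBlock (t : ℝ) (R : ℕ) (u : List ℕ+) : Prop where
  mem_language : u ∈ language t
  le_continuant : R ≤ continuant u
  continuant_dropLast_lt : continuant u.dropLast < R

/-- A strict bound for the lengths of the blocks of size `R` with letters less than `A`. -/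
def blockLength (A R : ℕ) : ℕ := Nat.log 2 (2 * (A * R) ^ 2) + 1

namespace IsBlock

variable {t : ℝ} {A R : ℕ} {u v : List ℕ+}

theorem ne_nil (h : IsBlock t R u) : u ≠ [] := by
  rintro rfl
  exact h.continuant_dropLast_lt.not_ge h.le_continuant

theorem continuant_mem_Icc (htA : t < A) (h : IsBlock t R u) :
    continuant u ∈ Set.Icc R (A * R) := by
  refine ⟨h.le_continuant, ?_⟩
  have hlast := lt_of_mem_language htA h.mem_language _ (List.getLast_mem h.ne_nil)
  calc continuant u = continuant (u.dropLast ++ [u.getLast h.ne_nil]) := by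
        rw [List.dropLast_append_getLast]
    _ ≤ (u.getLast h.ne_nil + 1) * continuant u.dropLast := continuant_append_singleton_le _ _
    _ ≤ A * R := Nat.mul_le_mul hlast h.continuant_dropLast_lt.le

theorem length_lt (htA : t < A) (h : IsBlock t R u) : u.length < blockLength A R := by
  have hpow : 2 ^ u.length ≤ 2 * (A * R) ^ 2 :=
    (two_pow_length_le u).trans (by gcongr; exact (h.continuant_mem_Icc htA).2)
  have hne : 2 * (A * R) ^ 2 ≠ 0 := ((Nat.two_pow_pos _).trans_le hpow).ne'
  exact Nat.lt_succ_of_le ((Nat.le_log_iff_pow_le one_lt_two hne).2 hpow)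

theorem eq_of_prefix (hu : IsBlock t R u) (hv : IsBlock t R v) (h : u <+: v) : u = v := by
  obtain ⟨r, rfl⟩ := h
  rcases eq_or_ne r [] with rfl | hr
  · rw [List.append_nil]
  have hlt := hv.continuant_dropLast_lt
  rw [List.dropLast_append_of_ne_nil hr] at hlt
  have hle := continuant_le_of_infix (List.prefix_append u r.dropLast).isInfix
  exact absurd (hu.le_continuant.trans hle) hlt.not_ge

end IsBlock

section Blocks

variable {t : ℝ} {A R k : ℕ}

theorem finite_isBlock (t : ℝ) (R : ℕ) : {u | IsBlock t R u}.Finite := by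
  obtain ⟨A, htA⟩ := exists_nat_gt t
  refine ((Finset.range (blockLength A R)).biUnion fun l =>
    words (Finset.Icc 1 A.succPNat) l).finite_toSet.subset fun u hu => ?_
  refine Finset.mem_coe.2 (Finset.mem_biUnion.2 ⟨u.length, Finset.mem_range.2 (hu.length_lt htA),
    mem_words.2 ⟨rfl, fun x hx => Finset.mem_Icc.2 ⟨one_le, ?_⟩⟩⟩)
  exact PNat.coe_le_coe _ _ |>.1 ((lt_of_mem_language htA hu.mem_language x hx).le.trans
    A.le_succ)

/-- The finite set of all blocks of size `R`. -/
def blocks (t : ℝ) (R : ℕ) : Finset (List ℕ+) := (finite_isBlock t R).toFinset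

theorem mem_blocks {u : List ℕ+} : u ∈ blocks t R ↔ IsBlock t R u :=
  Set.Finite.mem_toFinset _

theorem exists_isBlock_occursAt {θ : ℤ → ℕ+} (hθ : θ ∈ sigmaLe t) (hR : 2 ≤ R) (n : ℤ) :
    ∃ u, IsBlock t R u ∧ OccursAt u θ n := by
  classical
  set a : ℕ → ℕ+ := fun m => θ (n + m)
  have hex : ∃ l, R ≤ continuant (initialWord a l) := by
    refine ⟨2 * R ^ 2, ?_⟩
    have hpow := two_pow_length_le (initialWord a (2 * R ^ 2))
    rw [length_initialWord] at hpow
    have hlt : 2 * R ^ 2 < 2 ^ (2 * R ^ 2) := Nat.lt_two_pow_self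
    exact (lt_of_pow_lt_pow_left₀ 2 (Nat.zero_le _) (by linarith)).le
  obtain ⟨l, hl, hmin⟩ : ∃ l, R ≤ continuant (initialWord a l) ∧
      ∀ l' < l, continuant (initialWord a l') < R :=
    ⟨Nat.find hex, Nat.find_spec hex, fun l' hl' => not_le.1 (Nat.find_min hex hl')⟩
  refine ⟨initialWord a l, ⟨⟨θ, hθ, n, occursAt_initialWord θ n l⟩, hl, ?_⟩,
    occursAt_initialWord θ n l⟩
  cases l with
  | zero =>
    rw [initialWord_zero, continuant_nil] at hl
    lia
  | succ l =>
    rw [initialWord_succ, List.dropLast_concat]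
    exact hmin l l.lt_succ_self

theorem exists_mem_words_occursAt_flatten {θ : ℤ → ℕ+} (hθ : θ ∈ sigmaLe t) (hR : 2 ≤ R)
    (k : ℕ) (n : ℤ) : ∃ w ∈ words (blocks t R) k, OccursAt w.flatten θ n := by
  induction k generalizing n with
  | zero => exact ⟨[], mem_words.2 ⟨rfl, by simp⟩, fun i hi => by simp at hi⟩
  | succ k ih =>
    obtain ⟨u, hu, hocc⟩ := exists_isBlock_occursAt hθ hR n
    obtain ⟨w, hw, hocc'⟩ := ih (n + u.length)
    obtain ⟨hlen, hmem⟩ := mem_words.1 hw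
    exact ⟨u :: w, mem_words.2 ⟨congrArg Nat.succ hlen,
      List.forall_mem_cons.2 ⟨mem_blocks.2 hu, hmem⟩⟩, occursAt_append.2 ⟨hocc, hocc'⟩⟩

theorem pow_length_le_continuant_flatten {w : List (List ℕ+)} (h : ∀ u ∈ w, R ≤ continuant u) :
    R ^ w.length ≤ continuant w.flatten := by
  induction w with
  | nil => simp
  | cons u w ih =>
    obtain ⟨hu, hw⟩ := List.forall_mem_cons.1 h
    rw [List.flatten_cons, List.length_cons, pow_succ']
    exact (Nat.mul_le_mul hu (ih hw)).trans (continuant_mul_le _ _)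

theorem continuant_flatten_le {P : ℕ} {w : List (List ℕ+)} (h : ∀ u ∈ w, continuant u ≤ P) :
    continuant w.flatten ≤ (2 * P) ^ w.length := by
  induction w with
  | nil => simp
  | cons u w ih =>
    obtain ⟨hu, hw⟩ := List.forall_mem_cons.1 h
    rw [List.flatten_cons, List.length_cons, pow_succ', mul_assoc]
    exact (continuant_append_le _ _).trans (Nat.mul_le_mul_left 2 (Nat.mul_le_mul hu (ih hw)))

theorem eq_of_flatten_prefix {α : Type*} {S : Set (List α)}
    (hS : ∀ u ∈ S, ∀ v ∈ S, u <+: v → u = v) {w v : List (List α)} (hw : ∀ u ∈ w, u ∈ S)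
    (hv : ∀ u ∈ v, u ∈ S) (hlen : w.length = v.length) (h : w.flatten <+: v.flatten) :
    w = v := by
  induction w generalizing v with
  | nil => exact (List.length_eq_zero_iff.1 hlen.symm).symm
  | cons a w ih =>
    cases v with
    | nil => simp at hlen
    | cons b v =>
      obtain ⟨ha, hw'⟩ := List.forall_mem_cons.1 hw
      obtain ⟨hb, hv'⟩ := List.forall_mem_cons.1 hv
      rw [List.flatten_cons, List.flatten_cons] at h
      have hab : a = b := by
        rcases List.prefix_or_prefix_of_prefix ((List.prefix_append _ _).trans h)
          (List.prefix_append b v.flatten) with hab | hba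
        · exact hS a ha b hb hab
        · exact (hS b hb a ha hba).symm
      subst hab
      exact congrArg (List.cons a)
        (ih hw' hv' (Nat.succ.inj hlen) ((List.prefix_append_right_inj a).1 h))

open Classical in
/-- The sequences of `k` blocks whose concatenation belongs to the language of `Σ_t`. -/
def blockWords (t : ℝ) (R k : ℕ) : Finset (List (List ℕ+)) :=
  {w ∈ words (blocks t R) k | w.flatten ∈ language t}

theorem mem_blockWords {w : List (List ℕ+)} :
    w ∈ blockWords t R k ↔ w ∈ words (blocks t R) k ∧ w.flatten ∈ language t := by
  classical exact Finset.mem_filter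

theorem blockWords_subset_words (t : ℝ) (R k : ℕ) : blockWords t R k ⊆ words (blocks t R) k :=
  fun _ h => (mem_blockWords.1 h).1

theorem boxCount_le_card_blockWords (hR : 2 ≤ R) (k : ℕ) {r : ℝ}
    (hr : 1 / ((R : ℝ) ^ k) ^ 2 ≤ r) :
    boxCount (cfProj (sigmaLe t)) r ≤ (blockWords t R k).card := by
  refine boxCount_le_card (fun w => {x | ∃ a : ℕ → ℕ+, BeginsWith a w.flatten ∧ cfVal a = x})
    ?_ ?_
  · rintro _ ⟨θ, hθ, rfl⟩
    obtain ⟨w, hw, hocc⟩ := exists_mem_words_occursAt_flatten hθ hR k 0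
    refine Set.mem_iUnion₂.2 ⟨w, mem_blockWords.2 ⟨hw, θ, hθ, 0, hocc⟩, _, ?_, rfl⟩
    simpa only [zero_add] using hocc.beginsWith
  · rintro w hw _ ⟨a, ha, rfl⟩ _ ⟨b, hb, rfl⟩
    obtain ⟨hlen, hblock⟩ := mem_words.1 (mem_blockWords.1 hw).1
    have hpow := pow_length_le_continuant_flatten fun u hu =>
      (mem_blocks.1 (hblock u hu)).le_continuant
    rw [hlen] at hpow
    have : 0 < R := by lia
    calc |cfVal a - cfVal b| ≤ 1 / (continuant (initialWord a w.flatten.length) : ℝ) ^ 2 :=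
          abs_cfVal_sub_le (ha.trans hb.symm)
      _ = 1 / (continuant w.flatten : ℝ) ^ 2 := by rw [show initialWord a _ = _ from ha]
      _ ≤ 1 / ((R : ℝ) ^ k) ^ 2 := by
          gcongr
          exact_mod_cast hpow
      _ ≤ r := hr

theorem card_blocks_le_boxCount (htA : t < A) {r : ℝ} (hr : r < 1 / (4 * A ^ 5 * (R : ℝ) ^ 2)) :
    ((blocks t R).card : ℕ∞) ≤ boxCount (cfProj (sigmaLe t)) r := by
  have hex : ∀ u ∈ blocks t R, ∃ θ ∈ sigmaLe t, OccursAt u θ 0 := fun u hu =>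
    exists_occursAt_of_mem_language (mem_blocks.1 hu).mem_language 0
  choose! θ hθ hocc using hex
  refine card_le_boxCount (fun u => cfVal fun n : ℕ => θ u n) (fun u hu => ⟨_, hθ u hu, rfl⟩)
    fun u hu v hv hne => ?_
  have hbegin (w) (hw : w ∈ blocks t R) : BeginsWith (fun n : ℕ => θ w n) w := by
    simpa only [zero_add] using (hocc w hw).beginsWith
  have hlt (w) (hw : w ∈ blocks t R) (i : ℕ) : (θ w i : ℕ) < A :=
    lt_of_mem_sigmaLe htA (hθ w hw) i
  have hdiff : initialWord (fun n : ℕ => θ u n) u.length ≠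
      initialWord (fun n : ℕ => θ v n) u.length := by
    rw [hbegin u hu]
    intro heq
    have hu' := mem_blocks.1 hu
    have hv' := mem_blocks.1 hv
    rcases (show BeginsWith (fun n : ℕ => θ v n) u from heq.symm).prefix_or_prefix (hbegin v hv)
      with h | h
    · exact hne (hu'.eq_of_prefix hv' h)
    · exact hne (hv'.eq_of_prefix hu' h).symm
  have hgap := le_abs_cfVal_sub (hlt u hu) (hlt v hv) hdiff
  rw [hbegin u hu] at hgap
  have hcont : (continuant u : ℝ) ≤ A * R := by
    exact_mod_cast ((mem_blocks.1 hu).continuant_mem_Icc htA).2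
  have hpos : (0 : ℝ) < continuant u := by exact_mod_cast continuant_pos u
  have hA0 : (0 : ℝ) < A := Nat.cast_pos.2 (Nat.pos_of_ne_zero fun h => by
    have := hlt u hu 0
    lia)
  calc r < 1 / (4 * A ^ 5 * (R : ℝ) ^ 2) := hr
    _ = 1 / (4 * A ^ 3 * (A * (R : ℝ)) ^ 2) := by ring_nf
    _ ≤ 1 / (4 * A ^ 3 * (continuant u : ℝ) ^ 2) := by gcongr
    _ ≤ _ := hgap

end Blocks

/-! ### Good loops in sequences of blocks -/

theorem eq_take_append_of_getElem?_eq {α : Type*} {w : List α} {i : ℕ} {a b : α}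
    (ha : w[i]? = some a) (hb : w[i + 1]? = some b) :
    w = w.take i ++ a :: b :: w.drop (i + 2) := by
  obtain ⟨hi, rfl⟩ := List.getElem?_eq_some_iff.1 ha
  obtain ⟨hi', rfl⟩ := List.getElem?_eq_some_iff.1 hb
  rw [← List.drop_eq_getElem_cons hi', ← List.drop_eq_getElem_cons hi, List.take_append_drop]

section GoodLoops

variable {t : ℝ} {A R k : ℕ}

theorem flanked_of_rightGood {lt : List ℕ+ → List ℕ+ → Prop} {z l r : List (List ℕ+)}
    {c : List ℕ+} (h : RightGood (blockWords t R k) lt (z ++ (l ++ c :: r)) (z ++ l).length) :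
    Flanked lt {v | l.flatten ++ v ∈ language t} c := by
  obtain ⟨x, hx, hflanked⟩ := h
  rw [← List.append_assoc] at hx
  obtain rfl : c = x := by simpa using hx
  refine hflanked.mono ?_
  rintro v ⟨u, hu, htake, hv⟩
  rw [← List.append_assoc, List.take_left] at htake
  refine mem_language_of_infix (mem_blockWords.1 hu).2 ?_
  obtain ⟨hi, rfl⟩ := List.getElem?_eq_some_iff.1 hv
  have hu' : u = z ++ l ++ u[(z ++ l).length] :: u.drop ((z ++ l).length + 1) := by
    conv_lhs => rw [← List.take_append_drop (z ++ l).length u, htake,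
      List.drop_eq_getElem_cons hi]
  generalize u.drop ((z ++ l).length + 1) = y at hu'
  generalize u[(z ++ l).length] = x at *
  subst hu'
  exact ⟨z.flatten, y.flatten, by simp⟩

theorem flanked_of_leftGood {z l r : List (List ℕ+)} {c : List ℕ+}
    (h : LeftGood (blockWords t R k) (fun x y => CfLT x.reverse y.reverse)
      (z ++ c :: (l ++ r)) z.length) :
    Flanked CfLT {v | l.flatten.reverse ++ v ∈ language t} c.reverse := by
  obtain ⟨x, hx, hflanked⟩ := h
  obtain rfl : c = x := by simpa using hx
  have hmem {v : List ℕ+} (hv : v ∈ leftLetters (blockWords t R k) (z ++ c :: (l ++ r))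
      z.length) : l.flatten.reverse ++ v.reverse ∈ language t := by
    obtain ⟨u, hu, hdrop, hv⟩ := hv
    rw [← List.reverse_append]
    refine reverse_mem_language (mem_language_of_infix (mem_blockWords.1 hu).2 ?_)
    obtain ⟨hi, rfl⟩ := List.getElem?_eq_some_iff.1 hv
    have htail : (z ++ c :: (l ++ r)).drop (z.length + 1) = l ++ r := by simp
    have hu' : u = u.take z.length ++ u[z.length] :: (l ++ r) := by
      conv_lhs => rw [← List.take_append_drop z.length u, List.drop_eq_getElem_cons hi, hdrop,
        htail]
    generalize u.take z.length = y at hu'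
    generalize u[z.length] = x at *
    subst hu'
    exact ⟨y.flatten, r.flatten, by simp⟩
  obtain ⟨⟨v, hv, hvc⟩, v', hv', hcv⟩ := hflanked
  exact ⟨⟨v.reverse, hmem hv, hvc⟩, v'.reverse, hmem hv', hcv⟩

theorem GoodPair.exists_goodLoop {p q : ℕ} {w : List (List ℕ+)} {s : List ℕ+ × List ℕ+}
    (hp : GoodPair (blockWords t R k) CfLT (fun x y => CfLT x.reverse y.reverse) w p s)
    (hq : GoodPair (blockWords t R k) CfLT (fun x y => CfLT x.reverse y.reverse) w q s)
    (hpq : p + 3 ≤ q) :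
    ∃ m : List (List ℕ+), loopWord p q w = s.2 :: (m ++ [s.1]) ∧ m ≠ [] ∧
      GoodLoop t s.1 s.2 m.flatten := by
  obtain ⟨a, b⟩ := s
  obtain ⟨j, rfl⟩ := Nat.exists_eq_add_of_le hpq
  have hdrop_p := eq_take_append_of_getElem?_eq hp.getElem_fst hp.getElem_snd
  have hdrop_q := eq_take_append_of_getElem?_eq (w := w.drop (p + 2)) (i := j + 1) (a := a)
    (b := b) (by rw [List.getElem?_drop, ← hq.getElem_fst]; congr 1; lia)
    (by rw [List.getElem?_drop, ← hq.getElem_snd]; congr 1; lia)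
  have hjw : p + 3 + j < w.length := (List.getElem?_eq_some_iff.1 hq.getElem_fst).1
  have hz : (w.take p).length = p := List.length_take_of_le (by lia)
  have hm : ((w.drop (p + 2)).take (j + 1)).length = j + 1 :=
    List.length_take_of_le (by rw [List.length_drop]; lia)
  rw [hdrop_q] at hdrop_p
  generalize w.take p = z at *
  generalize (w.drop (p + 2)).take (j + 1) = m at *
  generalize (w.drop (p + 2)).drop (j + 1 + 2) = r at *
  clear hdrop_q
  subst hdrop_p hz
  obtain rfl : j = m.length - 1 := by lia
  have hindex : z.length + 3 + (m.length - 1) = (z ++ (a :: b :: m)).length := by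
    simp only [List.length_append, List.length_cons]
    lia
  rw [hindex] at hq ⊢
  refine ⟨m, ?_, List.ne_nil_of_length_pos (by lia), ⟨?_, ?_⟩, ?_, ?_⟩
  · rw [loopWord, show (z ++ (a :: b :: m)).length - z.length = (b :: (m ++ [a])).length by simp]
    simp [List.take_length_add_append]
  · simpa using flanked_of_rightGood (l := a :: b :: m) (by simpa using hq.right_fst)
  · simpa using flanked_of_rightGood (l := a :: b :: (m ++ [a]))
      (by simpa [add_assoc] using hq.right_snd)
  · have := flanked_of_leftGood (z := z ++ [a]) (c := b) (l := m ++ [a, b]) (r := r)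
      (by simpa using hp.left_snd)
    simpa using this
  · have := flanked_of_leftGood (z := z) (c := a) (l := b :: (m ++ [a, b])) (r := r)
      (by simpa using hp.left_fst)
    simpa using this

theorem exists_loopWord_flatten_eq_of_goodPair {p q : ℕ} {w : List (List ℕ+)}
    {s : List ℕ+ × List ℕ+} (hw : w ∈ blockWords t R k)
    (hp : GoodPair (blockWords t R k) CfLT (fun x y => CfLT x.reverse y.reverse) w p s)
    (hq : GoodPair (blockWords t R k) CfLT (fun x y => CfLT x.reverse y.reverse) w q s)
    (hpq : p + 3 ≤ q) :
    ∃ m : List ℕ+, (loopWord p q w).flatten = s.2 ++ (m ++ s.1) ∧ R ≤ continuant m ∧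
      GoodLoop t s.1 s.2 m := by
  obtain ⟨m, hloop, hm, hgood⟩ := hp.exists_goodLoop hq hpq
  refine ⟨m.flatten, by rw [hloop]; simp, ?_, hgood⟩
  refine (Nat.le_self_pow (List.length_pos_iff.2 hm).ne' R).trans
    (pow_length_le_continuant_flatten fun u hu => ?_)
  refine (mem_blocks.1 ((mem_words.1 (mem_blockWords.1 hw).1).2 u
    ((loopWord_infix p q w).subset ?_))).le_continuant
  rw [hloop]
  simp [hu]

/-! ### Alphabets of concatenated blocks -/

variable {Z : Finset (List (List ℕ+))} {n : ℕ} (hZ : Z ⊆ words (blocks t R) n)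

include hZ

theorem eq_of_flatten_prefix_of_mem_words {w v : List (List ℕ+)} (hw : w ∈ Z) (hv : v ∈ Z)
    (h : w.flatten <+: v.flatten) : w = v := by
  obtain ⟨hwlen, hwblock⟩ := mem_words.1 (hZ hw)
  obtain ⟨hvlen, hvblock⟩ := mem_words.1 (hZ hv)
  exact eq_of_flatten_prefix (S := blocks t R)
    (fun _ hu _ hv => (mem_blocks.1 hu).eq_of_prefix (mem_blocks.1 hv)) hwblock hvblock
    (hwlen.trans hvlen.symm) h

theorem card_image_flatten : (Z.image List.flatten).card = Z.card :=
  Finset.card_image_of_injOn fun _ hw _ hv h =>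
    eq_of_flatten_prefix_of_mem_words hZ hw hv (h ▸ List.prefix_rfl)

theorem isAlphabet_image_flatten (hcard : 1 < Z.card) : IsAlphabet (Z.image List.flatten) := by
  have hprefix : ∀ β ∈ Z.image List.flatten, ∀ γ ∈ Z.image List.flatten, β ≠ γ → ¬ γ <+: β := by
    simp only [Finset.forall_mem_image]
    intro w hw v hv hne h
    exact hne (congrArg _ (eq_of_flatten_prefix_of_mem_words hZ hv hw h)).symm
  refine ⟨hcard.trans_eq (card_image_flatten hZ).symm, fun β hβ hnil => ?_, hprefix⟩
  obtain ⟨γ, hγ, hne⟩ := Finset.exists_mem_ne (hcard.trans_eq (card_image_flatten hZ).symm) β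
  exact hprefix γ hγ β hβ hne (hnil ▸ List.nil_prefix)

theorem ofReal_le_dimH_gaussCantorSet_image_flatten (htA : t < A) (hA0 : 0 < A) (hR : 1 ≤ R)
    (hn : 1 ≤ n) {V : ℝ} (hV : 1 ≤ V) (hcard : 1 < Z.card) (hVZ : V ^ n ≤ Z.card)
    (hA : ∀ z ∈ Z, ∀ a ∈ z.flatten, (a : ℕ) < A) :
    ENNReal.ofReal (Real.log V / (2 * Real.log (4 * A * R))) ≤
      dimH (gaussCantorSet (Z.image List.flatten)) := by
  have hAR : 1 ≤ A * R := Nat.mul_pos hA0 hR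
  have hARr : (1 : ℝ) ≤ A * R := by exact_mod_cast hAR
  have hcont : ∀ β ∈ Z.image List.flatten, continuant β ≤ (2 * (A * R)) ^ n := by
    refine Finset.forall_mem_image.2 fun z hz => ?_
    obtain ⟨hlen, hblock⟩ := mem_words.1 (hZ hz)
    exact hlen ▸ continuant_flatten_le fun u hu =>
      ((mem_blocks.1 (hblock u hu)).continuant_mem_Icc htA).2
  refine le_trans (ENNReal.ofReal_le_ofReal ?_) (ofReal_le_dimH_gaussCantorSet
    (isAlphabet_image_flatten hZ hcard) (Finset.forall_mem_image.2 hA)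
    (Nat.one_le_pow _ _ (by lia)) hcont)
  rw [card_image_flatten hZ]
  have hnum : n * Real.log V ≤ Real.log Z.card := by
    rw [← Real.log_pow]
    exact Real.log_le_log (by positivity) hVZ
  have hP : (1 : ℝ) ≤ ((2 * (A * R)) ^ n : ℕ) := by
    exact_mod_cast Nat.one_le_pow _ _ (by lia)
  have hden : Real.log (2 * ((2 * (A * R)) ^ n : ℕ)) ≤ n * Real.log (4 * A * R) := by
    rw [← Real.log_pow]
    refine Real.log_le_log (by linarith) ?_
    push_cast
    calc (2 : ℝ) * (2 * (A * R)) ^ n ≤ 2 ^ n * (2 * (A * R)) ^ n := by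
          gcongr
          exact le_self_pow₀ one_le_two (by lia)
      _ = (4 * A * R) ^ n := by rw [← mul_pow]; ring
  have hlogV : 0 ≤ Real.log V := Real.log_nonneg hV
  have hlogP : 0 < Real.log (2 * ((2 * (A * R)) ^ n : ℕ)) := Real.log_pos (by linarith)
  have hlog : 0 < Real.log (4 * A * R) := Real.log_pos (by linarith)
  rw [div_le_div_iff₀ (by positivity) (by positivity)]
  calc Real.log V * (2 * Real.log (2 * ((2 * (A * R)) ^ n : ℕ)))
      ≤ Real.log V * (2 * (n * Real.log (4 * A * R))) := by gcongr
    _ = n * Real.log V * (2 * Real.log (4 * A * R)) := by ring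
    _ ≤ Real.log Z.card * (2 * Real.log (4 * A * R)) := by gcongr

end GoodLoops

theorem exists_alphabet_of_lt_card_blockWords {t : ℝ} {A R k m : ℕ} (htA : t < A) (hA0 : 0 < A)
    (hR : 32 * A ^ 7 ≤ R ^ 2) {V : ℝ} (hV : 1 ≤ V) (hblocks : 1 ≤ (blocks t R).card)
    (hm : 4 * ((2 * blockLength A R + 1) * (blocks t R).card) ^ k ≤
      (blocks t R).card ^ m * (blockWords t R k).card)
    (hlarge : 2 * (((k : ℝ) ^ 2 * ((blocks t R).card ^ 2 : ℕ) + 1) ^ ((blocks t R).card ^ 2) *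
      ((blocks t R).card : ℝ) ^ (4 * m + 2 + (blocks t R).card ^ 2 * (3 + 1)) * V ^ k) <
        (blockWords t R k).card) :
    ∃ (δ : ℝ) (B : Finset (List ℕ+)), 0 < δ ∧ IsAlphabet B ∧
      completeShift B ⊆ sigmaLe (t - δ) ∧
      ENNReal.ofReal (Real.log V / (2 * Real.log (4 * A * R))) ≤ dimH (gaussCantorSet B) := by
  have hR1 : 1 ≤ R := Nat.pos_of_ne_zero fun h => by
    have : 0 < A ^ 7 := by positivity
    rw [h] at hR
    lia
  obtain ⟨p, q, s, Z, hpq, hZ, hVZ⟩ := exists_loop hblocks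
    (fun u hu => (mem_blocks.1 hu).length_lt htA)
    (fun x _ y _ hlen hne => cfLT_or_cfLT hlen hne)
    (fun x _ y _ hlen hne => cfLT_or_cfLT (u := x.reverse) (v := y.reverse)
      (by simpa using hlen) (List.reverse_injective.ne hne))
    (blockWords_subset_words t R k) hm hV hlarge
  have hwords : Z ⊆ words (blocks t R) (q - p) := fun z hz => by
    obtain ⟨w, hw, -, hq, rfl⟩ := hZ z hz
    rw [← length_loopWord (List.getElem?_eq_some_iff.1 hq.getElem_fst).1]
    exact mem_words_of_sublist (mem_blockWords.1 hw).1 (loopWord_infix p q w).sublist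
  have hletters : ∀ z ∈ Z, ∀ a ∈ z.flatten, (a : ℕ) < A := fun z hz => by
    obtain ⟨w, hw, -, -, rfl⟩ := hZ z hz
    exact lt_of_mem_language htA (mem_language_of_infix (mem_blockWords.1 hw).2
      (loopWord_infix p q w).flatten)
  have hcard : 1 < Z.card := by
    exact_mod_cast (one_le_pow₀ hV).trans_lt hVZ
  have halph := isAlphabet_image_flatten hwords hcard
  obtain ⟨z₀, hz₀⟩ := Finset.card_pos.1 (zero_lt_one.trans hcard)
  obtain ⟨w₀, hw₀, hp₀, -, -⟩ := hZ z₀ hz₀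
  obtain ⟨hs₁, hs₂⟩ := Finset.mem_product.1 (hp₀.mem_product (mem_blockWords.1 hw₀).1)
  obtain ⟨δ, hδ, hsub⟩ := exists_completeShift_subset_sigmaLe hA0 htA hR
    (B := Z.image List.flatten) ((mem_blocks.1 hs₁).continuant_mem_Icc htA)
    ((mem_blocks.1 hs₂).continuant_mem_Icc htA) (Finset.forall_mem_image.2 fun z hz => by
      obtain ⟨w, hw, hp, hq, rfl⟩ := hZ z hz
      exact exists_loopWord_flatten_eq_of_goodPair hw hp hq hpq)
    (Finset.forall_mem_image.2 hletters) halph.ne_nil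
  exact ⟨δ, _, hδ, halph, hsub, ofReal_le_dimH_gaussCantorSet_image_flatten hwords htA hA0 hR1
    (by lia) hV hcard hVZ.le hletters⟩

/-! ### Box-counting dimension -/

theorem ennreal_log_natCast {n : ℕ} (hn : n ≠ 0) :
    ENNReal.log (n : ENNReal) = (Real.log n : EReal) := by
  rw [← ENNReal.ofReal_natCast, ENNReal.log_ofReal_of_pos (by exact_mod_cast Nat.pos_of_ne_zero hn)]

theorem tendsto_log_one_div_nhdsGT_zero :
    Tendsto (fun r : ℝ => Real.log (1 / r)) (𝓝[>] 0) atTop := by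
  simpa [Function.comp_def] using
    Real.tendsto_log_atTop.comp (tendsto_inv_nhdsGT_zero (𝕜 := ℝ))

section BoxDim

variable {X : Set ℝ} {a b c r : ℝ}

theorem eventually_log_le_of_boxDim_lt (h : boxDim X < c) :
    ∀ᶠ r : ℝ in 𝓝[>] 0, ∀ n : ℕ, n ≠ 0 → (n : ℕ∞) ≤ boxCount X r →
      Real.log n ≤ c * Real.log (1 / r) := by
  filter_upwards [eventually_lt_of_limsup_lt h,
    tendsto_log_one_div_nhdsGT_zero.eventually_gt_atTop 0] with r hr hlog n hn hle
  rw [EReal.div_lt_iff (by exact_mod_cast hlog) (EReal.coe_ne_top _)] at hr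
  have hmono : ENNReal.log (n : ENNReal) ≤ ENNReal.log (boxCount X r : ENNReal) :=
    ENNReal.log_le_log (by exact_mod_cast hle)
  rw [ennreal_log_natCast hn] at hmono
  exact_mod_cast (hmono.trans_lt hr).le

theorem frequently_lt_log_of_lt_boxDim (h : (c : EReal) < boxDim X) :
    ∃ᶠ r : ℝ in 𝓝[>] 0, ∀ n : ℕ, boxCount X r ≤ n → c * Real.log (1 / r) < Real.log n := by
  refine ((frequently_lt_of_lt_limsup (by isBoundedDefault) h).and_eventually
    (tendsto_log_one_div_nhdsGT_zero.eventually_gt_atTop 0)).mono ?_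
  rintro r ⟨hr, hlog⟩ n hle
  rw [EReal.lt_div_iff (by exact_mod_cast hlog) (EReal.coe_ne_top _)] at hr
  have hmono : ENNReal.log (boxCount X r : ENNReal) ≤ ENNReal.log (n : ENNReal) :=
    ENNReal.log_le_log (by exact_mod_cast hle)
  have hn : n ≠ 0 := by
    rintro rfl
    simpa using hr.trans_le hmono
  rw [ennreal_log_natCast hn] at hmono
  exact_mod_cast hr.trans_le hmono

theorem boxCount_le_of_subset_Icc (hr : 0 < r) (hX : X ⊆ Set.Icc a b) :
    boxCount X r ≤ (⌊(b - a) / r⌋₊ + 1 : ℕ) := by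
  classical
  refine (iInf₂_le ((Finset.range (⌊(b - a) / r⌋₊ + 1)).image fun i : ℕ => a + i * r) ?_).trans ?_
  · intro x hx
    obtain ⟨hax, hxb⟩ := hX hx
    have hfloor := (le_div_iff₀ hr).1 (Nat.floor_le (div_nonneg (sub_nonneg.2 hax) hr.le))
    have hlt := (div_lt_iff₀ hr).1 (Nat.lt_floor_add_one ((x - a) / r))
    refine Set.mem_iUnion₂.2 ⟨a + ⌊(x - a) / r⌋₊ * r, Finset.mem_image.2 ⟨_, ?_, rfl⟩, ?_⟩
    · rw [Finset.mem_range, Nat.lt_succ_iff]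
      gcongr
    · constructor <;> linarith
  · exact_mod_cast Finset.card_image_le.trans (Finset.card_range _).le

theorem boxDim_le_one (hX : Bornology.IsBounded X) : boxDim X ≤ 1 := by
  obtain ⟨l, hl⟩ := hX.bddBelow
  obtain ⟨u, hu⟩ := hX.bddAbove
  refine EReal.le_of_forall_lt_iff_le.1 fun c hc => limsup_le_of_le (by isBoundedDefault) ?_
  have hc1 : 0 < c - 1 := sub_pos.2 (by exact_mod_cast hc)
  filter_upwards [tendsto_log_one_div_nhdsGT_zero.eventually_gt_atTop 0,
    tendsto_log_one_div_nhdsGT_zero.eventually_ge_atTop (Real.log (|u - l| + 1) / (c - 1)),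
    Ioo_mem_nhdsGT one_pos] with r hlog hlarge hr
  rw [EReal.div_le_iff_le_mul (by exact_mod_cast hlog) (EReal.coe_ne_top _), mul_comm]
  have hcount : ENNReal.log (boxCount X r : ENNReal) ≤
      ENNReal.log ((⌊(u - l) / r⌋₊ + 1 : ℕ) : ENNReal) :=
    ENNReal.log_le_log (by
      exact_mod_cast boxCount_le_of_subset_Icc hr.1 fun x hx => ⟨hl hx, hu hx⟩)
  have hfloor : ((⌊(u - l) / r⌋₊ + 1 : ℕ) : ℝ) ≤ (|u - l| + 1) * (1 / r) := by
    have hle : (⌊(u - l) / r⌋₊ : ℝ) ≤ |u - l| / r :=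
      (Nat.cast_le.2 (Nat.floor_le_floor (by gcongr; exacts [hr.1.le, le_abs_self _]))).trans
        (Nat.floor_le (div_nonneg (abs_nonneg _) hr.1.le))
    have : 1 ≤ 1 / r := (one_le_div hr.1).2 hr.2.le
    push_cast
    calc (⌊(u - l) / r⌋₊ : ℝ) + 1 ≤ |u - l| / r + 1 / r := add_le_add hle this
      _ = (|u - l| + 1) * (1 / r) := by ring
  have hlogle := Real.log_le_log (by positivity) hfloor
  rw [Real.log_mul (by positivity) (one_div_pos.2 hr.1).ne'] at hlogle
  rw [ennreal_log_natCast (Nat.succ_ne_zero _)] at hcount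
  refine hcount.trans ?_
  rw [div_le_iff₀ hc1] at hlarge
  exact_mod_cast hlogle.trans (by linarith)

end BoxDim

theorem cfProj_subset_Icc (S : Set (ℤ → ℕ+)) : cfProj S ⊆ Set.Icc 0 1 := by
  rintro _ ⟨θ, -, rfl⟩
  exact cfVal_mem_Icc _

theorem deltaPlus_le_one (t : ℝ) : deltaPlus t ≤ 1 :=
  boxDim_le_one ((Metric.isBounded_Icc 0 1).subset (cfProj_subset_Icc _))

/-! ### Choosing the scale and the number of blocks -/

theorem tendsto_log_natCast : Tendsto (fun n : ℕ => Real.log n) atTop atTop :=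
  Real.tendsto_log_atTop.comp tendsto_natCast_atTop_atTop

theorem eventually_log_card_blocks_le {t c : ℝ} (hc : 0 ≤ c) (h : deltaPlus t < c) :
    ∀ᶠ R : ℕ in atTop, Real.log (blocks t R).card ≤ c * (2 * Real.log R) := by
  obtain ⟨b, hb, hbc⟩ := EReal.lt_iff_exists_real_btwn.1 h
  have hbc' : 0 < c - b := sub_pos.2 (by exact_mod_cast hbc)
  set A := ⌊t⌋₊ + 1
  have htA : t < A := by exact_mod_cast Nat.lt_floor_add_one t
  set M : ℝ := 8 * A ^ 5
  have hMpos : 0 < M := by positivity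
  have hscale : Tendsto (fun R : ℕ => 1 / (M * (R : ℝ) ^ 2)) atTop (𝓝[>] 0) := by
    have : Tendsto (fun R : ℕ => M * (R : ℝ) ^ 2) atTop atTop :=
      ((tendsto_pow_atTop two_ne_zero).comp tendsto_natCast_atTop_atTop).const_mul_atTop hMpos
    simpa [Function.comp_def] using tendsto_inv_atTop_nhdsGT_zero.comp this
  filter_upwards [hscale.eventually (eventually_log_le_of_boxDim_lt hb),
    tendsto_log_natCast.eventually_ge_atTop (b * Real.log M / (2 * (c - b))),
    eventually_ge_atTop 1] with R hcount hlarge hR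
  have hR0 : (0 : ℝ) < R := by exact_mod_cast hR
  rcases eq_or_ne (blocks t R).card 0 with hzero | hne
  · rw [hzero, Nat.cast_zero, Real.log_zero]
    have := Real.log_natCast_nonneg R
    positivity
  · have hle := hcount _ hne (card_blocks_le_boxCount htA ?_)
    · rw [one_div_one_div, Real.log_mul hMpos.ne' (by positivity), Real.log_pow] at hle
      rw [div_le_iff₀ (by positivity)] at hlarge
      push_cast at hle
      linarith
    · gcongr
      exact mul_lt_mul_of_pos_right (by norm_num) (by positivity)

theorem frequently_lt_log_card_blockWords {t c : ℝ} {R : ℕ} (hR : 2 ≤ R) (hc : 0 ≤ c)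
    (h : (c : EReal) < deltaPlus t) :
    ∃ᶠ k : ℕ in atTop, c * (2 * Real.log R) * k < Real.log (blockWords t R k).card := by
  obtain ⟨b, hcb, hb⟩ := EReal.lt_iff_exists_real_btwn.1 h
  have hcb' : 0 < b - c := sub_pos.2 (by exact_mod_cast hcb)
  have hx : 0 < 2 * Real.log R := mul_pos two_pos (Real.log_pos (by exact_mod_cast hR))
  set x := 2 * Real.log R
  refine frequently_atTop.2 fun n => ?_
  obtain ⟨r, hr, hlog, hr0⟩ := ((frequently_lt_log_of_lt_boxDim hb).and_eventually
    ((tendsto_log_one_div_nhdsGT_zero.eventually_ge_atTop (x * max (n : ℝ) (c / (b - c)))).and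
      self_mem_nhdsWithin)).exists
  replace hr0 : 0 < r := hr0
  set y := Real.log (1 / r) / x with hy
  have hyx : Real.log (1 / r) = y * x := (div_mul_cancel₀ _ hx.ne').symm
  have hmax : max (n : ℝ) (c / (b - c)) ≤ y := by
    rwa [hy, le_div_iff₀ hx, mul_comm]
  obtain ⟨hny, hcy⟩ := max_le_iff.1 hmax
  rw [div_le_iff₀ hcb'] at hcy
  have hceil : (⌈y⌉₊ : ℝ) ≤ y + 1 := (Nat.ceil_lt_add_one ((Nat.cast_nonneg n).trans hny)).le
  refine ⟨⌈y⌉₊, Nat.cast_le.1 (hny.trans (Nat.le_ceil y)), ?_⟩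
  have hcover : 1 / ((R : ℝ) ^ ⌈y⌉₊) ^ 2 ≤ r := by
    rw [one_div_le (by positivity) hr0, ← Real.log_le_log_iff (by positivity) (by positivity),
      Real.log_pow, Real.log_pow, hyx]
    calc y * x ≤ ⌈y⌉₊ * x := by gcongr; exact Nat.le_ceil y
      _ = _ := by push_cast; ring
  calc c * x * ⌈y⌉₊ ≤ c * x * (y + 1) := by gcongr
    _ = (c * y + c) * x := by ring
    _ ≤ b * y * x := by gcongr; linarith
    _ = b * Real.log (1 / r) := by rw [hyx, mul_assoc]
    _ < _ := hr _ (boxCount_le_card_blockWords hR _ hcover)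

theorem blockLength_le {A R : ℕ} (hAR : 2 * A ^ 2 ≤ R) :
    (blockLength A R : ℝ) ≤ 6 * Real.log R + 1 := by
  have hpow : 2 * (A * R) ^ 2 ≤ R ^ 3 := by
    calc 2 * (A * R) ^ 2 = 2 * A ^ 2 * R ^ 2 := by ring
      _ ≤ R * R ^ 2 := by gcongr
      _ = R ^ 3 := by ring
  have hlog : (Nat.log 2 (2 * (A * R) ^ 2) : ℝ) ≤ 3 * (Real.log R / Real.log 2) := by
    calc (Nat.log 2 (2 * (A * R) ^ 2) : ℝ) ≤ Nat.log 2 (R ^ 3) :=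
          Nat.cast_le.2 (Nat.log_mono_right hpow)
      _ ≤ Real.logb 2 ((R ^ 3 : ℕ) : ℝ) := by exact_mod_cast Real.natLog_le_logb (R ^ 3) 2
      _ = 3 * (Real.log R / Real.log 2) := by
        rw [Nat.cast_pow, Real.logb_pow, Real.logb, Nat.cast_ofNat]
  have htwo : Real.log R / Real.log 2 ≤ 2 * Real.log R := by
    have := Real.log_two_gt_d9
    rw [div_le_iff₀ (by linarith)]
    nlinarith [Real.log_natCast_nonneg R]
  rw [blockLength]
  push_cast
  linarith

theorem eventually_log_blockLength_le (A : ℕ) {c : ℝ} (hc : 0 < c) :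
    ∀ᶠ R : ℕ in atTop, Real.log (2 * (blockLength A R : ℝ) + 1) ≤ c * Real.log R := by
  have hlittle : ∀ᶠ x : ℝ in atTop, Real.log (15 * x) ≤ c * x := by
    have := Real.isLittleO_log_id_atTop.comp_tendsto (tendsto_id.const_mul_atTop
      (by norm_num : (0 : ℝ) < 15))
    filter_upwards [this.bound (show 0 < c / 15 by positivity), eventually_ge_atTop 0] with x hx hx0
    calc Real.log (15 * x) ≤ ‖Real.log (15 * x)‖ := le_abs_self _
      _ ≤ c / 15 * ‖15 * x‖ := hx
      _ = c * x := by rw [Real.norm_of_nonneg (by positivity)]; ring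
  filter_upwards [tendsto_log_natCast.eventually hlittle,
    tendsto_log_natCast.eventually_ge_atTop 1, eventually_ge_atTop (2 * A ^ 2)] with R hR hlog hAR
  refine (Real.log_le_log (by positivity) ?_).trans hR
  linarith [blockLength_le hAR]

theorem eventually_add_mul_log_lt (a b M : ℝ) {c : ℝ} (hM : 0 ≤ M) (hc : 0 < c) :
    ∀ᶠ k : ℕ in atTop, a + b * Real.log ((k : ℝ) ^ 2 * M + 1) < c * k := by
  have hlog : (fun x : ℝ => Real.log (x ^ 2 * M + 1)) =o[atTop] (id : ℝ → ℝ) := by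
    refine Asymptotics.IsBigO.trans_isLittleO (.of_norm_eventuallyLE ?_)
      ((Asymptotics.isLittleO_const_id_atTop (Real.log (M + 1))).add
        (Real.isLittleO_log_id_atTop.const_mul_left 2))
    filter_upwards [eventually_ge_atTop 1] with x hx
    rw [Real.norm_of_nonneg (Real.log_nonneg (by simp only [le_add_iff_nonneg_left]; positivity))]
    calc Real.log (x ^ 2 * M + 1) ≤ Real.log ((M + 1) * x ^ 2) :=
          Real.log_le_log (by positivity) (by nlinarith [one_le_pow₀ hx (n := 2)])
      _ = Real.log (M + 1) + 2 * Real.log x := by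
        rw [Real.log_mul (by positivity) (by positivity), Real.log_pow, Nat.cast_ofNat]
  have hlittle : (fun x => a + b * Real.log (x ^ 2 * M + 1)) =o[atTop] (id : ℝ → ℝ) :=
    (Asymptotics.isLittleO_const_id_atTop a).add (hlog.const_mul_left b)
  filter_upwards [tendsto_natCast_atTop_atTop.eventually (hlittle.bound (half_pos hc)),
    eventually_gt_atTop 0] with k hk hk0
  have hk0' : (0 : ℝ) < k := Nat.cast_pos.2 hk0
  calc _ ≤ c / 2 * ‖(k : ℝ)‖ := (le_abs_self _).trans hk
    _ < c * k := by
      rw [Real.norm_of_nonneg hk0'.le]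
      exact mul_lt_mul_of_pos_right (half_lt_self hc) hk0'

section Estimates

variable {N W k m : ℕ} {κ h : ℝ}

theorem four_mul_mul_pow_le_pow_mul {L : ℕ} (hN : 1 ≤ N) (hW : 1 ≤ W) (hL : 2 ≤ L) (hk : 1 ≤ k)
    (hκ : 3 * κ ≤ 1) (hh : 0 ≤ h) (hlogN : Real.log N ≤ (1 + κ) * h)
    (hlogW : (1 - κ) * h * k ≤ Real.log W) (hlogL : 2 * Real.log (2 * (L : ℝ) + 1) ≤ κ * h)
    (hm : 3 * κ * k ≤ m) : 4 * ((2 * L + 1) * N) ^ k ≤ N ^ m * W := by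
  have hN0 : (0 : ℝ) < N := by exact_mod_cast hN
  have hW0 : (0 : ℝ) < W := by exact_mod_cast hW
  have hk1 : (1 : ℝ) ≤ k := by exact_mod_cast hk
  set ℓ := Real.log (2 * (L : ℝ) + 1)
  have hfour : Real.log 4 ≤ k * ℓ := by
    have hL2 : (2 : ℝ) ≤ L := by exact_mod_cast hL
    have : Real.log 4 ≤ ℓ := Real.log_le_log (by norm_num) (by linarith)
    exact this.trans (le_mul_of_one_le_left ((Real.log_nonneg (by norm_num)).trans this) hk1)
  have hmN : 3 * κ * k * Real.log N ≤ m * Real.log N := by gcongr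
  have hlog : 2 * ℓ + (1 - 3 * κ) * Real.log N ≤ (1 - κ) * h := by
    have := mul_le_mul_of_nonneg_left hlogN (sub_nonneg.2 hκ)
    nlinarith [mul_nonneg (sq_nonneg κ) hh]
  have hreal : (4 : ℝ) * ((2 * (L : ℝ) + 1) * N) ^ k ≤ (N : ℝ) ^ m * W := by
    rw [← Real.log_le_log_iff (by positivity) (by positivity),
      Real.log_mul (by norm_num) (by positivity), Real.log_pow,
      Real.log_mul (by positivity) hN0.ne', Real.log_mul (by positivity) hW0.ne', Real.log_pow]
    linarith [mul_le_mul_of_nonneg_left hlog k.cast_nonneg]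
  exact_mod_cast hreal

theorem two_mul_pow_mul_exp_pow_lt (hN : 1 ≤ N) (hW : 1 ≤ W) (hκ : 0 ≤ κ) (hκ1 : κ ≤ 1)
    (hh : 0 ≤ h) (hlogN : Real.log N ≤ (1 + κ) * h) (hlogW : (1 - κ) * h * k ≤ Real.log W)
    (hm : m ≤ 3 * κ * k + 1)
    (hk : Real.log 2 + (6 + 4 * (N : ℝ) ^ 2) * Real.log N +
      (N : ℝ) ^ 2 * Real.log ((k : ℝ) ^ 2 * (N : ℝ) ^ 2 + 1) < κ * h * k) :
    2 * (((k : ℝ) ^ 2 * (N ^ 2 : ℕ) + 1) ^ (N ^ 2) * (N : ℝ) ^ (4 * m + 2 + N ^ 2 * (3 + 1)) *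
      Real.exp ((1 - 26 * κ) * h) ^ k) < W := by
  have : (0 : ℝ) < N := by exact_mod_cast hN
  have hW0 : (0 : ℝ) < W := by exact_mod_cast hW
  rw [← Real.log_lt_log_iff (by positivity) hW0, Real.log_mul (by norm_num) (by positivity),
    Real.log_mul (by positivity) (by positivity), Real.log_mul (by positivity) (by positivity),
    Real.log_pow, Real.log_pow, Real.log_pow, Real.log_exp]
  have hmN : (m : ℝ) * Real.log N ≤ (3 * κ * k + 1) * Real.log N := by gcongr
  have hN2 : 3 * κ * k * Real.log N ≤ 3 * κ * k * (2 * h) := by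
    gcongr
    exact hlogN.trans (by gcongr; linarith)
  push_cast at hk ⊢
  linarith

theorem mul_le_mul_div_add {D x y : ℝ} (hD : 0 ≤ D) (hκ : 0 ≤ κ) (hκ1 : 27 * κ ≤ 1) (hx : 0 < x)
    (hy : 0 < y) (hyx : y ≤ κ * x) :
    (1 - 27 * κ) * D ≤ (1 - 26 * κ) * (2 * D * x) / (2 * (y + x)) := by
  rw [le_div_iff₀ (by positivity)]
  calc (1 - 27 * κ) * D * (2 * (y + x)) ≤ (1 - 27 * κ) * D * (2 * ((1 + κ) * x)) := by
        gcongr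
        linarith
    _ = ((1 - 27 * κ) * (1 + κ)) * (2 * D * x) := by ring
    _ ≤ (1 - 26 * κ) * (2 * D * x) := by
      gcongr
      nlinarith

end Estimates

theorem two_le_blockLength {A R : ℕ} (hA : 0 < A) (hR : 0 < R) : 2 ≤ blockLength A R := by
  have : 2 ≤ 2 * (A * R) ^ 2 := Nat.le_mul_of_pos_right 2 (by positivity)
  exact Nat.succ_le_succ (Nat.log_pos one_lt_two this)

theorem one_le_card_blocks {t : ℝ} {R k : ℕ} (h : 1 ≤ (blockWords t R k).card) (hk : k ≠ 0) :
    1 ≤ (blocks t R).card := by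
  have := h.trans (Finset.card_le_card (blockWords_subset_words t R k))
  rw [card_words] at this
  exact Nat.pos_of_ne_zero fun h0 => by simp [h0, hk] at this

theorem exists_scale {t D κ : ℝ} (hD0 : 0 < D) (hD : deltaPlus t = D) (hκ : 0 < κ) (A : ℕ) :
    ∃ R : ℕ, 2 ≤ R ∧ 32 * A ^ 7 ≤ R ^ 2 ∧ Real.log (4 * A) ≤ κ * Real.log R ∧
      2 * Real.log (2 * (blockLength A R : ℝ) + 1) ≤ κ * (2 * D * Real.log R) ∧
      Real.log (blocks t R).card ≤ (1 + κ) * (2 * D * Real.log R) := by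
  have hlt : deltaPlus t < ((1 + κ) * D : ℝ) := by
    rw [hD, EReal.coe_lt_coe_iff]
    linarith [mul_pos hκ hD0]
  have hpow : ∀ᶠ R : ℕ in atTop, 32 * A ^ 7 ≤ R ^ 2 :=
    (tendsto_pow_atTop two_ne_zero).eventually_ge_atTop _
  obtain ⟨R, hR, hAR, hlogA, hlen, hblocks⟩ := ((eventually_ge_atTop 2).and (hpow.and
    ((tendsto_log_natCast.eventually_ge_atTop (Real.log (4 * A) / κ)).and
      ((eventually_log_blockLength_le A (mul_pos hκ hD0)).and
        (eventually_log_card_blocks_le (by positivity) hlt))))).exists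
  rw [div_le_iff₀' hκ] at hlogA
  exact ⟨R, hR, hAR, hlogA, by linarith, by linarith⟩

theorem exists_alphabet_of_deltaPlus {t D η : ℝ} (hD0 : 0 < D) (hD : deltaPlus t = D)
    (hη : 0 < η) (hη1 : η ≤ 1) :
    ∃ (δ : ℝ) (B : Finset (List ℕ+)), 0 < δ ∧ IsAlphabet B ∧ completeShift B ⊆ sigmaLe (t - δ) ∧
      ENNReal.ofReal ((1 - η) * D) ≤ dimH (gaussCantorSet B) := by
  -- Markers cost `24 κ`, the two box-counting estimates `2 κ`, replacing `R` by `4 A R` costs `κ`.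
  obtain ⟨κ, rfl⟩ : ∃ κ, η = 27 * κ := ⟨η / 27, by ring⟩
  have hκ : 0 < κ := by linarith
  set A := ⌊t⌋₊ + 1
  have htA : t < A := by exact_mod_cast Nat.lt_floor_add_one t
  obtain ⟨R, hR, hAR, hlogA, hlogL, hlogN⟩ := exists_scale hD0 hD hκ A
  have hx : 0 < Real.log R := Real.log_pos (by exact_mod_cast hR)
  set x := Real.log R
  set h := 2 * D * x
  have hh : 0 < h := by positivity
  set N := (blocks t R).card
  have hlt : (((1 - κ) * D : ℝ) : EReal) < deltaPlus t := by
    rw [hD, EReal.coe_lt_coe_iff]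
    linarith [mul_pos hκ hD0]
  have hκD : 0 ≤ (1 - κ) * D := mul_nonneg (by linarith) hD0.le
  obtain ⟨k, hlogW, hk, hk1⟩ := ((frequently_lt_log_card_blockWords hR hκD hlt).and_eventually
    ((eventually_add_mul_log_lt (Real.log 2 + (6 + 4 * (N : ℝ) ^ 2) * Real.log N) ((N : ℝ) ^ 2)
      ((N : ℝ) ^ 2) (by positivity) (mul_pos hκ hh)).and (eventually_ge_atTop 1))).exists
  replace hlogW : (1 - κ) * h * k ≤ Real.log (blockWords t R k).card := by linarith
  have hW : 1 ≤ (blockWords t R k).card := Nat.one_le_iff_ne_zero.2 fun h0 => by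
    rw [h0, Nat.cast_zero, Real.log_zero] at hlogW
    have : 0 < (1 - κ) * h * k := mul_pos (mul_pos (by linarith) hh) (by exact_mod_cast hk1)
    linarith
  have hN : 1 ≤ N := one_le_card_blocks hW (by lia)
  obtain ⟨δ, B, hδ, hB, hBt, hdim⟩ := exists_alphabet_of_lt_card_blockWords (k := k)
    (m := ⌈3 * κ * k⌉₊) htA (Nat.succ_pos _) hAR
    (Real.one_le_exp (show 0 ≤ (1 - 26 * κ) * h from mul_nonneg (by linarith) hh.le)) hN
    (four_mul_mul_pow_le_pow_mul hN hW (two_le_blockLength (Nat.succ_pos _) (by lia)) hk1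
      (by linarith) hh.le hlogN hlogW hlogL (Nat.le_ceil _))
    (two_mul_pow_mul_exp_pow_lt hN hW hκ.le (by linarith) hh.le hlogN hlogW
      (Nat.ceil_lt_add_one (by positivity)).le hk)
  refine ⟨δ, B, hδ, hB, hBt, (ENNReal.ofReal_le_ofReal ?_).trans hdim⟩
  have hA : (1 : ℝ) ≤ A := by exact_mod_cast Nat.succ_pos _
  rw [Real.log_exp, Real.log_mul (by positivity) (by positivity)]
  exact mul_le_mul_div_add hD0.le hκ.le hη1 hx (Real.log_pos (by linarith)) hlogA

/-! ### Sumsets of sets of box-counting dimension zero -/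

theorem eventually_exists_cover_card_le {X : Set ℝ} {c : ℝ} (h : boxDim X < c) :
    ∀ᶠ r : ℝ in 𝓝[>] 0, ∃ s : Finset ℝ, X ⊆ ⋃ a ∈ s, Set.Icc a (a + r) ∧
      (s.card : ℝ) ≤ (1 / r) ^ c := by
  filter_upwards [eventually_log_le_of_boxDim_lt h, self_mem_nhdsWithin] with r hr hr0
  have hle (n : ℕ) (hn : n ≤ boxCount X r) : (n : ℝ) ≤ (1 / r) ^ c := by
    have hpow : 0 < (1 / r) ^ c := Real.rpow_pos_of_pos (one_div_pos.2 hr0) c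
    rcases eq_or_ne n 0 with rfl | hn0
    · exact_mod_cast hpow.le
    · have hn0' : (0 : ℝ) < n := by exact_mod_cast Nat.pos_of_ne_zero hn0
      rw [← Real.log_le_log_iff hn0' hpow, Real.log_rpow (one_div_pos.2 hr0)]
      exact hr n hn0 hn
  have hfin : boxCount X r ≠ ⊤ := by
    intro htop
    obtain ⟨n, hn⟩ := exists_nat_gt ((1 / r) ^ c)
    exact hn.not_ge (hle n (htop ▸ le_top))
  obtain ⟨n, hn⟩ := ENat.ne_top_iff_exists.1 hfin
  have hlt : boxCount X r < (n + 1 : ℕ) := hn ▸ by exact_mod_cast n.lt_succ_self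
  obtain ⟨s, hcover, hcard⟩ := by simpa only [boxCount, iInf_lt_iff] using hlt
  have hcard' : s.card ≤ n := Nat.lt_succ_iff.1 (by exact_mod_cast hcard)
  exact ⟨s, hcover, hle _ (hn ▸ by exact_mod_cast hcard')⟩

theorem dimH_le_of_eventually_exists_cover {S : Set ℝ} {C K : ℝ} {d : NNReal} (hK : 0 ≤ K)
    (h : ∀ᶠ r : ℝ in 𝓝[>] 0, ∃ s : Finset ℝ, S ⊆ ⋃ a ∈ s, Set.Icc a (a + K * r) ∧
      (s.card : ℝ) ≤ C * (1 / r) ^ (d : ℝ)) :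
    dimH S ≤ d := by
  obtain ⟨s, hs⟩ := h.choice
  have hediam (r a : ℝ) : Metric.ediam (Set.Icc a (a + K * r)) = ENNReal.ofReal (K * r) := by
    rw [Real.ediam_Icc, add_sub_cancel_left]
  have htendsto : Tendsto (fun r : ℝ => ENNReal.ofReal (K * r)) (𝓝[>] 0) (𝓝 0) := by
    have hcont : Continuous fun r : ℝ => ENNReal.ofReal (K * r) :=
      ENNReal.continuous_ofReal.comp (continuous_const_mul K)
    simpa using (hcont.tendsto 0).mono_left nhdsWithin_le_nhds
  have hmeasure := MeasureTheory.Measure.hausdorffMeasure_le_liminf_sum (X := ℝ) (ι := fun r => s r)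
    (d : ℝ) S _ htendsto (fun r i => Set.Icc (i : ℝ) (i + K * r))
    (Eventually.of_forall fun r i => (hediam r i).le)
    (hs.mono fun r hr => hr.1.trans
      (Set.iUnion_subtype (· ∈ s r) fun i => Set.Icc (i : ℝ) (i + K * r)).ge)
  refine dimH_le_of_hausdorffMeasure_ne_top (ne_top_of_le_ne_top (b := ENNReal.ofReal
    (C * K ^ (d : ℝ))) ENNReal.ofReal_ne_top (hmeasure.trans
      (liminf_le_of_frequently_le' (Eventually.frequently ?_))))
  filter_upwards [hs, self_mem_nhdsWithin] with r hr (hr0 : 0 < r)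
  simp only [hediam]
  rw [Finset.sum_const, nsmul_eq_mul, Finset.card_univ, Fintype.card_coe,
    ENNReal.ofReal_rpow_of_nonneg (by positivity) d.coe_nonneg, ← ENNReal.ofReal_natCast,
    ← ENNReal.ofReal_mul (Nat.cast_nonneg _)]
  refine ENNReal.ofReal_le_ofReal ?_
  calc ((s r).card : ℝ) * (K * r) ^ (d : ℝ)
      ≤ C * (1 / r) ^ (d : ℝ) * (K * r) ^ (d : ℝ) := by gcongr; exact hr.2
    _ = C * K ^ (d : ℝ) := by
      rw [mul_assoc, ← Real.mul_rpow (by positivity) (by positivity)]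
      congr 2
      field_simp

theorem dimH_eq_zero_of_forall_exists_add {X S : Set ℝ} (hX : boxDim X ≤ 0) (F : Finset ℝ)
    (hS : ∀ x ∈ S, ∃ a ∈ F, ∃ u ∈ X, ∃ v ∈ X, x = a + u + v) : dimH S = 0 := by
  classical
  refine le_antisymm (ENNReal.le_of_forall_pos_le_add fun d hd _ => ?_) bot_le
  rw [zero_add]
  refine dimH_le_of_eventually_exists_cover (C := F.card) zero_le_two ?_
  have hd2 : (0 : ℝ) < d / 2 := half_pos (NNReal.coe_pos.2 hd)
  filter_upwards [eventually_exists_cover_card_le (hX.trans_lt (EReal.coe_pos.2 hd2)),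
    self_mem_nhdsWithin] with r ⟨s, hcover, hcard⟩ (hr : 0 < r)
  refine ⟨(F ×ˢ s ×ˢ s).image fun z => z.1 + z.2.1 + z.2.2, fun x hx => ?_, ?_⟩
  · obtain ⟨a, ha, u, hu, v, hv, rfl⟩ := hS x hx
    obtain ⟨p, hp, hpu⟩ := Set.mem_iUnion₂.1 (hcover hu)
    obtain ⟨q, hq, hqv⟩ := Set.mem_iUnion₂.1 (hcover hv)
    refine Set.mem_iUnion₂.2 ⟨a + p + q, Finset.mem_image.2 ⟨(a, p, q), ?_, rfl⟩, ?_⟩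
    · exact Finset.mem_product.2 ⟨ha, Finset.mem_product.2 ⟨hp, hq⟩⟩
    · constructor <;> linarith [hpu.1, hpu.2, hqv.1, hqv.2]
  · calc (((F ×ˢ s ×ˢ s).image fun z => z.1 + z.2.1 + z.2.2).card : ℝ)
        ≤ (F ×ˢ s ×ˢ s).card := Nat.cast_le.2 Finset.card_image_le
      _ = F.card * (s.card * s.card) := by simp only [Finset.card_product, Nat.cast_mul]
      _ ≤ F.card * ((1 / r) ^ (d / 2 : ℝ) * (1 / r) ^ (d / 2 : ℝ)) := by gcongr
      _ = F.card * (1 / r) ^ (d : ℝ) := by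
        rw [← Real.rpow_add (one_div_pos.2 hr), add_halves]

/-! ### Limits of one-sided sequences -/

/-- The height `[dₙ; dₙ₊₁, …] + [0; dₙ₋₁, …, d₀]` of a one-sided sequence. -/
def oneSidedHeight (d : ℕ → ℕ+) (n : ℕ) : ℝ :=
  ((d n : ℕ) : ℝ) + cfVal (fun i => d (i + (n + 1))) + cfPrepend (initialWord d n).reverse 0

theorem cfPrepend_zero_mem_Icc (w : List ℕ+) : cfPrepend w 0 ∈ Set.Icc (0 : ℝ) 1 :=
  cfPrepend_mem_Icc w (Set.left_mem_Icc.2 zero_le_one)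

theorem oneSidedHeight_pos (d : ℕ → ℕ+) (n : ℕ) : 0 < oneSidedHeight d n := by
  have hletter := one_le_cast (d n)
  have hright := (cfVal_mem_Icc fun i => d (i + (n + 1))).1
  have hleft := (cfPrepend_zero_mem_Icc (initialWord d n).reverse).1
  rw [oneSidedHeight]
  linarith

theorem cast_add_cfVal_le_oneSidedHeight (d : ℕ → ℕ+) (n : ℕ) :
    ((d n : ℕ) : ℝ) + cfVal (fun i => d (i + (n + 1))) ≤ oneSidedHeight d n :=
  le_add_of_nonneg_right (cfPrepend_zero_mem_Icc _).1

theorem lt_of_oneSidedHeight_lt {d : ℕ → ℕ+} {n A : ℕ} (h : oneSidedHeight d n < A) :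
    (d n : ℕ) < A := by
  have hle := cast_add_cfVal_le_oneSidedHeight d n
  have hright := (cfVal_mem_Icc fun i => d (i + (n + 1))).1
  exact_mod_cast (by linarith : ((d n : ℕ) : ℝ) < A)

theorem abs_cfPrepend_initialWord_sub_le (a : ℕ → ℕ+) (l : ℕ) {x y : ℝ}
    (hx : x ∈ Set.Icc (0 : ℝ) 1) (hy : y ∈ Set.Icc (0 : ℝ) 1) :
    |cfPrepend (initialWord a l) x - cfPrepend (initialWord a l) y| ≤ 2 / 2 ^ l := by
  have hpow : (2 : ℝ) ^ l ≤ 2 * (continuant (initialWord a l) : ℝ) ^ 2 := by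
    simpa using (by exact_mod_cast two_pow_length_le (initialWord a l) :
      (2 : ℝ) ^ (initialWord a l).length ≤ 2 * (continuant (initialWord a l) : ℝ) ^ 2)
  have hq : (0 : ℝ) < continuant (initialWord a l) := Nat.cast_pos.2 (continuant_pos _)
  have hxy : |x - y| ≤ 1 := by
    rw [abs_le]
    constructor <;> linarith [hx.1, hx.2, hy.1, hy.2]
  refine (abs_cfPrepend_sub_le _ hx.1 hy.1).trans ?_
  rw [div_le_div_iff₀ (by positivity) (by positivity)]
  exact (mul_le_of_le_one_left (by positivity) hxy).trans hpow

theorem reverse_initialWord (d : ℕ → ℕ+) {l n : ℕ} (hl : l ≤ n) :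
    (initialWord d n).reverse =
      initialWord (fun i => d (n - 1 - i)) l ++ (initialWord d (n - l)).reverse := by
  obtain ⟨m, rfl⟩ := Nat.exists_eq_add_of_le' hl
  rw [initialWord_add, List.reverse_append, Nat.add_sub_cancel]
  congr 1
  refine List.ext_getElem (by simp) fun i _ hi => ?_
  rw [length_initialWord] at hi
  simp only [List.getElem_reverse, getElem_initialWord, length_initialWord]
  congr 1
  lia

theorem abs_oneSidedHeight_sub_heightAt_le {d : ℕ → ℕ+} {θ : ℤ → ℕ+} {k : ℤ} {n l : ℕ}
    (hl : l ≤ n) (h : ∀ j ∈ Set.Icc (-l : ℤ) l, d (n + j).toNat = θ (k + j)) :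
    |oneSidedHeight d n - heightAt θ k| ≤ 4 / 2 ^ l := by
  have hletter : d n = θ k := by simpa using h 0 (by simp)
  have hrightWord :
      initialWord (fun i => d (i + (n + 1))) l = initialWord (fun m : ℕ => θ (k + 1 + m)) l := by
    refine initialWord_eq_initialWord_iff.2 fun i hi => ?_
    rw [show k + 1 + (i : ℤ) = k + (i + 1) by ring, ← h (i + 1) ⟨by lia, by lia⟩]
    congr 1
    lia
  have hleftWord :
      initialWord (fun i => d (n - 1 - i)) l = initialWord (fun m : ℕ => θ (k - 1 - m)) l := by
    refine initialWord_eq_initialWord_iff.2 fun i hi => ?_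
    rw [show k - 1 - (i : ℤ) = k + -(i + 1) by ring, ← h (-(i + 1)) ⟨by lia, by lia⟩]
    congr 1
    lia
  have hright : |cfVal (fun i => d (i + (n + 1))) - cfVal (fun m : ℕ => θ (k + 1 + m))| ≤
      2 / 2 ^ l := by
    rw [cfVal_eq_cfPrepend _ l, cfVal_eq_cfPrepend (fun m : ℕ => θ (k + 1 + m)) l, hrightWord]
    exact abs_cfPrepend_initialWord_sub_le _ _ (cfVal_mem_Icc _) (cfVal_mem_Icc _)
  have hleft : |cfPrepend (initialWord d n).reverse 0 - cfVal (fun m : ℕ => θ (k - 1 - m))| ≤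
      2 / 2 ^ l := by
    rw [reverse_initialWord d hl, cfPrepend_append, cfVal_eq_cfPrepend _ l, hleftWord]
    exact abs_cfPrepend_initialWord_sub_le _ _ (cfPrepend_zero_mem_Icc _) (cfVal_mem_Icc _)
  calc |oneSidedHeight d n - heightAt θ k|
      = |(cfVal (fun i => d (i + (n + 1))) - cfVal (fun m : ℕ => θ (k + 1 + m))) +
        (cfPrepend (initialWord d n).reverse 0 - cfVal (fun m : ℕ => θ (k - 1 - m)))| := by
        rw [oneSidedHeight, heightAt, hletter]
        congr 1
        ring
    _ ≤ 2 / 2 ^ l + 2 / 2 ^ l := (abs_add_le _ _).trans (add_le_add hright hleft)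
    _ = 4 / 2 ^ l := by ring

theorem tendsto_const_div_two_pow (C : ℝ) :
    Tendsto (fun l : ℕ => C / 2 ^ l) atTop (𝓝 0) :=
  tendsto_const_nhds.div_atTop (tendsto_pow_atTop_atTop_of_one_lt one_lt_two)

theorem tendsto_toNat_add {F : Filter ℕ} (hF : F ≤ atTop) (k : ℤ) :
    Tendsto (fun n : ℕ => ((n : ℤ) + k).toNat) F atTop := by
  refine Tendsto.mono_left (tendsto_atTop.2 fun b => ?_) hF
  filter_upwards [eventually_ge_atTop (b + k.natAbs)] with n hn
  lia

theorem tendsto_oneSidedHeight {F : Filter ℕ} (hF : F ≤ atTop) {d : ℕ → ℕ+} {θ : ℤ → ℕ+}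
    (h : ∀ k : ℤ, ∀ᶠ n : ℕ in F, d (n + k).toNat = θ k) (k : ℤ) :
    Tendsto (fun n : ℕ => oneSidedHeight d (n + k).toNat) F (𝓝 (heightAt θ k)) := by
  refine Metric.tendsto_nhds.2 fun ε hε => ?_
  obtain ⟨l, hl⟩ := ((tendsto_const_div_two_pow 4).eventually_lt_const hε).exists
  have hwindow : ∀ᶠ n : ℕ in F, ∀ j ∈ Set.Icc (-l : ℤ) l, d (n + (k + j)).toNat = θ (k + j) :=
    (eventually_all_finite (Set.finite_Icc _ _)).2 fun j _ => h (k + j)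
  filter_upwards [hwindow, (tendsto_toNat_add hF k).eventually_ge_atTop (l + 1)] with n hn hnl
  refine (abs_oneSidedHeight_sub_heightAt_le (by lia) fun j hj => ?_).trans_lt hl
  rw [← hn j hj]
  congr 1
  lia

theorem exists_ultrafilter_limit {U : Ultrafilter ℕ} (hU : ↑U ≤ (atTop : Filter ℕ)) {d : ℕ → ℕ+}
    {A : ℕ} (hd : ∀ᶠ n in atTop, (d n : ℕ) < A) :
    ∃ θ : ℤ → ℕ+, ∀ k : ℤ, ∀ᶠ n : ℕ in U, d (n + k).toNat = θ k := by
  suffices h : ∀ k : ℤ, ∃ c : ℕ+, ∀ᶠ n : ℕ in U, d (n + k).toNat = c from Classical.skolem.1 h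
  intro k
  have hfin : {c : ℕ+ | (c : ℕ) < A}.Finite :=
    (Set.finite_lt_nat A).preimage PNat.coe_injective.injOn
  have hunion : (⋃ c ∈ {c : ℕ+ | (c : ℕ) < A}, {n : ℕ | d (n + k).toNat = c}) ∈ U :=
    mem_of_superset ((tendsto_toNat_add hU k).eventually hd) fun n hn =>
      Set.mem_iUnion₂.2 ⟨_, hn, rfl⟩
  obtain ⟨c, -, hc⟩ := (Ultrafilter.finite_biUnion_mem_iff hfin).1 hunion
  exact ⟨c, hc⟩

theorem exists_mem_sigmaLe_of_mapClusterPt {d : ℕ → ℕ+} {x : ℝ}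
    (hlim : ∀ y, x < y → ∀ᶠ n in atTop, oneSidedHeight d n < y)
    (hcluster : MapClusterPt x atTop (oneSidedHeight d)) :
    ∃ θ ∈ sigmaLe x, heightAt θ 0 = x := by
  obtain ⟨U, hU, hUx⟩ := mapClusterPt_iff_ultrafilter.1 hcluster
  obtain ⟨A, hA⟩ := exists_nat_gt x
  obtain ⟨θ, hθ⟩ := exists_ultrafilter_limit hU ((hlim A hA).mono fun n => lt_of_oneSidedHeight_lt)
  have htendsto := tendsto_oneSidedHeight hU hθ
  refine ⟨θ, mem_sigmaLe.2 fun k => le_of_forall_gt_imp_ge_of_dense fun y hy => ?_, ?_⟩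
  · exact le_of_tendsto (htendsto k)
      (((tendsto_toNat_add hU k).eventually (hlim y hy)).mono fun _ => le_of_lt)
  · exact tendsto_nhds_unique (htendsto 0) (by simpa using hUx)

/-! ### Continued fraction expansions -/

/-- The complete quotients `α₀ = α`, `αₙ₊₁ = 1 / {αₙ}` of `α`. -/
def completeQuot (α : ℝ) : ℕ → ℝ
  | 0 => α
  | n + 1 => (Int.fract (completeQuot α n))⁻¹

/-- The partial quotients of the fractional part of `α`, so that `α = ⌊α⌋ + [0; b₀, b₁, …]` for
`bₙ = partialQuot α n` when `α` is irrational. -/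
def partialQuot (α : ℝ) (n : ℕ) : ℕ+ := ⌊completeQuot α (n + 1)⌋.toNat.toPNat'

theorem cfPrepend_zero_right (w : List ℕ+) :
    cfPrepend w 0 = continuantMatrix w 1 0 / continuant w := by
  rw [eq_div_iff (Nat.cast_ne_zero.2 (continuant_pos w).ne')]
  simpa [cfDenom] using cfPrepend_mul_cfDenom w le_rfl

section Irrational

variable {α : ℝ} (hα : Irrational α)

include hα

theorem irrational_completeQuot (n : ℕ) : Irrational (completeQuot α n) := by
  induction n with
  | zero => exact hα
  | succ n ih => exact (ih.sub_intCast _).inv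

theorem fract_completeQuot_pos (n : ℕ) : 0 < Int.fract (completeQuot α n) :=
  Int.fract_pos.2 ((irrational_completeQuot hα n).ne_int _)

theorem cast_partialQuot (n : ℕ) : ((partialQuot α n : ℕ) : ℝ) = ⌊completeQuot α (n + 1)⌋ := by
  have hfloor : 1 ≤ ⌊completeQuot α (n + 1)⌋ := by
    rw [Int.le_floor, Int.cast_one]
    exact ((one_lt_inv₀ (fract_completeQuot_pos hα n)).2 (Int.fract_lt_one _)).le
  rw [partialQuot, PNat.toPNat'_coe (by lia)]
  exact_mod_cast Int.toNat_of_nonneg (by lia)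

theorem completeQuot_succ_eq_add_fract (n : ℕ) :
    completeQuot α (n + 1) = partialQuot α n + Int.fract (completeQuot α (n + 1)) := by
  rw [cast_partialQuot hα, Int.floor_add_fract]

theorem fract_completeQuot_eq_one_div (n : ℕ) :
    Int.fract (completeQuot α n) = 1 / (partialQuot α n + Int.fract (completeQuot α (n + 1))) := by
  rw [← completeQuot_succ_eq_add_fract hα, completeQuot, one_div, inv_inv]

theorem fract_completeQuot_eq_cfPrepend (m n : ℕ) :
    Int.fract (completeQuot α m) = cfPrepend (initialWord (fun k => partialQuot α (k + m)) n)
      (Int.fract (completeQuot α (n + m))) := by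
  induction n generalizing m with
  | zero => simp [cfPrepend]
  | succ n ih =>
    rw [initialWord_succ', cfPrepend, fract_completeQuot_eq_one_div hα, ih (m + 1)]
    simp only [zero_add, add_assoc, add_comm 1 m]

theorem fract_completeQuot_eq_cfVal (m : ℕ) :
    Int.fract (completeQuot α m) = cfVal (fun k => partialQuot α (k + m)) := by
  set b : ℕ → ℕ+ := fun k => partialQuot α (k + m)
  have hle (l : ℕ) : |Int.fract (completeQuot α m) - cfVal b| ≤ 2 / 2 ^ l := by
    rw [fract_completeQuot_eq_cfPrepend hα m l, cfVal_eq_cfPrepend b l]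
    exact abs_cfPrepend_initialWord_sub_le b l
      ⟨Int.fract_nonneg _, (Int.fract_lt_one _).le⟩ (cfVal_mem_Icc _)
  exact sub_eq_zero.1 (abs_nonpos_iff.1 (ge_of_tendsto' (tendsto_const_div_two_pow 2) hle))

theorem convergent_completeQuot (m n : ℕ) :
    ((completeQuot α m).convergent n : ℝ) = ⌊completeQuot α m⌋ +
      cfPrepend (initialWord (fun k => partialQuot α (k + m)) n) 0 := by
  induction n generalizing m with
  | zero => simp [cfPrepend]
  | succ n ih =>
    have hfract : (Int.fract (completeQuot α m))⁻¹ = completeQuot α (m + 1) := rfl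
    rw [Real.convergent_succ, initialWord_succ', cfPrepend]
    push_cast
    rw [hfract, ih (m + 1), ← cast_partialQuot hα, one_div]
    simp only [zero_add, add_assoc, add_comm 1 m]

theorem convergent_eq_floor_add (n : ℕ) :
    (α.convergent n : ℝ) = ⌊α⌋ + cfPrepend (initialWord (partialQuot α) n) 0 :=
  convergent_completeQuot hα 0 n

theorem den_convergent (n : ℕ) :
    (α.convergent n).den = continuant (initialWord (partialQuot α) n) := by
  set w := initialWord (partialQuot α) n with hw
  have hpos : (0 : ℤ) < continuant w := by exact_mod_cast continuant_pos w
  have hne : (continuant w : ℝ) ≠ 0 := by exact_mod_cast hpos.ne'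
  have hconv : α.convergent n =
      ((continuantMatrix w 1 0 + ⌊α⌋ * continuant w : ℤ) : ℚ) / (continuant w : ℤ) := by
    have : (α.convergent n : ℝ) =
        (continuantMatrix w 1 0 + ⌊α⌋ * continuant w) / continuant w := by
      rw [convergent_eq_floor_add hα, ← hw, cfPrepend_zero_right]
      field_simp
      ring
    exact_mod_cast this
  have hcoprime : IsCoprime (continuantMatrix w 1 0 + ⌊α⌋ * continuant w : ℤ) (continuant w) :=
    (Nat.isCoprime_iff_coprime.2 (coprime_continuant w)).symm.add_mul_right_left _
  have hden := Rat.den_div_eq_of_coprime hpos (Int.isCoprime_iff_gcd_eq_one.1 hcoprime)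
  rw [← hconv] at hden
  exact_mod_cast hden

theorem tendsto_den_convergent : Tendsto (fun n => (α.convergent n).den) atTop atTop := by
  refine tendsto_atTop.2 fun b => ?_
  filter_upwards [eventually_ge_atTop (2 * b ^ 2)] with n hn
  by_contra! hlt
  have hlength := two_pow_length_le (initialWord (partialQuot α) n)
  rw [length_initialWord, ← den_convergent hα] at hlength
  have hsq : (α.convergent n).den ^ 2 ≤ b ^ 2 := Nat.pow_le_pow_left hlt.le 2
  have hpow : n < 2 ^ n := Nat.lt_two_pow_self
  lia

theorem one_div_abs_den_convergent_mul (n : ℕ) :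
    1 / |((α.convergent n).den : ℝ) * ((α.convergent n).den * α - (α.convergent n).num)| =
      oneSidedHeight (partialQuot α) n := by
  set w := initialWord (partialQuot α) n with hw
  set x := Int.fract (completeQuot α n)
  set Q : ℝ := ((α.convergent n).den : ℝ)
  have hx : 0 < x := fract_completeQuot_pos hα n
  have hQ : 0 < Q := Nat.cast_pos.2 (α.convergent n).den_pos
  have hcontinuant : (continuant w : ℝ) = Q := by rw [hw, ← den_convergent hα]
  have hdiff : α - α.convergent n = cfPrepend w x - cfPrepend w 0 := by
    have : Int.fract α = cfPrepend w x := fract_completeQuot_eq_cfPrepend hα 0 n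
    rw [convergent_eq_floor_add hα, ← this, ← hw, Int.fract, sub_sub]
  have herror : |α - α.convergent n| * (cfDenom w x * Q) = x := by
    have h := abs_cfPrepend_sub_mul w hx.le le_rfl
    have hzero : cfDenom w 0 = Q := by simp [cfDenom, hcontinuant]
    rwa [← hdiff, sub_zero, abs_of_pos hx, hzero] at h
  have hleft : cfPrepend w.reverse 0 = continuantMatrix w 0 1 / Q := by
    simp [cfPrepend_zero_right, continuant_reverse, continuantMatrix_reverse, hcontinuant]
  have hright : ((partialQuot α n : ℕ) : ℝ) + cfVal (fun i => partialQuot α (i + (n + 1))) =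
      x⁻¹ := by
    rw [← fract_completeQuot_eq_cfVal hα, ← completeQuot_succ_eq_add_fract hα, completeQuot]
  have hnum : ((α.convergent n).num : ℝ) = α.convergent n * Q := by
    rw [Rat.cast_def, div_mul_cancel₀ _ hQ.ne']
  have habs : |Q * (Q * α - (α.convergent n).num)| = Q ^ 2 * |α - α.convergent n| := by
    have hfactor : Q * (Q * α - (α.convergent n).num) = Q ^ 2 * (α - α.convergent n) := by
      rw [hnum]
      ring
    rw [hfactor, abs_mul, abs_of_pos (pow_pos hQ 2)]
  have hD : 0 < cfDenom w x := cfDenom_pos w hx.le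
  rw [habs, (eq_div_iff (mul_pos hD hQ).ne').2 herror, oneSidedHeight, hright, ← hw, hleft]
  rw [cfDenom, hcontinuant] at hD ⊢
  field_simp

end Irrational

theorem exists_eq_mul_convergent {α : ℝ} {p : ℤ} {q : ℕ} (hq : 0 < q)
    (h : 2 * |(q : ℝ) * (q * α - p)| < 1) :
    ∃ (n k : ℕ), 0 < k ∧ p = k * (α.convergent n).num ∧ q = k * (α.convergent n).den := by
  set r : ℚ := Rat.divInt p q with hr
  obtain ⟨k, hp, hqk⟩ := Rat.num_den_mk (by exact_mod_cast hq.ne') hr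
  have hk : 0 < k := by
    have hpos : (0 : ℤ) < k * r.den := hqk ▸ by exact_mod_cast hq
    exact pos_of_mul_pos_left hpos (Nat.cast_nonneg _)
  lift k to ℕ using hk.le
  have hqk' : (q : ℝ) = k * r.den := by exact_mod_cast hqk
  have hclose : |α - r| < 1 / (2 * (r.den : ℝ) ^ 2) := by
    have hden : (0 : ℝ) < r.den := by exact_mod_cast r.den_pos
    have hfactor : (q : ℝ) * (q * α - p) = k ^ 2 * (r.den ^ 2 * (α - r)) := by
      rw [hqk', hp, Rat.cast_def r]
      push_cast
      field_simp
    rw [hfactor, abs_mul, abs_of_nonneg (by positivity), abs_mul, abs_of_pos (by positivity)] at h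
    have hk1 : (1 : ℝ) ≤ (k : ℝ) ^ 2 := one_le_pow₀ (by exact_mod_cast hk)
    rw [lt_div_iff₀ (by positivity)]
    nlinarith [abs_nonneg (α - r)]
  obtain ⟨n, hn⟩ := Real.exists_rat_eq_convergent hclose
  exact ⟨n, k, by exact_mod_cast hk, hn ▸ hp, hn ▸ by exact_mod_cast hqk⟩

theorem exists_lt_oneSidedHeight {α : ℝ} (hα : Irrational α) {y : ℝ} (hy : 2 ≤ y) {p : ℤ} {q : ℕ}
    (hq : 0 < q) (h : y < 1 / |(q : ℝ) * (q * α - p)|) :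
    ∃ n, y < oneSidedHeight (partialQuot α) n ∧
      (q : ℝ) < oneSidedHeight (partialQuot α) n * (α.convergent n).den := by
  have hpos : 0 < |(q : ℝ) * (q * α - p)| := one_div_pos.1 (by linarith)
  have hlt := (lt_div_iff₀ hpos).1 h
  obtain ⟨n, k, hk, rfl, rfl⟩ := exists_eq_mul_convergent (α := α) (p := p) hq (by nlinarith)
  refine ⟨n, ?_⟩
  have hquality := one_div_abs_den_convergent_mul hα n
  have hH := oneSidedHeight_pos (partialQuot α) n
  set H := oneSidedHeight (partialQuot α) n
  set Q : ℝ := ((α.convergent n).den : ℝ)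
  have hQ : 0 < Q := Nat.cast_pos.2 (α.convergent n).den_pos
  have hk1 : (1 : ℝ) ≤ k := by exact_mod_cast hk
  have hkk : (k : ℝ) ≤ k ^ 2 := le_self_pow₀ hk1 two_ne_zero
  have hfactor : ((k * (α.convergent n).den : ℕ) : ℝ) * ((k * (α.convergent n).den : ℕ) * α -
      (k * (α.convergent n).num : ℤ)) = k ^ 2 * (Q * (Q * α - (α.convergent n).num)) := by
    push_cast
    ring
  have hy2 : y * (k : ℝ) ^ 2 < H := by
    rwa [hfactor, abs_mul, abs_of_pos (by positivity : (0 : ℝ) < k ^ 2), ← div_div, div_right_comm,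
      hquality, lt_div_iff₀ (by positivity)] at h
  constructor
  · nlinarith
  · push_cast
    gcongr
    nlinarith

/-! ### The Lagrange spectrum -/

section BestConst

variable {α y : ℝ} (hα : Irrational α)

include hα

theorem eventually_oneSidedHeight_lt (hy : bestConst α < y) :
    ∀ᶠ n in atTop, oneSidedHeight (partialQuot α) n < y := by
  have htendsto : Tendsto (fun n => ((α.convergent n).num, (α.convergent n).den)) atTop
      (comap Prod.snd atTop) := tendsto_comap_iff.2 (tendsto_den_convergent hα)
  filter_upwards [htendsto.eventually (eventually_lt_of_limsup_lt hy)] with n hn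
  rw [← one_div_abs_den_convergent_mul hα]
  exact_mod_cast hn

theorem frequently_lt_oneSidedHeight (hy2 : 2 ≤ y) (hy : y < bestConst α) :
    ∃ᶠ n in atTop, y < oneSidedHeight (partialQuot α) n := by
  set H := fun n => oneSidedHeight (partialQuot α) n * (α.convergent n).den
  refine frequently_atTop.2 fun m => ?_
  obtain ⟨b, hb⟩ := exists_nat_gt (∑ n ∈ Finset.range m, H n)
  have hlarge : ∀ᶠ z : ℤ × ℕ in comap Prod.snd atTop, b + 1 ≤ z.2 :=
    tendsto_comap.eventually (eventually_ge_atTop (b + 1))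
  obtain ⟨⟨p, q⟩, hpq, hbq⟩ :=
    ((frequently_lt_of_lt_limsup (by isBoundedDefault) hy).and_eventually hlarge).exists
  obtain ⟨n, hn, hnq⟩ :=
    exists_lt_oneSidedHeight hα hy2 (p := p) (q := q) (by lia) (by exact_mod_cast hpq)
  refine ⟨n, not_lt.1 fun hnm => ?_, hn⟩
  have hsum : H n ≤ ∑ n ∈ Finset.range m, H n := Finset.single_le_sum (f := H)
    (fun i _ => mul_nonneg (oneSidedHeight_pos _ i).le (Nat.cast_nonneg _)) (Finset.mem_range.2 hnm)
  have hbq' : (b : ℝ) + 1 ≤ q := by exact_mod_cast hbq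
  linarith

end BestConst

theorem le_oneSidedHeight_of_forall_eq_one {d : ℕ → ℕ+} {n : ℕ} (h : ∀ k ≥ n, d k = 1) :
    21 / 10 ≤ oneSidedHeight d (n + 1) := by
  have hrec (k : ℕ) (hk : n ≤ k) :
      cfVal (fun i => d (i + k)) = 1 / (1 + cfVal (fun i => d (i + (k + 1)))) := by
    rw [cfVal_eq_one_div, zero_add, h k hk, PNat.one_coe, Nat.cast_one]
    simp only [add_assoc, add_comm 1 k]
  have hhalf : 1 / 2 ≤ cfVal (fun i => d (i + (n + 4))) := by
    refine one_div_le_cfVal (A := 2) ?_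
    rw [h _ (by lia), PNat.one_coe]
    exact one_lt_two
  have htwoThirds : cfVal (fun i => d (i + (n + 3))) ≤ 2 / 3 := by
    rw [hrec _ (by lia), div_le_iff₀ (by linarith)]
    linarith
  have hright : 3 / 5 ≤ cfVal (fun i => d (i + (n + 2))) := by
    have := (cfVal_mem_Icc fun i => d (i + (n + 3))).1
    rw [hrec _ (by lia), le_div_iff₀ (by linarith)]
    linarith
  have hleft : 1 / 2 ≤ cfPrepend (initialWord d (n + 1)).reverse 0 := by
    rw [initialWord_succ, List.reverse_append, List.reverse_singleton, List.singleton_append,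
      cfPrepend, h n le_rfl, PNat.one_coe, Nat.cast_one]
    have := cfPrepend_zero_mem_Icc (initialWord d n).reverse
    exact one_div_le_one_div_of_le (by linarith [this.1]) (by linarith [this.2])
  rw [oneSidedHeight, h (n + 1) (by lia), PNat.one_coe, Nat.cast_one]
  linarith

theorem frequently_le_oneSidedHeight (d : ℕ → ℕ+) :
    ∃ᶠ n in atTop, 21 / 10 ≤ oneSidedHeight d n := by
  by_contra hfreq
  simp only [not_frequently, not_le] at hfreq
  have hlt (n : ℕ) (hn : oneSidedHeight d n < 21 / 10) : (d n : ℕ) < 3 :=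
    lt_of_oneSidedHeight_lt (hn.trans (by norm_num))
  obtain ⟨m, hm⟩ := eventually_atTop.1 hfreq
  have hone (n : ℕ) (hn : m ≤ n) : d n = 1 := by
    have htail : (1 : ℝ) / (3 : ℕ) ≤ cfVal (fun i => d (i + (n + 1))) :=
      one_div_le_cfVal (hlt _ (hm _ (by lia)))
    have hle := cast_add_cfVal_le_oneSidedHeight d n
    have hlt2 : ((d n : ℕ) : ℝ) < (2 : ℕ) := by
      push_cast at htail ⊢
      linarith [hm n hn]
    exact PNat.coe_eq_one_iff.1 (le_antisymm (Nat.lt_succ_iff.1 (Nat.cast_lt.1 hlt2)) (d n).pos)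
  exact (hm (m + 1) m.le_succ).not_ge (le_oneSidedHeight_of_forall_eq_one hone)

theorem two_lt_bestConst {α : ℝ} (hα : Irrational α) : (2 : ℝ) < bestConst α := by
  refine lt_of_lt_of_le (b := ((21 / 10 : ℝ) : EReal)) (by norm_num) (not_lt.1 fun hlt => ?_)
  obtain ⟨n, hn, hn'⟩ := ((frequently_le_oneSidedHeight (partialQuot α)).and_eventually
    (eventually_oneSidedHeight_lt hα hlt)).exists
  exact hn.not_gt hn'

theorem exists_mem_sigmaLe_of_bestConst {α x : ℝ} (hα : Irrational α) (hx : bestConst α = x) :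
    ∃ θ ∈ sigmaLe x, heightAt θ 0 = x := by
  have hlt (y : ℝ) (hy : x < y) : ∀ᶠ n in atTop, oneSidedHeight (partialQuot α) n < y :=
    eventually_oneSidedHeight_lt hα (hx.trans_lt (EReal.coe_lt_coe_iff.2 hy))
  have hx2 : 2 < x := EReal.coe_lt_coe_iff.1 (hx ▸ two_lt_bestConst hα)
  refine exists_mem_sigmaLe_of_mapClusterPt hlt (mapClusterPt_iff_frequently.2 fun s hs => ?_)
  obtain ⟨ε, hε, hball⟩ := Metric.mem_nhds_iff.1 hs
  have hmax : max 2 (x - ε) < x := max_lt hx2 (sub_lt_self x hε)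
  refine ((frequently_lt_oneSidedHeight hα (le_max_left 2 (x - ε))
    (hx ▸ EReal.coe_lt_coe_iff.2 hmax)).and_eventually (hlt (x + ε) (by linarith))).mono
    fun n hn => hball ?_
  rw [Metric.mem_ball, Real.dist_eq, abs_lt]
  have := (le_max_right 2 (x - ε)).trans_lt hn.1
  constructor <;> linarith [hn.2]

theorem dimLagrange_eq_zero {t : ℝ} (h : deltaPlus t ≤ 0) : dimLagrange t = 0 := by
  obtain ⟨A, htA⟩ := exists_nat_gt t
  refine dimH_eq_zero_of_forall_exists_add h ((Finset.range A).map Nat.castEmbedding) ?_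
  rintro x ⟨⟨α, hα, hx⟩, hxt : x < t⟩
  obtain ⟨θ, hθ, rfl⟩ := exists_mem_sigmaLe_of_bestConst hα hx
  have hθt : θ ∈ sigmaLe t := mem_sigmaLe.2 fun n => (mem_sigmaLe.1 hθ n).trans hxt.le
  refine ⟨(θ 0 : ℕ), Finset.mem_map_of_mem _ (Finset.mem_range.2 (lt_of_mem_sigmaLe htA hθt 0)),
    _, ⟨_, shift_mem_sigmaLe hθt 1, rfl⟩,
    _, ⟨_, shift_mem_sigmaLe (mirror_mem_sigmaLe hθt) 1, rfl⟩, ?_⟩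
  have hright (m : ℕ) : (0 : ℤ) + 1 + m = m + 1 := by ring
  have hleft (m : ℕ) : (0 : ℤ) - 1 - m = -(m + 1) := by ring
  simp only [heightAt, hright, hleft]

theorem mem_one_to_four_of_mem_sigmaLe {t : ℝ} (ht : t < 5) {θ : ℤ → ℕ+} (h : θ ∈ sigmaLe t)
    (n : ℤ) : θ n ∈ ({1, 2, 3, 4} : Set ℕ+) := by
  have hlt : (θ n : ℕ) < 5 := lt_of_mem_sigmaLe (by exact_mod_cast ht) h n
  have hpos := (θ n).pos
  simp only [Set.mem_insert_iff, Set.mem_singleton_iff, ← PNat.coe_inj]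
  change (θ n : ℕ) = 1 ∨ (θ n : ℕ) = 2 ∨ (θ n : ℕ) = 3 ∨ (θ n : ℕ) = 4
  omega

end

end GaussCantor

theorem mainTheorem3_general (η t : ℝ) (hη : 0 < η) (hd : 0 < GaussCantor.dimLagrange t) :
    ∃ (δ : ℝ) (B : Finset (List ℕ+)), 0 < δ ∧ GaussCantor.IsAlphabet B ∧
      GaussCantor.completeShift B ⊆ GaussCantor.sigmaLe (t - δ) ∧
      ((1 - η : ℝ) : EReal) * GaussCantor.deltaPlus t ≤
        ((dimH (GaussCantor.gaussCantorSet B) : ENNReal) : EReal) := by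
  have hpos : 0 < GaussCantor.deltaPlus t := by
    by_contra! h
    exact hd.ne' (GaussCantor.dimLagrange_eq_zero h)
  obtain ⟨D, hD⟩ : ∃ D : ℝ, GaussCantor.deltaPlus t = D :=
    ⟨_, (EReal.coe_toReal (ne_top_of_le_ne_top (EReal.coe_ne_top 1)
      (GaussCantor.deltaPlus_le_one t)) (ne_bot_of_gt hpos)).symm⟩
  have hD0 : 0 < D := by
    rw [hD] at hpos
    exact_mod_cast hpos
  obtain ⟨δ, B, hδ, hB, hBt, hdim⟩ := GaussCantor.exists_alphabet_of_deltaPlus hD0 hD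
    (lt_min hη one_pos) (min_le_right _ _)
  refine ⟨δ, B, hδ, hB, hBt, ?_⟩
  rw [hD, ← EReal.coe_mul]
  calc (((1 - η) * D : ℝ) : EReal) ≤ (((1 - min η 1) * D : ℝ) : EReal) := by
        norm_cast
        gcongr
        exact min_le_left _ _
    _ ≤ ((ENNReal.ofReal ((1 - min η 1) * D) : ENNReal) : EReal) := by
        rw [EReal.coe_ennreal_ofReal]
        exact_mod_cast le_max_left _ _
    _ ≤ _ := EReal.coe_ennreal_le_coe_ennreal_iff.2 hdim

theorem mainTheorem3 (η t : ℝ) (hη : 0 < η) (ht3 : 3 ≤ t) (ht5 : t < 5)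
    (hd : 0 < GaussCantor.dimLagrange t) :
    ∃ (δ : ℝ) (B : Finset (List ℕ+)), 0 < δ ∧ GaussCantor.IsAlphabet B ∧
      (∀ θ ∈ GaussCantor.completeShift B, ∀ n : ℤ, θ n ∈ ({1, 2, 3, 4} : Set ℕ+)) ∧
      GaussCantor.completeShift B ⊆ GaussCantor.sigmaLe (t - δ) ∧
      ((1 - η : ℝ) : EReal) * GaussCantor.deltaPlus t ≤
        ((dimH (GaussCantor.gaussCantorSet B) : ENNReal) : EReal) := by
  obtain ⟨δ, B, hδ, hB, hBt, hdim⟩ := mainTheorem3_general η t hη hd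
  exact ⟨δ, B, hδ, hB,
    fun θ hθ => GaussCantor.mem_one_to_four_of_mem_sigmaLe (by linarith) (hBt hθ), hBt, hdim⟩
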